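/- **Model.** Two companies have free surpluses $X_t=x+p_1t-\sum_{i\le N^1_t}U^{(1)}_i$ and $Y_t=y+p_2t-\sum_{i\le N^2_t}U^{(2)}_i$, where $N^1,N^2$ are Poisson processes with intensities $\lambda_1,\lambda_2>0$, the claims $U^{(k)}_i>0$ have a continuous distribution $F^k$ with finite mean, all these objects are independent, and $p_k>\lambda_kE(U^{(k)}_i)$. Put $\lambda=\lambda_1+\lambda_2$; let $\delta>0$, $a_1\in[0,1]$, $a_2=1-a_1$. Let $\mathbf R_+^2=[0,\infty)^2$. A dividend strategy $\overline L=(L^1,L^2)$ consists of cumulative dividend processes that are non-decreasing, left continuous with right limits, zero at time $0$, and predictable for the filtration generated by $(X,Y)$. If a claim makes the surplus of one company negative while the joint surplus stays non-negative, the other company transfers the exact deficit; $X^{\overline L},Y^{\overline L}$ are the surpluses after dividends and transfers, and $\overline\tau=\inf\{t\ge 0: X^{\overline L}_t+Y^{\overline L}_t<0\}$. The strategy is admissible, $\overline L\in\Pi_{x,y}$, if both surpluses are non-negative before $\overline\tau$ and the joint surplus is negative at $\overline\tau$ when $\overline\tau<\infty$ (ruin is caused by a claim, not by paying dividends). Its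 value is $$V_{\overline L}(x,y)=E\Big(\sum_{k=1,2}a_k\int_{[0,\overline\tau)}e^{-\delta s}dL^k_s+e^{-\delta\overline\tau}\big(a_1V_1^0(X^{\overline L}_{\overline\tau})+a_2V_2^0(Y^{\overline L}_{\overline\tau})\big)\Big),$$ where $V_k^0$ is the optimal expected discounted dividend value of company $k$ alone, extended by $0$ to negative surpluses. Let $\tau_n$ be the time of the $n$-th claim of either company ($\tau_0=0$), let $\Pi^n_{x,y}$ be the set of $\overline L\in\Pi_{x,y}$ for which right after $\tau_n$ (if $\tau_n<\overline\tau$) each company pays out its whole surplus and from then on, until $\overline\tau$, its incoming premium, and let $V^n(x,y)=\sup_{\overline L\in\Pi^n_{x,y}}V_{\overline L}(x,y)$, $n\ge 0$. Put $H_n=\mathcal I(V^n)+U$ on $\mathbf R_+^2$ with $$\mathcal I(W)(x,y)=\lambda_1\!\int_0^x\! W(x-\alpha,y)dF^1(\alpha)+\lambda_1\!\int_x^{x+y}\! W(0,x+y-\alpha)dF^1(\alpha)+\lambda_2\!\int_0^y\! W(x,y-\alpha)dF^2(\alpha)+\lambda_2\!\int_y^{x+y}\! W(x+y-\alpha,0)dF^2(\alpha),$$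 $$U(x,y)=\lambda_1a_2V_2^0(y)(1-F^1(x+y))+\lambda_2a_1V_1^0(x)(1-F^2(x+y)).$$ **Curve strategies.** Let $(\overline x,\overline y)\in\mathbf R_+^2$, $\overline u=\overline x-\frac{p_1}{p_2}\overline y$, $\overline v=\overline y-\frac{p_2}{p_1}\overline x$, and let $\xi_1:[\overline u,M_{\xi_1}]\to\mathbf R_+$, $\xi_2:[\overline v,M_{\xi_2}]\to\mathbf R_+$ be continuously differentiable with negative derivative, $M_{\xi_i}\ge0$, $\xi_i(M_{\xi_i})=0$, $\xi_1(\overline u)=\overline y$, $\xi_2(\overline v)=\overline x$, such that the curves $\{(u+\frac{p_1}{p_2}\xi_1(u),\xi_1(u))\}$ and $\{(\xi_2(v),v+\frac{p_2}{p_1}\xi_2(v))\}$ lie in $\mathbf R_+^2$. The curve strategy of $\overline\xi=((\overline x,\overline y),\xi_1,\xi_2)$ pays as follows. In $[\overline x,\infty)\times[\overline y,\infty)$ the companies pay lump sums down to $(\overline x,\overline y)$, and at $(\overline x,\overline y)$ they pay their incoming premiums. At points with $y\le\overline y$ to the right of the first curve, Company One pays a lump sum down to the curve, and on the curve it pays at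 the rate that keeps the surpluses on the curve; symmetrically for Company Two above the second curve. At the remaining points nothing is paid. For $n\ge1$ let $V^{n,\overline\xi}(x,y)$ be the expected discounted weighted dividends of this strategy up to the first claim time $\tau_1$, plus $e^{-\delta\tau_1}V^{n-1}$ at the surpluses after the claim if $\tau_1<\overline\tau$, or $e^{-\delta\overline\tau}(a_1V_1^0+a_2V_2^0)$ at the respective surpluses if $\tau_1=\overline\tau$. **Proposition.** Let $n\ge1$. Assume that $H_{n-1}$ is differentiable on $\mathbf R_+^2$ and that $V^n=V^{n,\overline\xi^*}$ on $\mathbf R_+^2$ for some such $\overline\xi^*=((\overline x^*,\overline y^*),\xi_1^*,\xi_2^*)$, and write $\overline u^*,\overline v^*$ for the corresponding $\overline u,\overline v$. Then $$\partial_xH_{n-1}\big(u+\tfrac{p_1}{p_2}\xi_1^*(u),\xi_1^*(u)\big)=a_1(\delta+\lambda)$$ for all $u\in[\overline u^*,M_{\xi_1^*}]$ with $u+\frac{p_1}{p_2}\xi_1^*(u)>0$, and $$\partial_yH_{n-1}\big(\xi_2^*(v),v+\tfrac{p_2}{p_1}\xi_2^*(v)\big)=a_2(\delta+\lambda)$$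 for all $v\in[\overline v^*,M_{\xi_2^*}]$ with $v+\frac{p_2}{p_1}\xi_2^*(v)>0$. -/

import Mathlib

open MeasureTheory ProbabilityTheory Set Filter Topology
open scoped NNReal ENNReal

noncomputable section

namespace Collab

/-- The data of the two collaborating companies (Company One is `0`, Company Two is `1`):
premium rates `p`, claim intensities `lam`, claim size distributions `F` (continuous, on the
positive half-line, with finite mean), weights `a`, discount factor `δ`. -/
structure Model where
  p : Fin 2 → ℝ
  lam : Fin 2 → ℝ
  F : Fin 2 → Measure ℝ
  a : Fin 2 → ℝ
  δ : ℝ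
  lam_pos : ∀ k, 0 < lam k
  F_prob : ∀ k, IsProbabilityMeasure (F k)
  F_continuous : ∀ k u, F k {u} = 0
  F_pos : ∀ k, F k (Iic 0) = 0
  F_integrable : ∀ k, Integrable (fun u : ℝ => u) (F k)
  net_profit : ∀ k, lam k * ∫ u, u ∂(F k) < p k
  a_nonneg : ∀ k, 0 ≤ a k
  a_sum : a 0 + a 1 = 1
  δ_pos : 0 < δ

/-- The other company. -/
def other (k : Fin 2) : Fin 2 := 1 - k

/-! ### The canonical probability space of the two independent compound Poisson processes -/

/-- Arrival time of claim number `i` (counted from `0`) of company `k`, where `(q (k, i)).1` is the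
waiting time before that claim and `(q (k, i)).2` is its size. -/
def rawArrival (q : Fin 2 × ℕ → ℝ × ℝ) (k : Fin 2) (i : ℕ) : ℝ :=
  ∑ j ∈ Finset.range (i + 1), (q (k, j)).1

/-- Scenarios: sequences of (waiting time, claim size) for both companies. The constraints
hold with probability one: waiting times and claims are positive, arrival times do
not accumulate, and no two claims arrive simultaneously. -/
def Scenario : Type :=
  {q : Fin 2 × ℕ → ℝ × ℝ // (∀ r, 0 < (q r).1 ∧ 0 < (q r).2) ∧
    (∀ k, Tendsto (rawArrival q k) atTop atTop) ∧
    (∀ i j, rawArrival q 0 i ≠ rawArrival q 1 j)}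

instance : MeasurableSpace Scenario := inferInstanceAs (MeasurableSpace (Subtype _))

/-- The law of the claims: all waiting times and claim sizes are independent, those of company `k`
being exponential with parameter `lam k`, respectively `F k`-distributed. -/
def law (m : Model) : Measure Scenario :=
  (Measure.infinitePi fun r : Fin 2 × ℕ => (expMeasure (m.lam r.1)).prod (m.F r.1)).comap
    Subtype.val

def arrival (k : Fin 2) (i : ℕ) (ω : Scenario) : ℝ := rawArrival ω.1 k i

def claimSize (k : Fin 2) (i : ℕ) (ω : Scenario) : ℝ := (ω.1 (k, i)).2

/-- The Poisson process `N^k`. -/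
def claimCount (k : Fin 2) (t : ℝ≥0) (ω : Scenario) : ℕ := {i | arrival k i ω ≤ t}.ncard

/-- Total claims of company `k` up to time `t`. -/
def aggregateClaims (k : Fin 2) (t : ℝ≥0) (ω : Scenario) : ℝ :=
  ∑ i ∈ Finset.range (claimCount k t ω), claimSize k i ω

/-- The free surplus of company `k` (before dividends and transfers), started at `z k`. -/
def freeSurplus (m : Model) (z : Fin 2 → ℝ) (k : Fin 2) (t : ℝ≥0) (ω : Scenario) : ℝ :=
  z k + m.p k * t - aggregateClaims k t ω

/-- `N = N^1 + N^2`. -/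
def totalCount (t : ℝ≥0) (ω : Scenario) : ℕ := claimCount 0 t ω + claimCount 1 t ω

/-- The arrival time of the `n`-th claim regardless from which company (`claimTime 0 = 0`). -/
def claimTime (n : ℕ) (ω : Scenario) : ℝ≥0 := sInf {t | n ≤ totalCount t ω}

theorem arrival_strictMono (k : Fin 2) (ω : Scenario) : StrictMono fun i => arrival k i ω := by
  refine strictMono_nat_of_lt_succ fun i => ?_
  have h := (ω.2.1 (k, i + 1)).1
  simp only [arrival, rawArrival]
  rw [Finset.sum_range_succ _ (i + 1)]
  linarith

theorem lt_claimCount_iff (k : Fin 2) (t : ℝ≥0) (ω : Scenario) (i : ℕ) :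
    i < claimCount k t ω ↔ arrival k i ω ≤ t := by
  have hmono := arrival_strictMono k ω
  obtain ⟨N, hN⟩ := ((ω.2.2.1 k).eventually_gt_atTop (t : ℝ)).exists
  have hex : ∃ i, ¬ arrival k i ω ≤ t := ⟨N, not_le.2 hN⟩
  classical
  have hset : {i | arrival k i ω ≤ t} = (Finset.range (Nat.find hex) : Set ℕ) := by
    ext i
    simp only [mem_ofPred_eq, Finset.coe_range, mem_Iio]
    constructor
    · intro hi
      by_contra hlt
      exact Nat.find_spec hex ((hmono.monotone (not_lt.1 hlt)).trans hi)
    · intro hi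
      exact not_not.1 (Nat.find_min hex hi)
  have hcount : claimCount k t ω = Nat.find hex := by
    rw [claimCount, hset, Set.ncard_coe_finset, Finset.card_range]
  rw [hcount]
  have := Set.ext_iff.1 hset i
  simpa using this.symm

theorem measurable_arrival (k : Fin 2) (i : ℕ) : Measurable (arrival k i) := by
  have h : Measurable fun ω : Scenario => ∑ j ∈ Finset.range (i + 1), (ω.1 (k, j)).1 :=
    Finset.measurable_sum _ fun j _ =>
      measurable_fst.comp ((measurable_pi_apply (k, j)).comp measurable_subtype_coe)
  exact h

theorem measurable_claimSize (k : Fin 2) (i : ℕ) : Measurable (claimSize k i) :=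
  measurable_snd.comp ((measurable_pi_apply (k, i)).comp measurable_subtype_coe)

theorem measurable_claimCount (k : Fin 2) (t : ℝ≥0) : Measurable (claimCount k t) := by
  refine measurable_of_Ioi fun n => ?_
  have : claimCount k t ⁻¹' Ioi n = {ω | arrival k n ω ≤ t} := by
    ext ω
    exact lt_claimCount_iff k t ω n
  rw [this]
  exact measurableSet_le (measurable_arrival k n) measurable_const

theorem measurable_aggregateClaims (k : Fin 2) (t : ℝ≥0) : Measurable (aggregateClaims k t) := by
  have h : Measurable fun x : ℕ × Scenario => ∑ i ∈ Finset.range x.1, claimSize k i x.2 :=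
    measurable_from_prod_countable_right fun n =>
      Finset.measurable_sum (Finset.range n) fun i _ => measurable_claimSize k i
  exact h.comp ((measurable_claimCount k t).prodMk measurable_id)

/-- The filtration generated by the bivariate process `(X, Y)`. (The free surplus and the
aggregate claims differ by a deterministic function, so they generate the same filtration.) -/
def filtration : Filtration ℝ≥0 (inferInstance : MeasurableSpace Scenario) :=
  Filtration.natural (fun t ω => fun k : Fin 2 => aggregateClaims k t ω) fun t =>
    (measurable_pi_lambda _ fun k => measurable_aggregateClaims k t).stronglyMeasurable

/-- The filtration generated by the surplus process of company `k` alone. -/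
def filtrationAlone (k : Fin 2) : Filtration ℝ≥0 (inferInstance : MeasurableSpace Scenario) :=
  Filtration.natural (fun t ω => aggregateClaims k t ω) fun t =>
    (measurable_aggregateClaims k t).stronglyMeasurable

/-! ### Dividend processes and discounted dividends -/

/-- Cumulative dividend processes: predictable, starting at `0`, non-decreasing and left continuous
with right limits (the right limits exist by monotonicity). Only their values up to
the ruin time are ever used. -/
structure IsDividendProcess (ℱ : Filtration ℝ≥0 (inferInstance : MeasurableSpace Scenario))
    (L : ℝ≥0 → Scenario → ℝ) : Prop where
  predictable : IsStronglyPredictable ℱ L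
  zero : ∀ ω, L 0 ω = 0
  mono : ∀ ω, Monotone fun t => L t ω
  left_continuous : ∀ ω t, ContinuousWithinAt (fun s => L s ω) (Iic t) t

open Classical in
/-- The measure `dℓ` of a non-decreasing left continuous path `ℓ` with `ℓ 0 = 0`, extended by `0` to
negative times: it gives `[s, t)` the mass `ℓ t - ℓ s`, so that a lump sum `ℓ (0+)`
paid at time `0` is a point mass at `0`. -/
def dividendMeasure (ℓ : ℝ≥0 → ℝ) : Measure ℝ :=
  if h : Monotone fun t : ℝ => ℓ t.toNNReal then h.stieltjesFunction.measure else 0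

/-- `∫_{[0, T)} e^{-δ s} dℓ_s`. -/
def discountedDividends (δ : ℝ) (ℓ : ℝ≥0 → ℝ) (T : ℝ≥0∞) : ℝ≥0∞ :=
  ∫⁻ s in {s : ℝ | 0 ≤ s ∧ ENNReal.ofReal s < T}, ENNReal.ofReal (Real.exp (-δ * s))
    ∂(dividendMeasure ℓ)

/-! ### The stand-alone problem of one company -/

/-- Ruin time of company `k` alone with initial surplus `x` under the dividend process `L`. -/
def ruinTimeAlone (m : Model) (k : Fin 2) (x : ℝ) (L : ℝ≥0 → Scenario → ℝ) (ω : Scenario) :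
    ℝ≥0∞ :=
  ⨅ (t : ℝ≥0) (_ : x + m.p k * t - aggregateClaims k t ω - L t ω < 0), (t : ℝ≥0∞)

/-- Admissible stand-alone strategies. By definition of the ruin time, `L` does not exceed
the surplus before ruin; ruin is caused by a claim and not by paying dividends. -/
def IsAdmissibleAlone (m : Model) (k : Fin 2) (x : ℝ) (L : ℝ≥0 → Scenario → ℝ) : Prop :=
  IsDividendProcess (filtrationAlone k) L ∧
  ∀ ω (t : ℝ≥0), ruinTimeAlone m k x L ω = t →
    x + m.p k * t - aggregateClaims k t ω - L t ω < 0

/-- `V_k^0`: the optimal value function of company `k` alone, extended by zero to negative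
surpluses. -/
def valueAlone (m : Model) (k : Fin 2) (x : ℝ) : ℝ≥0∞ :=
  if x < 0 then 0 else
    ⨆ (L : ℝ≥0 → Scenario → ℝ) (_ : IsAdmissibleAlone m k x L),
      ∫⁻ ω, discountedDividends m.δ (fun t => L t ω) (ruinTimeAlone m k x L ω) ∂(law m)

/-! ### The collaboration: transfers, ruin, admissible strategies, value -/

/-- Cumulative amount received by company `k` from the other company after the first `n`
claims have been settled. At the next claim, with `x i` the surplus of company `i` just before a
possible transfer, a deficit of company `k` is covered if the joint surplus is non-negative. -/
def received (m : Model) (z : Fin 2 → ℝ) (L : Fin 2 → ℝ≥0 → Scenario → ℝ) (ω : Scenario) :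
    ℕ → Fin 2 → ℝ
  | 0 => fun _ => 0
  | n + 1 =>
    let t := claimTime (n + 1) ω
    let x : Fin 2 → ℝ := fun i => freeSurplus m z i t ω - L i t ω +
      received m z L ω n i - received m z L ω n (other i)
    fun k => received m z L ω n k + if x k < 0 ∧ 0 ≤ x 0 + x 1 then |x k| else 0

/-- The controlled surplus of company `k`: `X - L^1 + C^{2,1} - C^{1,2}` for Company One and
`Y - L^2 + C^{1,2} - C^{2,1}` for Company Two. -/
def surplus (m : Model) (z : Fin 2 → ℝ) (L : Fin 2 → ℝ≥0 → Scenario → ℝ) (k : Fin 2) (t : ℝ≥0)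
    (ω : Scenario) : ℝ :=
  freeSurplus m z k t ω - L k t ω + received m z L ω (totalCount t ω) k -
    received m z L ω (totalCount t ω) (other k)

/-- The first time at which only one company remains: the infimum of the times at which
the joint controlled surplus is negative (`∞` if there is none). -/
def ruinTime (m : Model) (z : Fin 2 → ℝ) (L : Fin 2 → ℝ≥0 → Scenario → ℝ) (ω : Scenario) : ℝ≥0∞ :=
  ⨅ (t : ℝ≥0) (_ : surplus m z L 0 t ω + surplus m z L 1 t ω < 0), (t : ℝ≥0∞)

/-- The set `Π_z` of admissible strategies with initial surpluses `z`. Before `ruinTime`, no company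
has paid more dividends than its surplus allows, so both surpluses are non-negative; and the joint
surplus becomes negative by a claim, not by paying dividends: it is negative at the
ruin time itself, before any payment made at that time (`L` is left continuous). -/
structure IsAdmissible (m : Model) (z : Fin 2 → ℝ) (L : Fin 2 → ℝ≥0 → Scenario → ℝ) : Prop where
  dividend : ∀ k, IsDividendProcess filtration (L k)
  affordable : ∀ ω (t : ℝ≥0), (t : ℝ≥0∞) < ruinTime m z L ω → ∀ k,
    L k t ω ≤ freeSurplus m z k t ω + received m z L ω (totalCount t ω) k -
      received m z L ω (totalCount t ω) (other k)
  ruin_by_claim : ∀ ω (t : ℝ≥0), ruinTime m z L ω = t →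
    surplus m z L 0 t ω + surplus m z L 1 t ω < 0

/-- The value of the surviving company's optimal stand-alone continuation when ruin
occurs at the (finite) time `t`, discounted and weighted; the ruined company contributes zero. -/
def terminalValue (m : Model) (z : Fin 2 → ℝ) (L : Fin 2 → ℝ≥0 → Scenario → ℝ) (t : ℝ≥0)
    (ω : Scenario) : ℝ≥0∞ :=
  ENNReal.ofReal (Real.exp (-m.δ * t)) *
    ∑ k, ENNReal.ofReal (m.a k) * valueAlone m k (surplus m z L k t ω)

/-- `V_L(z)`: the weighted expected discounted dividends of the strategy `L`. -/
def strategyValue (m : Model) (z : Fin 2 → ℝ) (L : Fin 2 → ℝ≥0 → Scenario → ℝ) : ℝ≥0∞ :=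
  ∫⁻ ω, ((∑ k, ENNReal.ofReal (m.a k) *
      discountedDividends m.δ (fun t => L k t ω) (ruinTime m z L ω)) +
    if ruinTime m z L ω = ∞ then 0 else terminalValue m z L (ruinTime m z L ω).toNNReal ω) ∂(law m)

/-- The set `Π_z^n`: admissible strategies which take the money and run right after the `n`-th
claim, i.e. (if there is no ruin before) each company immediately pays its whole surplus
and then its incoming premium as dividends. -/
def IsAdmissibleStep (m : Model) (n : ℕ) (z : Fin 2 → ℝ) (L : Fin 2 → ℝ≥0 → Scenario → ℝ) : Prop :=
  IsAdmissible m z L ∧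
  ∀ ω (t : ℝ≥0), claimTime n ω < t → (t : ℝ≥0∞) ≤ ruinTime m z L ω → ∀ k,
    L k t ω = L k (claimTime n ω) ω + surplus m z L k (claimTime n ω) ω +
      m.p k * (t - claimTime n ω)

/-- `V^n(z)`, the supremum of `V_L(z)` over `Π_z^n`. For `n = 0` the only strategy, up to ruin, is
take-the-money-and-run from the start. -/
def stepValue (m : Model) (n : ℕ) (z : Fin 2 → ℝ) : ℝ≥0∞ :=
  ⨆ (L : Fin 2 → ℝ≥0 → Scenario → ℝ) (_ : IsAdmissibleStep m n z L), strategyValue m z L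

/-! ### Curve strategies -/

/-- `ξ ∈ Φ^w` with `M = M_ξ`: continuously differentiable on `[w, M]` (one-sided at the end points)
with negative derivative, and vanishing at `M ≥ 0`; hence non-negative. -/
structure IsPhi (w M : ℝ) (ξ : ℝ → ℝ) : Prop where
  le : w ≤ M
  nonneg : 0 ≤ M
  zero : ξ M = 0
  deriv : ∃ ξ' : ℝ → ℝ, ContinuousOn ξ' (Icc w M) ∧
    ∀ u ∈ Icc w M, HasDerivWithinAt ξ (ξ' u) (Icc w M) u ∧ ξ' u < 0

/-- The data of a curve strategy: the vertex and the functions `ξ 0`, `ξ 1` (the `ξ₁`, `ξ₂` of the two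
companies), on the intervals `[base k, M k]`, where `base 0` is the `x`-intercept and `base 1` the
`y`-intercept of the line with slope `p₂ / p₁` through the vertex. The curve of company `k`
consists of the points with `k`-th coordinate `u + (p k / p (other k)) * ξ k u` and other coordinate
`ξ k u`. It starts at the vertex and lies in the first quadrant. -/
structure Curve (m : Model) where
  vertex : Fin 2 → ℝ
  ξ : Fin 2 → ℝ → ℝ
  M : Fin 2 → ℝ
  vertex_nonneg : ∀ k, 0 ≤ vertex k
  phi : ∀ k, IsPhi (vertex k - m.p k / m.p (other k) * vertex (other k)) (M k) (ξ k)
  start : ∀ k, ξ k (vertex k - m.p k / m.p (other k) * vertex (other k)) = vertex (other k)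
  in_quadrant : ∀ k, ∀ u ∈ Icc (vertex k - m.p k / m.p (other k) * vertex (other k)) (M k),
    0 ≤ u + m.p k / m.p (other k) * ξ k u

namespace Curve

variable {m : Model}

def base (c : Curve m) (k : Fin 2) : ℝ := c.vertex k - m.p k / m.p (other k) * c.vertex (other k)

/-- The inverse of `ξ k`, from `[0, vertex (other k)]` to `[base k, M k]`. -/
def inv (c : Curve m) (k : Fin 2) (y : ℝ) : ℝ := Function.invFunOn (c.ξ k) (Icc (c.base k) (c.M k)) y

/-- Surpluses at time `t > 0` under the curve strategy from `z`, as long as there is no claim,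
when `z` is on the side of the line through the vertex where the curve of company `k` lies and is
not in `B₀`. Company `other k` pays nothing until its surplus reaches the vertex level and
then its incoming premium. Company `k`, in terms of `u = (surplus of k) - (p k / p (other k)) *
(surplus of other k)`: a starting point beyond the curve is brought onto the curve by a lump sum of
company `k`; in the no-action region `u` is constant; on the curve `u = (ξ k)⁻¹ (surplus of
other k)`, which decreases to the vertex, i.e. company `k` pays at the rate `- p (other k) / (ξ k)' u`
that keeps the surplus on the curve. -/
def sidePath (c : Curve m) (z : Fin 2 → ℝ) (k : Fin 2) (t : ℝ≥0) : Fin 2 → ℝ :=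
  let y := min (z (other k) + m.p (other k) * t) (c.vertex (other k))
  fun i => if i = other k then y else
    min (z k - m.p k / m.p (other k) * z (other k)) (c.inv k y) + m.p k / m.p (other k) * y

open Classical in
/-- Surpluses at time `t > 0` under the curve strategy started at `z`, as long as there is no claim.
Starting in `B₀` or at the vertex, both companies pay down to the vertex and then pay their incoming
premium; otherwise the side of the line through the vertex decides. -/
def path (c : Curve m) (z : Fin 2 → ℝ) (t : ℝ≥0) : Fin 2 → ℝ :=
  if ∀ i, c.vertex i ≤ z i then c.vertex
  else if c.base 0 ≤ z 0 - m.p 0 / m.p 1 * z 1 then c.sidePath z 0 t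
  else c.sidePath z 1 t

/-- Dividends paid by company `k` up to time `t` under the curve strategy started at `z`, as long as
there is no claim. -/
def dividends (c : Curve m) (z : Fin 2 → ℝ) (k : Fin 2) (t : ℝ≥0) : ℝ :=
  if t = 0 then 0 else z k + m.p k * t - c.path z t k

/-- The dividend process of the curve strategy up to the first claim (and constant afterwards). -/
def firstStep (c : Curve m) (z : Fin 2 → ℝ) (k : Fin 2) (t : ℝ≥0) (ω : Scenario) : ℝ :=
  c.dividends z k (min t (claimTime 1 ω))

/-- `W^ξ(z)`: the expected discounted dividends of the curve strategy up to the first claim, followed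
by the discounted value `W₀` of the surpluses after the first claim, or by the terminal value if
the first claim causes ruin. -/
def oneStepValue (c : Curve m) (W₀ : (Fin 2 → ℝ) → ℝ≥0∞) (z : Fin 2 → ℝ) : ℝ≥0∞ :=
  ∫⁻ ω, ((∑ k, ENNReal.ofReal (m.a k) *
      discountedDividends m.δ (fun t => c.firstStep z k t ω) (claimTime 1 ω)) +
    (if (claimTime 1 ω : ℝ≥0∞) < ruinTime m z (c.firstStep z) ω then
      ENNReal.ofReal (Real.exp (-m.δ * claimTime 1 ω)) *
        W₀ (fun k => surplus m z (c.firstStep z) k (claimTime 1 ω) ω) else 0) +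
    (if (claimTime 1 ω : ℝ≥0∞) = ruinTime m z (c.firstStep z) ω then
      terminalValue m z (c.firstStep z) (claimTime 1 ω) ω else 0)) ∂(law m)

end Curve

/-! ### The function `H_n` -/

/-- The integral operator `I`. -/
def claimOperator (m : Model) (W : ℝ → ℝ → ℝ) (x y : ℝ) : ℝ :=
  m.lam 0 * (∫ α in Ioc 0 x, W (x - α) y ∂(m.F 0)) +
  m.lam 0 * (∫ α in Ioc x (x + y), W 0 (x + y - α) ∂(m.F 0)) +
  m.lam 1 * (∫ α in Ioc 0 y, W x (y - α) ∂(m.F 1)) +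
  m.lam 1 * (∫ α in Ioc y (x + y), W (x + y - α) 0 ∂(m.F 1))

/-- The function `U`, collecting the contributions of claims that cause ruin. -/
def ruinTerm (m : Model) (x y : ℝ) : ℝ :=
  m.lam 0 * m.a 1 * (valueAlone m 1 y).toReal * (1 - cdf (m.F 0) (x + y)) +
  m.lam 1 * m.a 0 * (valueAlone m 0 x).toReal * (1 - cdf (m.F 1) (x + y))

/-- `H_n = I(V^n) + U`. -/
def H (m : Model) (n : ℕ) (x y : ℝ) : ℝ :=
  claimOperator m (fun x y => (stepValue m n ![x, y]).toReal) x y + ruinTerm m x y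

end Collab

end

noncomputable section

namespace Collab

/-! ### Counting claims -/

/-! A maximal strategy leaves no first order gain. Fix a point `z` on the curve of company `k` and
put q = δ + λ. Until the first claim the curve strategy from `z` is a deterministic plan D with
surplus path y(w) = z + pw - D(w). Integration by parts treats discounting as an exponential clock
of rate δ; together with the claim clock of rate λ it rings at rate q. Hence a plan that is
continued optimally after the first claim, with n - 1 further claims admitted, has the value ∫₀^∞
e^{-qw} (q ∑ a_j D_j(w) + H_{n-1}(y(w))) dw (`IsPlan.planValue_eq`). No derivative of D occurs, so
plans may jump, and changing D on (0, s] alone affects only the integral over (0, s].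

On its curve company `k` pays for some time at a rate of at least some κ > 0, because the slope of
the curve function is bounded; at the vertex it pays its premium (`Curve.exists_rates`). So D_k may
be replaced on (0, s] by D_k - κ(w - c) with c = 0 or c = s: either pay less and catch up by a lump
sum after s, or pay κs at once and less thereafter. The latter is affordable for small s because z_k
> 0. To first order the bracket in the integrand changes by κ(w - c)(∂_k H - a_k q). If the second
factor is not zero, one of the two choices of c makes this non-negative on (0, s]; the gain is then
of order s², whereas the error of linearizing H contributes o(s²) (`IsPlan.fderiv_eq`).

This contradicts optimality once no plan can beat V^n (`IsPlan.planValue_le`). For that, a plan has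
to be completed to a predictable admissible strategy which is nearly optimal for the random
surpluses left by the first claim. Countably many continuations suffice, one for each pair of
non-negative rational surpluses: the companies pay down to a rational point slightly below, at a
small loss since the value functions are continuous (`continuousOn_stepValue`,
`exists_optimal_selection`). Pasting is done by `SwitchPlan`; predictability is tested on the claims
strictly before the present time (`TimeScenario.measurable_restart`), and expectations are split at
the first claim by the lack of memory (`setLIntegral_rawLaw_first`). Payoffs are not shown to be
measurable in the scenario, so expectations are compared through measurable bounds only
(`le_lintegral_law`, `lintegral_law_le`).

In the other direction `Curve.oneStepValue_le` bounds the value of the curve strategy by that of its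
plan, so under the hypothesis of the theorem this plan is maximal. -/

@[simp] theorem other_other (k : Fin 2) : other (other k) = k := by fin_cases k <;> rfl

@[simp] theorem other_zero : other 0 = 1 := rfl

@[simp] theorem other_one : other 1 = 0 := rfl

theorem other_ne (k : Fin 2) : other k ≠ k := by fin_cases k <;> decide

theorem eq_or_eq_other (k i : Fin 2) : i = k ∨ i = other k := by
  fin_cases k <;> fin_cases i <;> simp

theorem sum_fin_two_other {M : Type*} [AddCommMonoid M] (f : Fin 2 → M) (k : Fin 2) :
    ∑ i, f i = f k + f (other k) := by
  fin_cases k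
  · simp [Fin.sum_univ_two]
  · simp [Fin.sum_univ_two, add_comm]

theorem arrival_pos (k : Fin 2) (i : ℕ) (ω : Scenario) : 0 < arrival k i ω := by
  unfold arrival rawArrival
  exact Finset.sum_pos (fun j _ => (ω.2.1 (k, j)).1) ⟨0, by simp⟩

theorem claimSize_pos (k : Fin 2) (i : ℕ) (ω : Scenario) : 0 < claimSize k i ω := (ω.2.1 (k, i)).2

theorem arrival_ne (k : Fin 2) (i j : ℕ) (ω : Scenario) :
    arrival k i ω ≠ arrival (other k) j ω := by
  fin_cases k
  · exact ω.2.2.2 i j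
  · exact fun h => ω.2.2.2 j i h.symm

theorem claimCount_le_iff (k : Fin 2) (t : ℝ≥0) (ω : Scenario) (i : ℕ) :
    claimCount k t ω ≤ i ↔ (t : ℝ) < arrival k i ω := by
  rw [← not_lt, lt_claimCount_iff, not_le]

theorem claimCount_mono (k : Fin 2) (ω : Scenario) : Monotone fun t => claimCount k t ω := by
  intro s t hst
  simp only
  rw [claimCount_le_iff]
  have h : (t : ℝ) < arrival k (claimCount k t ω) ω := (claimCount_le_iff k t ω _).1 le_rfl
  exact lt_of_le_of_lt (by exact_mod_cast hst) h

@[simp] theorem claimCount_zero (k : Fin 2) (ω : Scenario) : claimCount k 0 ω = 0 := by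
  have := (claimCount_le_iff k 0 ω 0).2 (by simpa using arrival_pos k 0 ω)
  omega

theorem totalCount_mono (ω : Scenario) : Monotone fun t => totalCount t ω := fun _ _ h =>
  add_le_add (claimCount_mono 0 ω h) (claimCount_mono 1 ω h)

@[simp] theorem totalCount_zero (ω : Scenario) : totalCount 0 ω = 0 := by simp [totalCount]

theorem totalCount_eq (k : Fin 2) (t : ℝ≥0) (ω : Scenario) :
    totalCount t ω = claimCount k t ω + claimCount (other k) t ω := by
  fin_cases k
  · rfl
  · exact add_comm _ _

theorem aggregateClaims_eq_zero {k : Fin 2} {t : ℝ≥0} {ω : Scenario} (h : claimCount k t ω = 0) :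
    aggregateClaims k t ω = 0 := by simp [aggregateClaims, h]

theorem aggregateClaims_mono (k : Fin 2) (ω : Scenario) :
    Monotone fun t => aggregateClaims k t ω := by
  intro s t hst
  exact Finset.sum_le_sum_of_subset_of_nonneg (Finset.range_mono (claimCount_mono k ω hst))
    fun i _ _ => (claimSize_pos k i ω).le

theorem aggregateClaims_nonneg (k : Fin 2) (t : ℝ≥0) (ω : Scenario) :
    0 ≤ aggregateClaims k t ω := Finset.sum_nonneg fun i _ => (claimSize_pos k i ω).le

/-- Right continuity of the counting processes: no claim occurs strictly between `t` and the earlier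
of the two next arrivals. -/
theorem exists_gt_claimCount_eq (t : ℝ≥0) (ω : Scenario) :
    ∃ t' > t, ∀ k, claimCount k t' ω = claimCount k t ω := by
  have h : ∀ k, (t : ℝ) < arrival k (claimCount k t ω) ω := fun k =>
    (claimCount_le_iff k t ω _).1 le_rfl
  obtain ⟨r, hr, hr'⟩ := exists_between (lt_min (h 0) (h 1))
  refine ⟨⟨r, t.2.trans hr.le⟩, by exact_mod_cast hr, fun k => ?_⟩
  refine le_antisymm ((claimCount_le_iff _ _ _ _).2 ?_) (claimCount_mono k ω ?_)
  · have := lt_min_iff.1 hr'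
    fin_cases k
    · exact this.1
    · exact this.2
  · exact_mod_cast hr.le

theorem exists_le_totalCount (n : ℕ) (ω : Scenario) : ∃ t : ℝ≥0, n ≤ totalCount t ω := by
  refine ⟨⟨arrival 0 n ω, (arrival_pos 0 n ω).le⟩, ?_⟩
  have := (lt_claimCount_iff 0 ⟨arrival 0 n ω, (arrival_pos 0 n ω).le⟩ ω n).2 le_rfl
  exact this.le.trans (Nat.le_add_right _ _)

/-- Right continuity of the count makes the infimum in `claimTime` a minimum. This Galois connection
is the working description of `claimTime`. -/
theorem claimTime_le_iff (n : ℕ) (t : ℝ≥0) (ω : Scenario) :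
    claimTime n ω ≤ t ↔ n ≤ totalCount t ω := by
  constructor
  · intro h
    by_contra hlt
    obtain ⟨t', ht', heq⟩ := exists_gt_claimCount_eq t ω
    have h1 : totalCount t' ω = totalCount t ω := by simp [totalCount, heq]
    obtain ⟨u, hu, hu'⟩ := (csInf_lt_iff (OrderBot.bddBelow _) (exists_le_totalCount n ω)).1
      (lt_of_le_of_lt h ht')
    have h2 : totalCount u ω ≤ totalCount t' ω := totalCount_mono ω hu'.le
    have h3 : n ≤ totalCount u ω := hu
    omega
  · intro h
    exact csInf_le (OrderBot.bddBelow _) h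

theorem lt_claimTime_iff (n : ℕ) (t : ℝ≥0) (ω : Scenario) :
    t < claimTime n ω ↔ totalCount t ω < n := by
  rw [← not_le, claimTime_le_iff, not_le]

@[simp] theorem claimTime_zero (ω : Scenario) : claimTime 0 ω = 0 :=
  le_antisymm ((claimTime_le_iff _ _ _).2 (Nat.zero_le _)) (zero_le)

/-- The total count jumps by one only, since the two companies never have claims at the same time.
Hence exactly `n` claims have occurred at the `n`-th claim time. -/
theorem exists_lt_totalCount (t : ℝ≥0) (ht : 0 < t) (ω : Scenario) :
    ∃ u < t, totalCount t ω ≤ totalCount u ω + 1 := by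
  -- for each company, some earlier time misses at most the claim occurring exactly at `t`
  have key : ∀ k, ∃ u < t, claimCount k t ω ≤ claimCount k u ω ∨
      (claimCount k t ω ≤ claimCount k u ω + 1 ∧ ∃ i, arrival k i ω = t) := by
    intro k
    have hlt : ∀ i, arrival k i ω < t → ∃ u < t, i + 1 ≤ claimCount k u ω := fun i hi =>
      ⟨⟨arrival k i ω, (arrival_pos k i ω).le⟩, by exact_mod_cast hi,
        (lt_claimCount_iff k ⟨arrival k i ω, (arrival_pos k i ω).le⟩ ω i).2 le_rfl⟩
    rcases hc : claimCount k t ω with _ | i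
    · exact ⟨0, ht, Or.inl (Nat.zero_le _)⟩
    · have hi : arrival k i ω ≤ t := (lt_claimCount_iff k t ω i).1 (by omega)
      rcases hi.lt_or_eq with hi | hi
      · obtain ⟨u, hu, hu'⟩ := hlt i hi
        exact ⟨u, hu, Or.inl hu'⟩
      · rcases i with _ | i
        · exact ⟨0, ht, Or.inr ⟨by omega, 0, hi⟩⟩
        · obtain ⟨u, hu, hu'⟩ := hlt i (lt_of_lt_of_eq (arrival_strictMono k ω (Nat.lt_succ_self i)) hi)
          exact ⟨u, hu, Or.inr ⟨by omega, _, hi⟩⟩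
  obtain ⟨u, hu, h0⟩ := key 0
  obtain ⟨v, hv, h1⟩ := key 1
  refine ⟨max u v, max_lt hu hv, ?_⟩
  have hu' := claimCount_mono 0 ω (le_max_left u v)
  have hv' := claimCount_mono 1 ω (le_max_right u v)
  simp only [totalCount] at *
  rcases h0 with h0 | ⟨h0, i, hi⟩ <;> rcases h1 with h1 | ⟨h1, j, hj⟩
  · omega
  · omega
  · omega
  · exact absurd (hi.trans hj.symm) (arrival_ne 0 i j ω)

@[simp] theorem totalCount_claimTime (n : ℕ) (ω : Scenario) :
    totalCount (claimTime n ω) ω = n := by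
  refine le_antisymm ?_ ((claimTime_le_iff _ _ _).1 le_rfl)
  rcases eq_zero_or_pos (claimTime n ω) with h | h
  · simp [h]
  · obtain ⟨u, hu, hu'⟩ := exists_lt_totalCount _ h ω
    have := (lt_claimTime_iff n u ω).1 hu
    omega

theorem claimTime_strictMono (ω : Scenario) : StrictMono fun n => claimTime n ω :=
  strictMono_nat_of_lt_succ fun n => (lt_claimTime_iff _ _ _).2 (by simp)

theorem claimTime_pos {n : ℕ} (hn : 1 ≤ n) (ω : Scenario) : 0 < claimTime n ω :=
  (lt_claimTime_iff _ _ _).2 (by rw [totalCount_zero]; exact hn)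

theorem totalCount_eq_zero {t : ℝ≥0} {ω : Scenario} (h : t < claimTime 1 ω) :
    totalCount t ω = 0 := by
  have := (lt_claimTime_iff 1 t ω).1 h
  omega

theorem claimCount_eq_zero {t : ℝ≥0} {ω : Scenario} (h : t < claimTime 1 ω) (k : Fin 2) :
    claimCount k t ω = 0 := by
  have := totalCount_eq_zero h
  rw [totalCount_eq k] at this
  omega

/-! ### Scenarios seen from a later time -/

/-- The scenario seen from time `r`: the claims up to time `r` are dropped. -/
def shiftRaw (r : ℝ≥0) (ω : Scenario) (s : Fin 2 × ℕ) : ℝ × ℝ :=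
  (if s.2 = 0 then arrival s.1 (claimCount s.1 r ω) ω - r else
    (ω.1 (s.1, claimCount s.1 r ω + s.2)).1, (ω.1 (s.1, claimCount s.1 r ω + s.2)).2)

theorem rawArrival_shiftRaw (r : ℝ≥0) (ω : Scenario) (k : Fin 2) (i : ℕ) :
    rawArrival (shiftRaw r ω) k i = arrival k (claimCount k r ω + i) ω - r := by
  induction i with
  | zero => simp [rawArrival, shiftRaw]
  | succ i ih =>
    rw [rawArrival, Finset.sum_range_succ, ← rawArrival, ih]
    have : arrival k (claimCount k r ω + (i + 1)) ω =
        arrival k (claimCount k r ω + i) ω + (ω.1 (k, claimCount k r ω + (i + 1))).1 := by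
      simp only [arrival, rawArrival]
      rw [← add_assoc, Finset.sum_range_succ _ (claimCount k r ω + i + 1)]
    rw [this]
    simp [shiftRaw]
    ring

def shift (r : ℝ≥0) (ω : Scenario) : Scenario := by
  refine ⟨shiftRaw r ω, fun s => ⟨?_, (ω.2.1 _).2⟩, fun k => ?_, fun i j => ?_⟩
  · simp only [shiftRaw]
    split_ifs
    · exact sub_pos.2 ((claimCount_le_iff _ _ _ _).1 le_rfl)
    · exact (ω.2.1 _).1
  · have h1 : Tendsto (fun i => arrival k (claimCount k r ω + i) ω) atTop atTop :=
      (ω.2.2.1 k).comp (tendsto_atTop_mono (fun i => Nat.le_add_left i _) tendsto_id)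
    have h2 := tendsto_atTop_add_const_right atTop (-(r : ℝ)) h1
    refine h2.congr fun i => ?_
    rw [rawArrival_shiftRaw]
    ring
  · rw [rawArrival_shiftRaw, rawArrival_shiftRaw]
    intro h
    exact arrival_ne 0 _ _ ω (sub_left_injective h)

theorem arrival_shift (r : ℝ≥0) (ω : Scenario) (k : Fin 2) (i : ℕ) :
    arrival k i (shift r ω) = arrival k (claimCount k r ω + i) ω - r :=
  rawArrival_shiftRaw r ω k i

theorem claimSize_shift (r : ℝ≥0) (ω : Scenario) (k : Fin 2) (i : ℕ) :
    claimSize k i (shift r ω) = claimSize k (claimCount k r ω + i) ω := rfl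

theorem claimCount_shift (r t : ℝ≥0) (ω : Scenario) (k : Fin 2) :
    claimCount k (r + t) ω = claimCount k r ω + claimCount k t (shift r ω) := by
  refine eq_of_forall_lt_iff fun i => ?_
  rw [lt_claimCount_iff]
  rcases lt_or_ge i (claimCount k r ω) with h | h
  · have h1 := (lt_claimCount_iff k r ω i).1 h
    refine iff_of_true (h1.trans ?_) (by omega)
    push_cast
    linarith [t.2]
  · obtain ⟨j, rfl⟩ := Nat.exists_eq_add_of_le h
    rw [add_lt_add_iff_left, lt_claimCount_iff, arrival_shift]
    push_cast
    constructor <;> intro h <;> linarith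

theorem totalCount_shift (r t : ℝ≥0) (ω : Scenario) :
    totalCount (r + t) ω = totalCount r ω + totalCount t (shift r ω) := by
  simp only [totalCount, claimCount_shift]
  ring

theorem aggregateClaims_shift (r t : ℝ≥0) (ω : Scenario) (k : Fin 2) :
    aggregateClaims k (r + t) ω = aggregateClaims k r ω + aggregateClaims k t (shift r ω) := by
  simp only [aggregateClaims, claimCount_shift, Finset.sum_range_add, claimSize_shift]

theorem freeSurplus_shift (m : Model) (z g : Fin 2 → ℝ) (k : Fin 2) (r t : ℝ≥0) (ω : Scenario) :
    freeSurplus m z k (r + t) ω =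
      freeSurplus m z k r ω - g k + freeSurplus m g k t (shift r ω) := by
  simp only [freeSurplus, aggregateClaims_shift]
  push_cast
  ring

/-- For `n = 0` this would fail: the claim numbered `totalCount r ω` occurs at or before `r`, in
general strictly before. -/
theorem claimTime_shift (r : ℝ≥0) (ω : Scenario) {n : ℕ} (hn : 1 ≤ n) :
    claimTime (totalCount r ω + n) ω = r + claimTime n (shift r ω) := by
  have h : r ≤ claimTime (totalCount r ω + n) ω :=
    ((lt_claimTime_iff _ _ _).2 (by omega)).le
  obtain ⟨t, ht⟩ := exists_add_of_le h
  rw [ht]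
  congr 1
  refine eq_of_forall_ge_iff fun u => ?_
  rw [claimTime_le_iff, ← add_le_add_iff_left r, ← ht, claimTime_le_iff, totalCount_shift]
  omega

variable {m : Model} {z g : Fin 2 → ℝ} {L M : Fin 2 → ℝ≥0 → Scenario → ℝ} {ω : Scenario}

theorem p_pos (m : Model) (k : Fin 2) : 0 < m.p k := by
  refine lt_of_le_of_lt (mul_nonneg (m.lam_pos k).le (integral_nonneg_of_ae ?_)) (m.net_profit k)
  have h : ∀ᵐ u ∂(m.F k), u ∉ Iic (0 : ℝ) := measure_eq_zero_iff_ae_notMem.1 (m.F_pos k)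
  filter_upwards [h] with u hu
  exact (not_le.1 hu).le

/-! ### Transfers -/

/-- Surpluses after the transfers, given the surpluses `y` before. -/
def settle (y : Fin 2 → ℝ) (k : Fin 2) : ℝ :=
  y k + (if y k < 0 ∧ 0 ≤ y 0 + y 1 then |y k| else 0) -
    (if y (other k) < 0 ∧ 0 ≤ y 0 + y 1 then |y (other k)| else 0)

theorem settle_sum (y : Fin 2 → ℝ) : settle y 0 + settle y 1 = y 0 + y 1 := by
  by_cases h0 : y 0 < 0 ∧ 0 ≤ y 0 + y 1 <;> by_cases h1 : y 1 < 0 ∧ 0 ≤ y 0 + y 1 <;>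
    simp only [settle, other_zero, other_one, h0, h1, if_false] <;> ring

theorem settle_of_neg {y : Fin 2 → ℝ} (h : y 0 + y 1 < 0) : settle y = y := by
  funext k
  simp [settle, not_le.2 h]

theorem settle_of_nonneg {y : Fin 2 → ℝ} (h : ∀ k, 0 ≤ y k) : settle y = y := by
  funext k
  simp [settle, not_lt.2 (h _)]

theorem settle_nonneg {y : Fin 2 → ℝ} (h : 0 ≤ y 0 + y 1) (k : Fin 2) : 0 ≤ settle y k := by
  have h' : 0 ≤ y k + y (other k) := by
    fin_cases k
    · exact h
    · exact (add_comm (y 0) (y 1)) ▸ h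
  simp only [settle, h, and_true]
  split_ifs with h1 h2 h2
  · linarith
  · rw [abs_of_neg h1]; linarith
  · rw [abs_of_neg h2]; linarith
  · simpa using h1

theorem measurable_settle : Measurable settle := by
  refine measurable_pi_lambda _ fun k => ?_
  have h : ∀ i, MeasurableSet {y : Fin 2 → ℝ | y i < 0 ∧ 0 ≤ y 0 + y 1} := fun i =>
    (measurableSet_lt (measurable_pi_apply i) measurable_const).inter
      (measurableSet_le measurable_const ((measurable_pi_apply 0).add (measurable_pi_apply 1)))
  exact ((measurable_pi_apply k).add (Measurable.ite (h k) (measurable_pi_apply k).abs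
    measurable_const)).sub (Measurable.ite (h _) (measurable_pi_apply _).abs measurable_const)

/-! ### Surplus paths -/

/-- The joint surplus does not depend on the transfers. -/
theorem surplus_add (m : Model) (z : Fin 2 → ℝ) (L : Fin 2 → ℝ≥0 → Scenario → ℝ) (t : ℝ≥0)
    (ω : Scenario) : surplus m z L 0 t ω + surplus m z L 1 t ω =
      (freeSurplus m z 0 t ω - L 0 t ω) + (freeSurplus m z 1 t ω - L 1 t ω) := by
  simp only [surplus, other_zero, other_one]
  ring

theorem surplus_of_lt_claimTime {t : ℝ≥0} (h : t < claimTime 1 ω) (k : Fin 2) :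
    surplus m z L k t ω = z k + m.p k * t - L k t ω := by
  simp [surplus, totalCount_eq_zero h, received, freeSurplus,
    aggregateClaims_eq_zero (claimCount_eq_zero h k)]

theorem surplus_zero (hL : ∀ k, L k 0 ω = 0) (k : Fin 2) : surplus m z L k 0 ω = z k := by
  rw [surplus_of_lt_claimTime (claimTime_pos le_rfl ω), hL]
  simp

/-- One step of the recursion `received` adds the transfers triggered by the present claim, and
`settle` isolates their effect on the surpluses. -/
theorem surplus_claimTime_succ (n : ℕ) (k : Fin 2) :
    surplus m z L k (claimTime (n + 1) ω) ω =
      settle (fun i => freeSurplus m z i (claimTime (n + 1) ω) ω - L i (claimTime (n + 1) ω) ω +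
        received m z L ω n i - received m z L ω n (other i)) k := by
  simp only [surplus, totalCount_claimTime, received, settle, other_other]
  ring

theorem surplus_claimTime_one (k : Fin 2) :
    surplus m z L k (claimTime 1 ω) ω =
      settle (fun i => freeSurplus m z i (claimTime 1 ω) ω - L i (claimTime 1 ω) ω) k := by
  rw [surplus_claimTime_succ]
  simp [received]

theorem ruinTime_le {t : ℝ≥0} (h : surplus m z L 0 t ω + surplus m z L 1 t ω < 0) :
    ruinTime m z L ω ≤ t := iInf₂_le t h

theorem ruinTime_lt_iff {T : ℝ≥0∞} : ruinTime m z L ω < T ↔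
    ∃ t : ℝ≥0, surplus m z L 0 t ω + surplus m z L 1 t ω < 0 ∧ (t : ℝ≥0∞) < T := by
  simp [ruinTime, iInf_lt_iff]

theorem joint_nonneg_of_lt_ruinTime {t : ℝ≥0} (h : (t : ℝ≥0∞) < ruinTime m z L ω) :
    0 ≤ surplus m z L 0 t ω + surplus m z L 1 t ω := by
  by_contra hlt
  exact absurd (ruinTime_le (not_le.1 hlt)) (not_le.2 h)

variable (m z L ω) in
/-- The requirements of `IsAdmissible` on the path of the scenario `ω`. -/
structure PathAdmissible : Prop where
  nonneg : ∀ t : ℝ≥0, (t : ℝ≥0∞) < ruinTime m z L ω → ∀ k, 0 ≤ surplus m z L k t ω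
  ruin : ∀ t : ℝ≥0, ruinTime m z L ω = t → surplus m z L 0 t ω + surplus m z L 1 t ω < 0

/-- Separates predictability, which concerns all scenarios together, from requirements that can be
verified one scenario at a time. -/
theorem isAdmissible_iff : IsAdmissible m z L ↔
    (∀ k, IsDividendProcess filtration (L k)) ∧ ∀ ω, PathAdmissible m z L ω := by
  have h : ∀ ω (t : ℝ≥0) k, L k t ω ≤ freeSurplus m z k t ω + received m z L ω (totalCount t ω) k -
      received m z L ω (totalCount t ω) (other k) ↔ 0 ≤ surplus m z L k t ω := by
    intro ω t k
    simp only [surplus]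
    constructor <;> intro h <;> linarith
  constructor
  · exact fun H => ⟨H.dividend, fun ω => ⟨fun t ht k => (h ω t k).1 (H.affordable ω t ht k),
      H.ruin_by_claim ω⟩⟩
  · exact fun H => ⟨H.1, fun ω t ht k => (h ω t k).2 ((H.2 ω).nonneg t ht k),
      fun ω => (H.2 ω).ruin⟩

variable (m z L ω) in
/-- The requirement of `IsAdmissibleStep` on the path of the scenario `ω`. -/
def RunsAfter (n : ℕ) : Prop :=
  ∀ t : ℝ≥0, claimTime n ω < t → (t : ℝ≥0∞) ≤ ruinTime m z L ω → ∀ k,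
    L k t ω = L k (claimTime n ω) ω + surplus m z L k (claimTime n ω) ω +
      m.p k * (t - claimTime n ω)

/-! ### Paths which restart at a given time -/

variable (m z L g M ω) in
/-- In the scenario `ω`, the strategy `L` brings the surpluses down to `g` right after
time `r` and then follows the strategy `M`. -/
structure Restarts (r : ℝ≥0) : Prop where
  start : ∀ k, M k 0 (shift r ω) = 0
  eq : ∀ k t, 0 < t →
    L k (r + t) ω = L k r ω + (surplus m z L k r ω - g k) + M k t (shift r ω)

namespace Restarts

variable {r : ℝ≥0}

/-- Induction on the claims after `r`: the payment right after `r` brings the surpluses to `g`, so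
just before each later claim they agree in both pictures and the same transfers follow. -/
theorem received_eq (h : Restarts m z g L M ω r) (n : ℕ) (k : Fin 2) :
    received m z L ω (totalCount r ω + n) k =
      received m z L ω (totalCount r ω) k + received m g M (shift r ω) n k := by
  induction n generalizing k with
  | zero => simp [received]
  | succ n ih =>
    have ht : claimTime (totalCount r ω + n + 1) ω = r + claimTime (n + 1) (shift r ω) :=
      claimTime_shift r ω (Nat.succ_le_succ (Nat.zero_le n))
    have hpos : 0 < claimTime (n + 1) (shift r ω) := claimTime_pos (by omega) _
    have hx : ∀ i, freeSurplus m z i (claimTime (totalCount r ω + n + 1) ω) ω -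
          L i (claimTime (totalCount r ω + n + 1) ω) ω +
          received m z L ω (totalCount r ω + n) i -
          received m z L ω (totalCount r ω + n) (other i) =
        freeSurplus m g i (claimTime (n + 1) (shift r ω)) (shift r ω) -
          M i (claimTime (n + 1) (shift r ω)) (shift r ω) +
          received m g M (shift r ω) n i - received m g M (shift r ω) n (other i) := by
      intro i
      rw [ht, h.eq i _ hpos, freeSurplus_shift m z g, ih i, ih (other i)]
      simp only [surplus]
      ring
    rw [← add_assoc, received]
    simp only [hx]
    rw [received, ih]
    ring

theorem surplus_eq (h : Restarts m z g L M ω r) {t : ℝ≥0} (ht : 0 < t) (k : Fin 2) :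
    surplus m z L k (r + t) ω = surplus m g M k t (shift r ω) := by
  rw [surplus, surplus, totalCount_shift, h.received_eq, h.received_eq, h.eq k t ht,
    freeSurplus_shift m z g, surplus]
  ring

/-- Surpluses correspond only at times strictly after `r`. Non-negativity of `g` excludes ruin of
the restarted process at its time `0`, and `hr` excludes ruin up to `r`. -/
theorem ruinTime_eq (h : Restarts m z g L M ω r) (hg : ∀ k, 0 ≤ g k)
    (hr : ∀ t ≤ r, 0 ≤ surplus m z L 0 t ω + surplus m z L 1 t ω) :
    ruinTime m z L ω = r + ruinTime m g M (shift r ω) := by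
  refine le_antisymm ?_ ?_
  · by_contra hlt
    rw [not_le, ← lt_tsub_iff_left] at hlt
    obtain ⟨u, hu, hu'⟩ := ruinTime_lt_iff.1 hlt
    have hpos : 0 < u := by
      rcases eq_zero_or_pos u with rfl | hpos
      · rw [surplus_zero h.start, surplus_zero h.start] at hu
        linarith [hg 0, hg 1]
      · exact hpos
    rw [lt_tsub_iff_left] at hu'
    rw [← h.surplus_eq hpos, ← h.surplus_eq hpos] at hu
    exact absurd (ruinTime_le hu) (not_le.2 (by exact_mod_cast hu'))
  · refine le_iInf₂ fun t ht => ?_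
    have hlt : r < t := by
      by_contra hle
      exact absurd (hr t (not_lt.1 hle)) (not_le.2 ht)
    obtain ⟨u, rfl⟩ := exists_add_of_le hlt.le
    have hpos : 0 < u := by
      rcases eq_zero_or_pos u with rfl | hpos
      · simp at hlt
      · exact hpos
    rw [h.surplus_eq hpos, h.surplus_eq hpos] at ht
    push_cast
    gcongr
    exact ruinTime_le ht

theorem pathAdmissible (h : Restarts m z g L M ω r) (hg : ∀ k, 0 ≤ g k)
    (hr : ∀ t ≤ r, ∀ k, 0 ≤ surplus m z L k t ω) (hM : PathAdmissible m g M (shift r ω)) :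
    PathAdmissible m z L ω := by
  have hruin := h.ruinTime_eq hg fun t ht => add_nonneg (hr t ht 0) (hr t ht 1)
  constructor
  · intro t ht k
    rcases le_or_gt t r with htr | htr
    · exact hr t htr k
    · obtain ⟨u, hu, rfl⟩ := exists_pos_add_of_lt' htr
      rw [h.surplus_eq hu]
      refine hM.nonneg u ?_ k
      rw [hruin] at ht
      push_cast at ht
      exact (ENNReal.add_lt_add_iff_left ENNReal.coe_ne_top).1 ht
  · intro t ht
    have hrt : r ≤ t := by
      rw [hruin] at ht
      have : (r : ℝ≥0∞) ≤ t := ht ▸ le_self_add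
      exact_mod_cast this
    obtain ⟨u, rfl⟩ := exists_add_of_le hrt
    have hu' : ruinTime m g M (shift r ω) = u := by
      rw [hruin] at ht
      push_cast at ht
      exact (ENNReal.add_right_inj ENNReal.coe_ne_top).1 ht
    have hlt := hM.ruin u hu'
    have hpos : 0 < u := by
      rcases eq_zero_or_pos u with rfl | hpos
      · rw [surplus_zero h.start, surplus_zero h.start] at hlt
        linarith [hg 0, hg 1]
      · exact hpos
    rwa [h.surplus_eq hpos, h.surplus_eq hpos]

theorem runsAfter (h : Restarts m z g L M ω r) (hg : ∀ k, 0 ≤ g k)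
    (hr : ∀ t ≤ r, 0 ≤ surplus m z L 0 t ω + surplus m z L 1 t ω) {n n' : ℕ}
    (hn : claimTime n ω = r + claimTime n' (shift r ω)) (hM : RunsAfter m g M (shift r ω) n') :
    RunsAfter m z L ω n := by
  intro t ht htr k
  rw [h.ruinTime_eq hg hr] at htr
  rw [hn] at ht ⊢
  obtain ⟨u, rfl⟩ := exists_add_of_le (le_self_add.trans ht.le)
  have hu : claimTime n' (shift r ω) < u := lt_of_add_lt_add_left ht
  have hM' := hM u hu (by
    push_cast at htr
    exact (ENNReal.add_le_add_iff_left ENNReal.coe_ne_top).1 htr) k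
  rw [h.eq k u (zero_le.trans_lt hu), hM']
  -- For `n' = 0` the running starts at `r` itself, where `L` has not yet paid the lump sum down to
  -- `g` and `h.eq` does not apply.
  rcases eq_zero_or_pos (claimTime n' (shift r ω)) with h0 | h0
  · rw [h0, h.start, surplus_zero h.start]
    push_cast
    simp only [add_zero, zero_add, sub_zero, add_sub_cancel_left]
    ring
  · rw [h.eq k _ h0, h.surplus_eq h0]
    push_cast
    ring

end Restarts

theorem ruinTime_eq_claimTime_one
    (hr : ∀ t < claimTime 1 ω, 0 ≤ surplus m z L 0 t ω + surplus m z L 1 t ω)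
    (hneg : surplus m z L 0 (claimTime 1 ω) ω + surplus m z L 1 (claimTime 1 ω) ω < 0) :
    ruinTime m z L ω = claimTime 1 ω := by
  refine le_antisymm (ruinTime_le hneg) (le_iInf₂ fun t ht => ?_)
  by_contra hlt
  exact absurd (hr t (by exact_mod_cast not_le.1 hlt)) (not_le.2 ht)

theorem pathAdmissible_of_ruin_at_claim
    (hr : ∀ t < claimTime 1 ω, ∀ k, 0 ≤ surplus m z L k t ω)
    (hneg : surplus m z L 0 (claimTime 1 ω) ω + surplus m z L 1 (claimTime 1 ω) ω < 0) :
    PathAdmissible m z L ω := by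
  have h := ruinTime_eq_claimTime_one (fun t ht => add_nonneg (hr t ht 0) (hr t ht 1)) hneg
  refine ⟨fun t ht => hr t ?_, fun t ht => ?_⟩
  · rw [h] at ht
    exact_mod_cast ht
  · rw [h] at ht
    have : claimTime 1 ω = t := by exact_mod_cast ht
    rwa [← this]

/-! ### Exponential integrals -/

theorem lintegral_exp_Ioi {δ : ℝ} (hδ : 0 < δ) (a : ℝ) :
    ∫⁻ s in Ioi a, ENNReal.ofReal (δ * Real.exp (-δ * s)) = ENNReal.ofReal (Real.exp (-δ * a)) := by
  rw [← ofReal_integral_eq_lintegral_ofReal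
    ((integrableOn_exp_mul_Ioi (neg_neg_of_pos hδ) a).const_mul δ)
    (ae_of_all _ fun s => mul_nonneg hδ.le (Real.exp_nonneg _)), integral_const_mul,
    integral_exp_mul_Ioi (neg_neg_of_pos hδ)]
  congr 1
  field_simp

/-- Half of the exponential absorbs the linear growth: A + Br ≤ (A + 2B/δ)(1 + δr/2) ≤ (A +
2B/δ)e^{δr/2}. The other half integrates with a factor 2. The constant is not sharp, only finiteness
matters. -/
theorem lintegral_exp_mul_linear_le {δ A B : ℝ} (hδ : 0 < δ) (hA : 0 ≤ A) (hB : 0 ≤ B) :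
    ∫⁻ r in Ioi (0 : ℝ), ENNReal.ofReal (δ * Real.exp (-δ * r)) * ENNReal.ofReal (A + B * r) ≤
      ENNReal.ofReal (2 * A + 4 * B / δ) := by
  have h : ∀ r ∈ Ioi (0 : ℝ), ENNReal.ofReal (δ * Real.exp (-δ * r)) * ENNReal.ofReal (A + B * r) ≤
      ENNReal.ofReal (2 * A + 4 * B / δ) *
        ENNReal.ofReal (δ / 2 * Real.exp (-(δ / 2) * r)) := by
    intro r hr
    rw [← ENNReal.ofReal_mul (by positivity), ← ENNReal.ofReal_mul (by positivity)]
    refine ENNReal.ofReal_le_ofReal ?_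
    have h1 : -δ * r = -(δ / 2) * r + -(δ / 2) * r := by ring
    have h2 : Real.exp (-(δ / 2) * r) * Real.exp (δ / 2 * r) = 1 := by
      rw [← Real.exp_add]; simp
    have h3 : δ / 2 * r + 1 ≤ Real.exp (δ / 2 * r) := Real.add_one_le_exp _
    have h4 : A + B * r ≤ (A + 2 * B / δ) * Real.exp (δ / 2 * r) := by
      have hr' : (0 : ℝ) < r := hr
      calc A + B * r ≤ (A + 2 * B / δ) * (δ / 2 * r + 1) := by
            have : (A + 2 * B / δ) * (δ / 2 * r + 1) = A + B * r + (A * δ * r / 2 + 2 * B / δ) := by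
              field_simp
              ring
            rw [this]
            have : 0 ≤ A * δ * r / 2 + 2 * B / δ := by positivity
            linarith
        _ ≤ _ := by gcongr
    rw [h1, Real.exp_add]
    calc δ * (Real.exp (-(δ / 2) * r) * Real.exp (-(δ / 2) * r)) * (A + B * r)
        ≤ δ * (Real.exp (-(δ / 2) * r) * Real.exp (-(δ / 2) * r)) *
          ((A + 2 * B / δ) * Real.exp (δ / 2 * r)) := by gcongr
      _ = δ * (A + 2 * B / δ) * Real.exp (-(δ / 2) * r) *
          (Real.exp (-(δ / 2) * r) * Real.exp (δ / 2 * r)) := by ring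
      _ = _ := by rw [h2]; ring
  calc _ ≤ ∫⁻ r in Ioi (0 : ℝ), ENNReal.ofReal (2 * A + 4 * B / δ) *
        ENNReal.ofReal (δ / 2 * Real.exp (-(δ / 2) * r)) := setLIntegral_mono (by fun_prop) h
    _ = _ := by
      rw [lintegral_const_mul _ (by fun_prop), lintegral_exp_Ioi (half_pos hδ)]
      simp

theorem exp_mul_linear_le {δ A B t : ℝ} (hδ : 0 < δ) (hA : 0 ≤ A) (hB : 0 ≤ B) (ht : 0 ≤ t) :
    Real.exp (-δ * t) * (A + B * t) ≤ A + B / δ := by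
  have h1 : δ * t + 1 ≤ Real.exp (δ * t) := Real.add_one_le_exp _
  have h2 : Real.exp (-δ * t) * Real.exp (δ * t) = 1 := by rw [← Real.exp_add]; simp
  calc Real.exp (-δ * t) * (A + B * t) ≤
      Real.exp (-δ * t) * ((A + B / δ) * Real.exp (δ * t)) := by
        gcongr
        calc A + B * t ≤ (A + B / δ) * (δ * t + 1) := by
              have : (A + B / δ) * (δ * t + 1) = A + B * t + (A * δ * t + B / δ) := by
                field_simp
                ring
              rw [this]
              have : 0 ≤ A * δ * t + B / δ := by positivity
              linarith
          _ ≤ _ := by gcongr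
    _ = (A + B / δ) * (Real.exp (-δ * t) * Real.exp (δ * t)) := by ring
    _ = _ := by rw [h2, mul_one]

/-! ### Discounted dividends -/

/-- The time `r` stopped at `T`. -/
def stopAt (T : ℝ≥0∞) (r : ℝ) : ℝ≥0 := (min (ENNReal.ofReal r) T).toNNReal

theorem coe_stopAt (T : ℝ≥0∞) (r : ℝ) : (stopAt T r : ℝ≥0∞) = min (ENNReal.ofReal r) T :=
  ENNReal.coe_toNNReal (ne_top_of_le_ne_top ENNReal.ofReal_ne_top (min_le_left _ _))

theorem stopAt_le (T : ℝ≥0∞) (r : ℝ) : (stopAt T r : ℝ≥0∞) ≤ T :=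
  (coe_stopAt T r).trans_le (min_le_right _ _)

theorem stopAt_coe (T : ℝ≥0) (r : ℝ) : stopAt T r = min r.toNNReal T := by
  rw [← ENNReal.coe_inj, coe_stopAt, ENNReal.coe_min]
  rfl

theorem stopAt_add {r₀ : ℝ≥0} {T : ℝ≥0∞} {r : ℝ} (hr : (r₀ : ℝ) ≤ r) :
    stopAt (r₀ + T) r = r₀ + stopAt T (r - r₀) := by
  rw [← ENNReal.coe_inj, ENNReal.coe_add, coe_stopAt, coe_stopAt, ← min_add_add_left]
  congr 1
  rw [← ENNReal.ofReal_coe_nnreal, ← ENNReal.ofReal_add r₀.coe_nonneg (by linarith)]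
  congr 1
  ring

theorem stopAt_le_toNNReal (T : ℝ≥0∞) {r : ℝ} : stopAt T r ≤ r.toNNReal := by
  rw [← ENNReal.coe_le_coe, coe_stopAt]
  exact min_le_left _ _

theorem stopAt_mono (r : ℝ) {T T' : ℝ≥0∞} (h : T ≤ T') : stopAt T r ≤ stopAt T' r := by
  rw [← ENNReal.coe_le_coe, coe_stopAt, coe_stopAt]
  exact min_le_min le_rfl h

section

variable {δ : ℝ} {ℓ : ℝ≥0 → ℝ}

/-- The Stieltjes function is the right continuous version of `ℓ`; its left limits are those of `ℓ`,
that is, the values of `ℓ` by left continuity. At `0` this uses the extension by `0`, so an initial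
lump sum is counted. -/
theorem dividendMeasure_Ico (hℓ : Monotone ℓ) (h0 : ℓ 0 = 0)
    (hcont : ∀ t, ContinuousWithinAt ℓ (Iic t) t) (b : ℝ≥0) :
    dividendMeasure ℓ (Ico 0 b) = ENNReal.ofReal (ℓ b) := by
  have hm : Monotone fun t : ℝ => ℓ t.toNNReal := fun s t hst => hℓ (Real.toNNReal_mono hst)
  have hlim : ∀ a : ℝ≥0, Function.leftLim hm.stieltjesFunction (a : ℝ) = ℓ a := by
    intro a
    have h1 : Function.leftLim (fun t : ℝ => ℓ t.toNNReal) (a : ℝ) = ℓ a := by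
      refine leftLim_eq_of_tendsto ?_
      have h2 : Tendsto Real.toNNReal (𝓝[<] (a : ℝ)) (𝓝[≤] a) := by
        refine tendsto_nhdsWithin_iff.2 ⟨?_, ?_⟩
        · have := (continuous_real_toNNReal.tendsto (a : ℝ)).mono_left
            (nhdsWithin_le_nhds (s := Iio (a : ℝ)))
          simpa using this
        · filter_upwards [self_mem_nhdsWithin] with t ht
          exact Real.toNNReal_le_iff_le_coe.2 (le_of_lt ht)
      exact (hcont a).tendsto.comp h2
    rw [← h1]
    exact _root_.leftLim_rightLim (hm.tendsto_leftLim _)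
  rw [dividendMeasure, dif_pos hm, StieltjesFunction.measure_Ico, hlim b]
  have := hlim 0
  simp only [NNReal.coe_zero] at this
  rw [this, h0, sub_zero]

/-- Integration by parts. -/
theorem discountedDividends_eq (hδ : 0 < δ) (hℓ : Monotone ℓ) (h0 : ℓ 0 = 0)
    (hcont : ∀ t, ContinuousWithinAt ℓ (Iic t) t) (T : ℝ≥0∞) :
    discountedDividends δ ℓ T =
      ∫⁻ r in Ioi (0 : ℝ), ENNReal.ofReal (δ * Real.exp (-δ * r)) *
        ENNReal.ofReal (ℓ (stopAt T r)) := by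
  set A : Set ℝ := {s : ℝ | 0 ≤ s ∧ ENNReal.ofReal s < T} with hAdef
  have hA : MeasurableSet A :=
    (measurableSet_le measurable_const measurable_id).inter
      (measurableSet_lt ENNReal.measurable_ofReal measurable_const)
  have : SFinite (dividendMeasure ℓ) := by
    unfold dividendMeasure
    split_ifs <;> infer_instance
  have hmeas : MeasurableSet {q : ℝ × ℝ | q.1 < q.2} := measurableSet_lt measurable_fst measurable_snd
  have hf : Measurable fun r : ℝ => ENNReal.ofReal (δ * Real.exp (-δ * r)) := by fun_prop
  -- Write e^{-δs} as the integral of δe^{-δr} over r > s and interchange the integrals; the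
  -- dividends with s < r and s < T amount to `ℓ` at the time `r` stopped at `T`.
  calc discountedDividends δ ℓ T
      = ∫⁻ s in A, (∫⁻ r, (Ioi s).indicator
          (fun r => ENNReal.ofReal (δ * Real.exp (-δ * r))) r) ∂(dividendMeasure ℓ) := by
        refine lintegral_congr fun s => ?_
        rw [lintegral_indicator measurableSet_Ioi, lintegral_exp_Ioi hδ]
    _ = ∫⁻ r, (∫⁻ s in A, (Ioi s).indicator
          (fun r => ENNReal.ofReal (δ * Real.exp (-δ * r))) r ∂(dividendMeasure ℓ)) := by
        refine lintegral_lintegral_swap (Measurable.aemeasurable ?_)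
        exact (hf.comp measurable_snd).indicator hmeas
    _ = ∫⁻ r, (Ioi (0 : ℝ)).indicator (fun r => ENNReal.ofReal (δ * Real.exp (-δ * r)) *
        ENNReal.ofReal (ℓ (stopAt T r))) r := by
        refine lintegral_congr fun r => ?_
        have h1 : ∀ s, (Ioi s).indicator (fun r => ENNReal.ofReal (δ * Real.exp (-δ * r))) r =
            (Iio r).indicator (fun _ => ENNReal.ofReal (δ * Real.exp (-δ * r))) s := by
          intro s
          by_cases h : s < r
          · rw [indicator_of_mem (by exact h), indicator_of_mem (by exact h)]
          · rw [indicator_of_notMem (by exact h), indicator_of_notMem (by exact h)]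
        simp_rw [h1]
        rw [lintegral_indicator_const measurableSet_Iio, Measure.restrict_apply measurableSet_Iio]
        by_cases hr : 0 < r
        · rw [indicator_of_mem (by exact hr), ← dividendMeasure_Ico hℓ h0 hcont]
          congr 2
          ext s
          simp only [hAdef, mem_inter_iff, mem_Iio, mem_ofPred_eq, mem_Ico]
          have h2 : 0 ≤ s → (s < stopAt T r ↔ s < r ∧ ENNReal.ofReal s < T) := by
            intro hs
            rw [← ENNReal.ofReal_lt_ofReal_iff_of_nonneg hs, ENNReal.ofReal_coe_nnreal, coe_stopAt,
              lt_min_iff, ENNReal.ofReal_lt_ofReal_iff_of_nonneg hs]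
          constructor
          · rintro ⟨h3, h4, h5⟩
            exact ⟨h4, (h2 h4).2 ⟨h3, h5⟩⟩
          · rintro ⟨h3, h4⟩
            exact ⟨((h2 h3).1 h4).1, h3, ((h2 h3).1 h4).2⟩
        · rw [indicator_of_notMem (by exact hr)]
          have : Iio r ∩ A = ∅ := by
            ext s
            simp only [hAdef, mem_inter_iff, mem_Iio, mem_ofPred_eq, mem_empty_iff_false, iff_false]
            rintro ⟨h3, h4, -⟩
            linarith
          rw [this]
          simp
    _ = _ := lintegral_indicator measurableSet_Ioi _

theorem discountedDividends_le (hδ : 0 < δ) (hℓ : Monotone ℓ) (h0 : ℓ 0 = 0)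
    (hcont : ∀ t, ContinuousWithinAt ℓ (Iic t) t) {T : ℝ≥0∞} {A B : ℝ} (hA : 0 ≤ A) (hB : 0 ≤ B)
    (hle : ∀ t : ℝ≥0, (t : ℝ≥0∞) < T → ℓ t ≤ A + B * t) :
    discountedDividends δ ℓ T ≤ ENNReal.ofReal (2 * A + 4 * B / δ) := by
  -- Left continuity extends the bound to `t = T`, which is needed because `stopAt T r` may equal
  -- `T`.
  have hle' : ∀ t : ℝ≥0, (t : ℝ≥0∞) ≤ T → ℓ t ≤ A + B * t := by
    intro t ht
    rcases ht.lt_or_eq with ht | ht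
    · exact hle t ht
    · rcases eq_zero_or_pos t with rfl | hpos
      · simpa [h0] using hA
      · have h1 : Tendsto ℓ (𝓝[<] t) (𝓝 (ℓ t)) :=
          (hcont t).tendsto.mono_left (nhdsWithin_mono _ Iio_subset_Iic_self)
        have h2 : Tendsto (fun s : ℝ≥0 => A + B * (s : ℝ)) (𝓝[<] t) (𝓝 (A + B * t)) := by
          have : Continuous fun s : ℝ≥0 => A + B * (s : ℝ) := by fun_prop
          exact (this.tendsto t).mono_left nhdsWithin_le_nhds
        have : (𝓝[<] t).NeBot := nhdsLT_neBot_of_exists_lt ⟨0, hpos⟩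
        refine le_of_tendsto_of_tendsto h1 h2 ?_
        filter_upwards [self_mem_nhdsWithin] with s hs
        refine hle s ?_
        rw [← ht]
        exact_mod_cast hs
  rw [discountedDividends_eq hδ hℓ h0 hcont]
  refine le_trans (setLIntegral_mono (by fun_prop) fun r hr => ?_)
    (lintegral_exp_mul_linear_le hδ hA hB)
  gcongr
  refine (hle' _ (stopAt_le T r)).trans ?_
  have : (stopAt T r : ℝ) ≤ r := by
    have := NNReal.coe_le_coe.2 (stopAt_le_toNNReal T (r := r))
    rwa [Real.coe_toNNReal r (le_of_lt hr)] at this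
  gcongr

/-- After integration by parts and a translation of the second integral by `r₀`, the integrands
compare pointwise. Only an inequality results, since the lump sum `c` paid right after `r₀` is
discarded. -/
theorem discountedDividends_restart {ℓ' : ℝ≥0 → ℝ} (hδ : 0 < δ) (hℓ : Monotone ℓ) (h0 : ℓ 0 = 0)
    (hcont : ∀ t, ContinuousWithinAt ℓ (Iic t) t) (hℓ' : Monotone ℓ') (h0' : ℓ' 0 = 0)
    (hcont' : ∀ t, ContinuousWithinAt ℓ' (Iic t) t) {r₀ : ℝ≥0} {T : ℝ≥0∞} {c : ℝ} (hc : 0 ≤ c)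
    (h : ∀ t, 0 < t → ℓ (r₀ + t) = ℓ r₀ + c + ℓ' t) :
    discountedDividends δ ℓ r₀ +
        ENNReal.ofReal (Real.exp (-δ * r₀)) * discountedDividends δ ℓ' T ≤
      discountedDividends δ ℓ (r₀ + T) := by
  have hpos : ∀ t, 0 ≤ ℓ t := fun t => h0 ▸ hℓ (zero_le (a := t))
  have hpos' : ∀ t, 0 ≤ ℓ' t := fun t => h0' ▸ hℓ' (zero_le (a := t))
  have hmeas : Measurable fun r : ℝ => ENNReal.ofReal (δ * Real.exp (-δ * r)) *
      ENNReal.ofReal (ℓ' (stopAt T r)) := by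
    have : Monotone fun r : ℝ => ℓ' (stopAt T r) := fun r s hrs => hℓ' (by
      rw [← ENNReal.coe_le_coe, coe_stopAt, coe_stopAt]
      exact min_le_min (ENNReal.ofReal_le_ofReal hrs) le_rfl)
    exact Measurable.mul (by fun_prop) this.measurable.ennreal_ofReal
  have hmeas₀ : Measurable fun r : ℝ => ENNReal.ofReal (δ * Real.exp (-δ * r)) *
      ENNReal.ofReal (ℓ (stopAt r₀ r)) := by
    have : Monotone fun r : ℝ => ℓ (stopAt r₀ r) := fun r s hrs => hℓ (by
      rw [← ENNReal.coe_le_coe, coe_stopAt, coe_stopAt]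
      exact min_le_min (ENNReal.ofReal_le_ofReal hrs) le_rfl)
    exact Measurable.mul (by fun_prop) this.measurable.ennreal_ofReal
  rw [discountedDividends_eq hδ hℓ h0 hcont, discountedDividends_eq hδ hℓ' h0' hcont',
    discountedDividends_eq hδ hℓ h0 hcont]
  have hshift : ENNReal.ofReal (Real.exp (-δ * r₀)) *
      ∫⁻ r in Ioi (0 : ℝ), ENNReal.ofReal (δ * Real.exp (-δ * r)) *
        ENNReal.ofReal (ℓ' (stopAt T r)) =
      ∫⁻ r in Ioi (0 : ℝ), (Ioi (r₀ : ℝ)).indicator (fun r => ENNReal.ofReal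
        (δ * Real.exp (-δ * r)) * ENNReal.ofReal (ℓ' (stopAt T (r - r₀)))) r := by
    rw [setLIntegral_indicator measurableSet_Ioi,
      inter_eq_left.2 (Ioi_subset_Ioi r₀.coe_nonneg), ← lintegral_const_mul _ hmeas,
      ← lintegral_indicator measurableSet_Ioi, ← lintegral_indicator measurableSet_Ioi,
      ← lintegral_sub_right_eq_self _ (r₀ : ℝ)]
    refine lintegral_congr fun r => ?_
    by_cases hr : (r₀ : ℝ) < r
    · rw [indicator_of_mem (by simpa using hr), indicator_of_mem (by exact hr), ← mul_assoc,
        ← ENNReal.ofReal_mul (Real.exp_nonneg _)]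
      congr 2
      rw [mul_left_comm, ← Real.exp_add]
      congr 2
      ring
    · rw [indicator_of_notMem (by simpa using hr), indicator_of_notMem (by exact hr)]
  rw [hshift, ← lintegral_add_left hmeas₀]
  refine lintegral_mono fun r => ?_
  by_cases hr : (r₀ : ℝ) < r
  · simp only [indicator_of_mem (show r ∈ Ioi (r₀ : ℝ) from hr)]
    rw [← mul_add, ← ENNReal.ofReal_add (hpos _) (hpos' _), stopAt_add hr.le]
    gcongr
    have h1 : stopAt r₀ r = r₀ := by
      rw [stopAt_coe]
      exact min_eq_right (by rw [← Real.toNNReal_coe (r := r₀)]; exact Real.toNNReal_mono hr.le)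
    rw [h1]
    rcases eq_zero_or_pos (stopAt T (r - r₀)) with h2 | h2
    · rw [h2, h0', add_zero, add_zero]
    · rw [h _ h2]
      linarith
  · simp only [indicator_of_notMem (show r ∉ Ioi (r₀ : ℝ) from hr), add_zero]
    gcongr
    exact hℓ (stopAt_mono r le_self_add)

end

/-! ### The predictable σ-algebra -/

theorem exists_rat_toNNReal_btwn {a b : ℝ} (ha : 0 ≤ a) (hab : a < b) :
    ∃ q : ℚ, a < ((q : ℝ).toNNReal : ℝ) ∧ ((q : ℝ).toNNReal : ℝ) < b := by
  obtain ⟨q, h1, h2⟩ := exists_rat_btwn hab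
  refine ⟨q, ?_⟩
  rw [Real.coe_toNNReal _ (ha.trans h1.le)]
  exact ⟨h1, h2⟩

theorem measurable_ite_of_Iio {α : Type*} {mα : MeasurableSpace α} {E : Set α} {f : α → ℝ}
    [DecidablePred (· ∈ E)] (hE : MeasurableSet E)
    (h : ∀ b, MeasurableSet (E ∩ {x | f x < b})) :
    Measurable fun x => if x ∈ E then f x else 0 := by
  refine measurable_of_Iio fun b => ?_
  have : (fun x => if x ∈ E then f x else 0) ⁻¹' Iio b =
      (E ∩ {x | f x < b}) ∪ (Eᶜ ∩ {_x | 0 < b}) := by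
    ext x
    by_cases hx : x ∈ E <;> simp [hx]
  rw [this]
  exact (h b).union (hE.compl.inter (.const _))

/-! ### Claim times and claim sizes observed through the filtration -/

theorem measurableSet_filtration_aggregateClaims_lt (k : Fin 2) (r : ℝ≥0) (b : ℝ) :
    MeasurableSet[filtration r] {ω | aggregateClaims k r ω < b} := by
  have h1 : MeasurableSpace.comap (fun ω => fun k : Fin 2 => aggregateClaims k r ω)
      inferInstance ≤ filtration r :=
    le_iSup₂_of_le (f := fun j (_ : j ≤ r) => MeasurableSpace.comap
      (fun ω => fun k : Fin 2 => aggregateClaims k j ω) inferInstance) r le_rfl le_rfl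
  exact h1 _ ⟨{y | y k < b}, measurableSet_lt (measurable_pi_apply k) measurable_const, rfl⟩

theorem aggregateClaims_lt_iff {k : Fin 2} {q r : ℝ≥0} {ω : Scenario} (hqr : q ≤ r) :
    aggregateClaims k q ω < aggregateClaims k r ω ↔ claimCount k q ω < claimCount k r ω := by
  constructor
  · intro h
    by_contra hle
    have : claimCount k r ω = claimCount k q ω := le_antisymm (not_lt.1 hle) (claimCount_mono k ω hqr)
    simp [aggregateClaims, this] at h
  · intro h
    exact Finset.sum_lt_sum_of_subset (Finset.range_mono h.le) (Finset.mem_range.2 h) (by simp)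
      (claimSize_pos _ _ _) fun j _ _ => (claimSize_pos _ _ _).le

/-- Only aggregate claims are observed, but claims are positive: claim `i + 1` has arrived by `r`
exactly if the aggregate claims increase between some rational time after the arrival of claim `i`
and `r`. A rational `b` between the two values separates the observations. -/
theorem measurableSet_filtration_arrival_le (k : Fin 2) (i : ℕ) (r : ℝ≥0) :
    MeasurableSet[filtration r] {ω | arrival k i ω ≤ r} := by
  induction i generalizing r with
  | zero =>
    have : {ω | arrival k 0 ω ≤ r} = {ω | aggregateClaims k r ω < 0 + 0}ᶜ ∩
        (⋃ n : ℕ, {ω | aggregateClaims k r ω < 1 / ((n : ℝ) + 1)}ᶜ) := by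
      ext ω
      simp only [mem_ofPred_eq, ← lt_claimCount_iff, mem_inter_iff, mem_compl_iff, not_lt, mem_iUnion,
        add_zero, aggregateClaims_nonneg, true_and]
      constructor
      · intro h
        have h1 : aggregateClaims k 0 ω < aggregateClaims k r ω :=
          (aggregateClaims_lt_iff (zero_le)).2 (by simpa using h)
        rw [aggregateClaims_eq_zero (claimCount_zero k ω)] at h1
        obtain ⟨n, hn⟩ := exists_nat_one_div_lt h1
        exact ⟨n, hn.le⟩
      · rintro ⟨n, hn⟩
        by_contra h
        rw [aggregateClaims_eq_zero (by omega)] at hn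
        have : (0 : ℝ) < 1 / ((n : ℝ) + 1) := by positivity
        linarith
    rw [this]
    exact (measurableSet_filtration_aggregateClaims_lt k r _).compl.inter
      (MeasurableSet.iUnion fun n => (measurableSet_filtration_aggregateClaims_lt k r _).compl)
  | succ i ih =>
    have : {ω | arrival k (i + 1) ω ≤ r} = ⋃ (q : ℚ) (b : ℚ), {ω | (q : ℝ).toNNReal < r ∧
        arrival k i ω ≤ (q : ℝ).toNNReal ∧ aggregateClaims k (q : ℝ).toNNReal ω < b ∧
          ¬ aggregateClaims k r ω < b} := by
      ext ω
      simp only [mem_ofPred_eq, mem_iUnion, not_lt]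
      constructor
      · intro h
        have h1 : arrival k i ω < r := (arrival_strictMono k ω (Nat.lt_succ_self i)).trans_le h
        obtain ⟨q, hq1, hq2⟩ := exists_rat_toNNReal_btwn (arrival_pos k i ω).le
          (arrival_strictMono k ω (Nat.lt_succ_self i))
        have hqr : (q : ℝ).toNNReal < r := by exact_mod_cast hq2.trans_le h
        obtain ⟨b, hb1, hb2⟩ := exists_rat_btwn ((aggregateClaims_lt_iff (k := k) (ω := ω) hqr.le).2
          (lt_of_le_of_lt ((claimCount_le_iff k _ ω (i + 1)).2 hq2)
            ((lt_claimCount_iff k r ω (i + 1)).2 h)))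
        exact ⟨q, b, hqr, hq1.le, hb1, hb2.le⟩
      · rintro ⟨q, b, hq, h1, h2, h3⟩
        have h4 := (aggregateClaims_lt_iff hq.le).1 (h2.trans_le h3)
        have h5 := (lt_claimCount_iff k _ ω i).2 h1
        exact (lt_claimCount_iff k r ω (i + 1)).1 (by omega)
    rw [this]
    refine MeasurableSet.iUnion fun q => MeasurableSet.iUnion fun b => ?_
    by_cases hq : (q : ℝ).toNNReal < r
    · simp only [hq, true_and]
      exact (filtration.mono hq.le _ (ih _)).inter
        ((filtration.mono hq.le _ (measurableSet_filtration_aggregateClaims_lt k _ _)).inter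
          (measurableSet_filtration_aggregateClaims_lt k r b).compl)
    · simp [hq]

/-- Total size of the claims `0, …, i`. -/
def partialClaims (k : Fin 2) (i : ℕ) (ω : Scenario) : ℝ :=
  ∑ j ∈ Finset.range (i + 1), claimSize k j ω

theorem partialClaims_le {k : Fin 2} {i : ℕ} {r : ℝ≥0} {ω : Scenario} (h : arrival k i ω ≤ r) :
    partialClaims k i ω ≤ aggregateClaims k r ω :=
  Finset.sum_le_sum_of_subset_of_nonneg
    (Finset.range_mono ((lt_claimCount_iff k r ω i).2 h)) fun j _ _ => (claimSize_pos k j ω).le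

/-- From the arrival of claim `i` until the next one the aggregate claims equal `partialClaims k i`.
A rational time in this interval and before `r` detects this, except if the claim arrives exactly at
`r`, where `r` itself serves. -/
theorem measurableSet_filtration_partialClaims_lt (k : Fin 2) (i : ℕ) (r : ℝ≥0) (b : ℝ) :
    MeasurableSet[filtration r] {ω | arrival k i ω ≤ r ∧ partialClaims k i ω < b} := by
  have : {ω | arrival k i ω ≤ r ∧ partialClaims k i ω < b} =
      {ω | arrival k i ω ≤ r ∧ aggregateClaims k r ω < b} ∪ ⋃ q : ℚ, {ω | (q : ℝ).toNNReal < r ∧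
        arrival k i ω ≤ (q : ℝ).toNNReal ∧ aggregateClaims k (q : ℝ).toNNReal ω < b} := by
    ext ω
    simp only [mem_ofPred_eq, mem_union, mem_iUnion]
    constructor
    · rintro ⟨h1, h2⟩
      have key : ∀ u : ℝ≥0, arrival k i ω ≤ u → (u : ℝ) < arrival k (i + 1) ω →
          aggregateClaims k u ω = partialClaims k i ω := by
        intro u hu hu'
        have : claimCount k u ω = i + 1 :=
          le_antisymm ((claimCount_le_iff _ _ _ _).2 hu') ((lt_claimCount_iff _ _ _ _).2 hu)
        rw [aggregateClaims, this, partialClaims]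
      rcases h1.lt_or_eq with h3 | h3
      · right
        obtain ⟨q, hq1, hq2⟩ := exists_rat_toNNReal_btwn (arrival_pos k i ω).le
          (lt_min h3 (arrival_strictMono k ω (Nat.lt_succ_self i)))
        rw [lt_min_iff] at hq2
        exact ⟨q, by exact_mod_cast hq2.1, hq1.le, by rwa [key _ hq1.le hq2.2]⟩
      · left
        exact ⟨h1, by rwa [key r h1 (h3 ▸ arrival_strictMono k ω (Nat.lt_succ_self i))]⟩
    · rintro (⟨h1, h2⟩ | ⟨q, hq, h1, h2⟩)
      · exact ⟨h1, (partialClaims_le h1).trans_lt h2⟩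
      · exact ⟨h1.trans (by exact_mod_cast hq.le), (partialClaims_le h1).trans_lt h2⟩
  rw [this]
  refine ((measurableSet_filtration_arrival_le k i r).inter
    (measurableSet_filtration_aggregateClaims_lt k r b)).union (MeasurableSet.iUnion fun q => ?_)
  by_cases hq : (q : ℝ).toNNReal < r
  · simp only [hq, true_and]
    exact filtration.mono hq.le _ ((measurableSet_filtration_arrival_le k i _).inter
      (measurableSet_filtration_aggregateClaims_lt k _ b))
  · simp [hq]

/-- Time and scenario, with the predictable σ-algebra. -/
def TimeScenario : Type := ℝ≥0 × Scenario

instance : MeasurableSpace TimeScenario := filtration.predictable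

namespace TimeScenario

def time (q : TimeScenario) : ℝ≥0 := q.1

def scenario (q : TimeScenario) : Scenario := q.2

open Classical in
/-- Arrival time and size of a claim, or zero if it does not arrive before the present time. -/
def past (r : Fin 2 × ℕ) (q : TimeScenario) : ℝ × ℝ :=
  if arrival r.1 r.2 q.scenario < q.time then
    (arrival r.1 r.2 q.scenario, claimSize r.1 r.2 q.scenario) else 0

theorem measurable_time : Measurable time :=
  measurable_of_Ioi fun i => by
    have : time ⁻¹' Ioi i = (Ioi i ×ˢ univ : Set (ℝ≥0 × Scenario)) := by
      ext q
      change i < q.1 ↔ i < q.1 ∧ True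
      simp
    rw [this]
    exact measurableSet_predictable_Ioi_prod MeasurableSet.univ

/-- An event observable strictly before the present is a countable union of predictable rectangles
(r, ∞) × B r, with `r` ranging over the rationals. -/
theorem measurableSet_iUnion_rat {f : TimeScenario → ℝ} {A : TimeScenario → Prop}
    (B : ℚ → Set Scenario)
    (hB : ∀ r : ℚ, MeasurableSet[filtration (r : ℝ).toNNReal] (B r))
    (h : ∀ q, (A q ∧ f q < q.time) ↔ ∃ r : ℚ, (r : ℝ).toNNReal < q.time ∧ q.scenario ∈ B r) :
    MeasurableSet {q : TimeScenario | A q ∧ f q < q.time} := by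
  have : {q : TimeScenario | A q ∧ f q < q.time} =
      ⋃ r : ℚ, (Ioi (r : ℝ).toNNReal ×ˢ B r : Set (ℝ≥0 × Scenario)) := by
    ext q
    rw [mem_ofPred_eq, h q]
    exact (mem_iUnion (x := q)
      (s := fun r : ℚ => (Ioi (r : ℝ).toNNReal ×ˢ B r : Set (ℝ≥0 × Scenario)))).symm
  rw [this]
  exact MeasurableSet.iUnion fun r => measurableSet_predictable_Ioi_prod (hB r)

theorem measurableSet_arrival_lt (k : Fin 2) (i : ℕ) (b : ℝ) :
    MeasurableSet {q : TimeScenario | arrival k i q.scenario < b ∧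
      arrival k i q.scenario < q.time} := by
  refine measurableSet_iUnion_rat
    (fun r => {ω | arrival k i ω ≤ (r : ℝ).toNNReal ∧ ((r : ℝ).toNNReal : ℝ) < b})
    (fun r => (measurableSet_filtration_arrival_le k i _).inter (.const _)) fun q => ?_
  constructor
  · rintro ⟨h1, h2⟩
    obtain ⟨r, hr1, hr2⟩ := exists_rat_toNNReal_btwn (arrival_pos k i q.scenario).le (lt_min h1 h2)
    rw [lt_min_iff] at hr2
    exact ⟨r, by exact_mod_cast hr2.2, hr1.le, hr2.1⟩
  · rintro ⟨r, hr1, hr2, hr3⟩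
    exact ⟨lt_of_le_of_lt hr2 hr3, lt_of_le_of_lt hr2 (by exact_mod_cast hr1)⟩

theorem measurableSet_partialClaims_lt (k : Fin 2) (i : ℕ) (b : ℝ) :
    MeasurableSet {q : TimeScenario | partialClaims k i q.scenario < b ∧
      arrival k i q.scenario < q.time} := by
  refine measurableSet_iUnion_rat
    (fun r => {ω | arrival k i ω ≤ (r : ℝ).toNNReal ∧ partialClaims k i ω < b})
    (fun r => measurableSet_filtration_partialClaims_lt k i _ b) fun q => ?_
  constructor
  · rintro ⟨h1, h2⟩
    obtain ⟨r, hr1, hr2⟩ := exists_rat_toNNReal_btwn (arrival_pos k i q.scenario).le h2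
    exact ⟨r, by exact_mod_cast hr2, hr1.le, h1⟩
  · rintro ⟨r, hr1, hr2, hr3⟩
    exact ⟨hr3, lt_of_le_of_lt hr2 (by exact_mod_cast hr1)⟩

theorem measurableSet_arrived (k : Fin 2) (i : ℕ) :
    MeasurableSet {q : TimeScenario | arrival k i q.scenario < q.time} := by
  have : {q : TimeScenario | arrival k i q.scenario < q.time} = ⋃ n : ℕ,
      {q : TimeScenario | arrival k i q.scenario < n ∧ arrival k i q.scenario < q.time} := by
    ext q
    simp only [mem_ofPred_eq, mem_iUnion]
    constructor
    · intro h
      obtain ⟨n, hn⟩ := exists_nat_gt (arrival k i q.scenario)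
      exact ⟨n, hn, h⟩
    · rintro ⟨n, -, h⟩
      exact h
  rw [this]
  exact MeasurableSet.iUnion fun n => measurableSet_arrival_lt k i n

open Classical in
theorem measurable_past (r : Fin 2 × ℕ) : Measurable (past r) := by
  obtain ⟨k, i⟩ := r
  have hE : ∀ i, MeasurableSet {q : TimeScenario | arrival k i q.scenario < q.time} :=
    measurableSet_arrived k
  have h1 : Measurable fun q : TimeScenario =>
      if q ∈ {q : TimeScenario | arrival k i q.scenario < q.time} then
        arrival k i q.scenario else 0 :=
    measurable_ite_of_Iio (hE i) fun b => by
      rw [inter_comm]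
      exact measurableSet_arrival_lt k i b
  have h2 : ∀ i, Measurable fun q : TimeScenario =>
      if q ∈ {q : TimeScenario | arrival k i q.scenario < q.time} then
        partialClaims k i q.scenario else 0 := fun i =>
    measurable_ite_of_Iio (hE i) fun b => by
      rw [inter_comm]
      exact measurableSet_partialClaims_lt k i b
  have h3 : Measurable fun q : TimeScenario =>
      if q ∈ {q : TimeScenario | arrival k i q.scenario < q.time} then
        claimSize k i q.scenario else 0 := by
    rcases i with _ | i
    · convert h2 0 using 2
      simp [partialClaims]
    · convert ((h2 (i + 1)).sub (h2 i)).indicator (hE (i + 1)) using 2 with q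
      by_cases h : arrival k (i + 1) q.scenario < q.time
      · have h' : arrival k i q.scenario < q.time :=
          (arrival_strictMono k q.scenario (Nat.lt_succ_self i)).trans h
        simp [partialClaims, h, h', Finset.sum_range_succ _ (i + 1)]
      · simp [h]
  convert h1.prodMk h3 using 2 with q
  simp only [past, mem_ofPred_eq]
  split_ifs <;> rfl

theorem past_fst_pos_iff (k : Fin 2) (i : ℕ) (q : TimeScenario) :
    0 < (past (k, i) q).1 ↔ arrival k i q.scenario < q.time := by
  simp only [past]
  split_ifs with h
  · simp [h, arrival_pos]
  · simp [h]

theorem past_of_lt {k : Fin 2} {i : ℕ} {q : TimeScenario} (h : arrival k i q.scenario < q.time) :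
    past (k, i) q = (arrival k i q.scenario, claimSize k i q.scenario) := if_pos h

theorem past_of_not_lt {k : Fin 2} {i : ℕ} {q : TimeScenario}
    (h : ¬ arrival k i q.scenario < q.time) : past (k, i) q = 0 := if_neg h

end TimeScenario

/-! ### Maps into the predictable σ-algebra, tested on the claims strictly in the past -/

namespace TimeScenario

section

variable {α : Type*} [MeasurableSpace α] {T : α → TimeScenario}

/-- Claims up to a time strictly before the present belong to the past, so their number can be read
off `past`. -/
theorem measurable_claimCount_of_lt (hp : ∀ r, Measurable fun x => past r (T x)) {f : α → ℝ≥0}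
    (hf : Measurable f) (hlt : ∀ x, f x < (T x).time) (k : Fin 2) :
    Measurable fun x => claimCount k (f x) (T x).scenario := by
  refine measurable_of_Ioi fun n => ?_
  have : (fun x => claimCount k (f x) (T x).scenario) ⁻¹' Ioi n =
      {x | 0 < (past (k, n) (T x)).1} ∩ {x | (past (k, n) (T x)).1 ≤ f x} := by
    ext x
    simp only [mem_preimage, mem_Ioi, lt_claimCount_iff, mem_inter_iff, mem_ofPred_eq,
      past_fst_pos_iff]
    constructor
    · intro h
      have : arrival k n (T x).scenario < (T x).time :=
        lt_of_le_of_lt h (by exact_mod_cast hlt x)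
      exact ⟨this, by rwa [past_of_lt this]⟩
    · rintro ⟨h1, h2⟩
      rwa [past_of_lt h1] at h2
  rw [this]
  exact (measurableSet_lt measurable_const (hp (k, n)).fst).inter
    (measurableSet_le (hp (k, n)).fst hf.coe_nnreal_real)

theorem measurable_aggregateClaims_of_lt (hp : ∀ r, Measurable fun x => past r (T x)) {f : α → ℝ≥0}
    (hf : Measurable f) (hlt : ∀ x, f x < (T x).time) (k : Fin 2) :
    Measurable fun x => aggregateClaims k (f x) (T x).scenario := by
  have h : Measurable fun y : ℕ × α => ∑ i ∈ Finset.range y.1, (past (k, i) (T y.2)).2 :=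
    measurable_from_prod_countable_right fun n =>
      Finset.measurable_sum (Finset.range n) fun i _ => (hp (k, i)).snd
  convert h.comp ((measurable_claimCount_of_lt hp hf hlt k).prodMk measurable_id) using 2 with x
  refine Finset.sum_congr rfl fun i hi => ?_
  have h1 := (lt_claimCount_iff _ _ _ _).1 (Finset.mem_range.1 hi)
  have h2 : arrival k i (T x).scenario < (T x).time :=
    lt_of_le_of_lt h1 (by exact_mod_cast hlt x)
  simp [past_of_lt h2]

theorem measurableSet_of_aggregateClaims {S : Set α} (hS : MeasurableSet S) (i : ℝ≥0)
    (h : ∀ j ≤ i, ∀ k, Measurable fun x : S => aggregateClaims k j (T x).scenario)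
    {A : Set Scenario} (hA : MeasurableSet[filtration i] A) :
    MeasurableSet (S ∩ {x | (T x).scenario ∈ A}) := by
  have hle : (filtration i).comap (fun x : S => (T x).scenario) ≤ Subtype.instMeasurableSpace := by
    change MeasurableSpace.comap (fun x : S => (T x).scenario)
      (⨆ j, ⨆ (_ : j ≤ i), MeasurableSpace.comap
        (fun ω => fun k : Fin 2 => aggregateClaims k j ω) inferInstance) ≤ _
    simp only [MeasurableSpace.comap_iSup, MeasurableSpace.comap_comp]
    refine iSup₂_le fun j hj => ?_
    rw [← measurable_iff_comap_le]
    exact measurable_pi_lambda _ fun k => h j hj k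
  have h1 : MeasurableSet {x : S | (T x).scenario ∈ A} := hle _ ⟨A, hA, rfl⟩
  have h2 := hS.subtype_image h1
  convert h2 using 1
  ext x
  simp [and_comm]

/-- A map is measurable for the predictable σ-algebra if the time and the past
claims are measurable along it. -/
theorem measurable_of_past (ht : Measurable fun x => (T x).time)
    (hp : ∀ r, Measurable fun x => past r (T x)) : Measurable T := by
  refine measurable_generateFrom ?_
  -- The generators are {0} × A with A observable at time 0, where nothing has happened yet, and (i,
  -- ∞) × A with A observable at time i, which then lies strictly in the past.
  rintro - (⟨A, hA, rfl⟩ | ⟨i, A, hA, rfl⟩)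
  · have h0 : MeasurableSet {x | (T x).time = 0} := ht (measurableSet_singleton 0)
    refine measurableSet_of_aggregateClaims (T := T) h0 0 (fun j hj k => ?_) hA
    have : j = 0 := le_antisymm hj zero_le
    subst this
    simp only [aggregateClaims_eq_zero (claimCount_zero _ _)]
    exact measurable_const
  · have hS : MeasurableSet {x | i < (T x).time} := measurableSet_lt measurable_const ht
    refine measurableSet_of_aggregateClaims (T := T) hS i (fun j hj k => ?_) hA
    exact measurable_aggregateClaims_of_lt (T := fun x : {x | i < (T x).time} => T x)
      (fun r => (hp r).comp measurable_subtype_coe) measurable_const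
      (fun x => hj.trans_lt x.2) k

end

/-! ### Restarting at a random time -/

section

variable {σ : Scenario → ℝ≥0}

/-- Measurability of `min σ time` says that `σ` is observable once it has passed; it is the only
property of the switching time that is used below. -/
theorem measurableSet_random_lt
    (hσ : Measurable fun q : TimeScenario => min (σ q.scenario) q.time) :
    MeasurableSet {q : TimeScenario | σ q.scenario < q.time} := by
  have : {q : TimeScenario | σ q.scenario < q.time} =
      {q : TimeScenario | min (σ q.scenario) q.time < q.time} := by
    ext q
    simp
  rw [this]
  exact measurableSet_lt hσ measurable_time

/-- Time and scenario seen from the random time `σ`. -/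
def restart (σ : Scenario → ℝ≥0) (q : TimeScenario) : TimeScenario :=
  (q.time - σ q.scenario, shift (σ q.scenario) q.scenario)

theorem measurable_random_subtype
    (hσ : Measurable fun q : TimeScenario => min (σ q.scenario) q.time) :
    Measurable fun q : {q : TimeScenario | σ q.scenario < q.time} => σ q.1.scenario := by
  have h : (fun q : {q : TimeScenario | σ q.scenario < q.time} => σ q.1.scenario) =
      fun q => min (σ q.1.scenario) q.1.time := funext fun q => (min_eq_left (le_of_lt q.2)).symm
  rw [h]
  exact hσ.comp measurable_subtype_coe

theorem past_restart_of_lt {q : TimeScenario} (h : σ q.scenario < q.time) (k : Fin 2) (i : ℕ) :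
    past (k, i) (restart σ q) =
      if 0 < (past (k, claimCount k (σ q.scenario) q.scenario + i) q).1 then
        ((past (k, claimCount k (σ q.scenario) q.scenario + i) q).1 - σ q.scenario,
          (past (k, claimCount k (σ q.scenario) q.scenario + i) q).2) else 0 := by
  have h1 : arrival k i (restart σ q).scenario < (restart σ q).time ↔
      arrival k (claimCount k (σ q.scenario) q.scenario + i) q.scenario < q.time := by
    change arrival k i (shift _ _) < ((q.time - σ q.scenario : ℝ≥0) : ℝ) ↔ _
    rw [arrival_shift, NNReal.coe_sub h.le]
    exact sub_lt_sub_iff_right _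
  by_cases h2 : arrival k (claimCount k (σ q.scenario) q.scenario + i) q.scenario < q.time
  · rw [if_pos ((past_fst_pos_iff _ _ _).2 h2), past_of_lt (h1.2 h2), past_of_lt h2]
    change (arrival k i (shift _ _), claimSize k i (shift _ _)) = _
    rw [arrival_shift, claimSize_shift]
  · rw [if_neg (mt (past_fst_pos_iff _ _ _).1 h2), past_of_not_lt (mt h1.1 h2)]

/-- The past claims seen from `σ` are past claims of the original scenario, renumbered by the number
of claims up to `σ`. That number is measurable and takes countably many values. This is what makes a
strategy started at a random time predictable. -/
theorem measurable_restart (hσ : Measurable fun q : TimeScenario => min (σ q.scenario) q.time) :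
    Measurable (restart σ) := by
  refine measurable_of_past ?_ fun ⟨k, i⟩ => ?_
  · convert measurable_time.sub hσ using 2 with q
    change q.time - σ q.scenario = q.time - min (σ q.scenario) q.time
    rcases le_total (σ q.scenario) q.time with h | h
    · rw [min_eq_left h]
    · rw [min_eq_right h, tsub_eq_zero_of_le h, tsub_self]
  · set S : Set TimeScenario := {q | σ q.scenario < q.time} with hSdef
    have hS : MeasurableSet S := measurableSet_random_lt hσ
    refine measurable_of_restrict_of_restrict_compl hS ?_ ?_
    · have hp : ∀ r, Measurable fun q : S => past r q.1 := fun r =>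
        (measurable_past r).comp measurable_subtype_coe
      have hσ' := measurable_random_subtype hσ
      have hN := measurable_claimCount_of_lt hp hσ' (fun q => q.2) k
      have h : Measurable fun y : ℕ × S => if 0 < (past (k, y.1 + i) y.2.1).1 then
          ((past (k, y.1 + i) y.2.1).1 - (σ y.2.1.scenario : ℝ), (past (k, y.1 + i) y.2.1).2)
            else 0 :=
        measurable_from_prod_countable_right fun n =>
          Measurable.ite (measurableSet_lt measurable_const (hp (k, n + i)).fst)
            (((hp (k, n + i)).fst.sub hσ'.coe_nnreal_real).prodMk (hp (k, n + i)).snd)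
            measurable_const
      have h0 : S.domRestrict (fun q => past (k, i) (restart σ q)) =
          (fun y : ℕ × S => if 0 < (past (k, y.1 + i) y.2.1).1 then
            ((past (k, y.1 + i) y.2.1).1 - (σ y.2.1.scenario : ℝ), (past (k, y.1 + i) y.2.1).2)
              else 0) ∘ fun q : S => (claimCount k (σ q.1.scenario) q.1.scenario, q) :=
        funext fun q => past_restart_of_lt q.2 k i
      rw [h0]
      exact h.comp (hN.prodMk measurable_id)
    · have h0 : Sᶜ.domRestrict (fun q => past (k, i) (restart σ q)) = fun _ => 0 := by
        funext q
        have hq : ¬ σ q.1.scenario < q.1.time := q.2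
        refine past_of_not_lt (not_lt.2 ?_)
        change ((q.1.time - σ q.1.scenario : ℝ≥0) : ℝ) ≤ _
        rw [tsub_eq_zero_of_le (not_lt.1 hq)]
        exact (arrival_pos _ _ _).le
      rw [h0]
      exact measurable_const

end

end TimeScenario

theorem isStronglyPredictable_iff {L : ℝ≥0 → Scenario → ℝ} : IsStronglyPredictable filtration L ↔
    Measurable fun q : TimeScenario => L q.time q.scenario :=
  stronglyMeasurable_iff_measurable

/-! ### The first claim -/

theorem coe_claimTime_one (ω : Scenario) :
    (claimTime 1 ω : ℝ) = min (arrival 0 0 ω) (arrival 1 0 ω) := by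
  have h0 : 0 ≤ min (arrival 0 0 ω) (arrival 1 0 ω) :=
    le_min (arrival_pos _ _ _).le (arrival_pos _ _ _).le
  have : claimTime 1 ω = NNReal.mk (min (arrival 0 0 ω) (arrival 1 0 ω)) h0 := by
    refine eq_of_forall_ge_iff fun t => ?_
    rw [claimTime_le_iff, ← NNReal.coe_le_coe, NNReal.coe_mk, min_le_iff, ← lt_claimCount_iff,
      ← lt_claimCount_iff, totalCount]
    omega
  rw [this]
  rfl

/-- The time of the first claim, or `s` if this is earlier. -/
def switchTime (s : ℝ≥0∞) (ω : Scenario) : ℝ≥0 := (min (claimTime 1 ω : ℝ≥0∞) s).toNNReal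

theorem coe_switchTime (s : ℝ≥0∞) (ω : Scenario) :
    (switchTime s ω : ℝ≥0∞) = min (claimTime 1 ω : ℝ≥0∞) s :=
  ENNReal.coe_toNNReal (ne_top_of_le_ne_top ENNReal.coe_ne_top (min_le_left _ _))

theorem switchTime_le (s : ℝ≥0∞) (ω : Scenario) : switchTime s ω ≤ claimTime 1 ω := by
  rw [← ENNReal.coe_le_coe, coe_switchTime]
  exact min_le_left _ _

theorem switchTime_eq (s : ℝ≥0∞) (ω : Scenario) : switchTime s ω = claimTime 1 ω ∨
    (switchTime s ω < claimTime 1 ω ∧ (switchTime s ω : ℝ≥0∞) = s) := by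
  rcases (switchTime_le s ω).eq_or_lt with h | h
  · exact Or.inl h
  · refine Or.inr ⟨h, ?_⟩
    rw [← ENNReal.coe_lt_coe, coe_switchTime] at h
    rw [coe_switchTime]
    exact min_eq_right (le_of_not_gt fun h' => absurd h (by rw [min_eq_left h'.le]; exact lt_irrefl _))

theorem switchTime_top (ω : Scenario) : switchTime ∞ ω = claimTime 1 ω := by
  rw [← ENNReal.coe_inj, coe_switchTime]
  simp

/-- The minimum of a first arrival and the present time is the arrival itself if it is past, and the
present time otherwise; both are predictable. -/
theorem measurable_min_switchTime (s : ℝ≥0∞) :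
    Measurable fun q : TimeScenario => min (switchTime s q.scenario) q.time := by
  have h1 : ∀ k, Measurable fun q : TimeScenario => min (arrival k 0 q.scenario) q.time := by
    intro k
    have h : Measurable fun q : TimeScenario => if 0 < (TimeScenario.past (k, 0) q).1 then
        (TimeScenario.past (k, 0) q).1 else (q.time : ℝ) := Measurable.ite
      (measurableSet_lt measurable_const (TimeScenario.measurable_past (k, 0)).fst)
      (TimeScenario.measurable_past (k, 0)).fst TimeScenario.measurable_time.coe_nnreal_real
    convert h using 2 with q
    simp only [TimeScenario.past_fst_pos_iff]
    split_ifs with hlt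
    · rw [TimeScenario.past_of_lt hlt, min_eq_left hlt.le]
    · exact min_eq_right (not_lt.1 hlt)
  have h2 : Measurable fun q : TimeScenario => min (claimTime 1 q.scenario) q.time := by
    have : Measurable fun q : TimeScenario => ((min (claimTime 1 q.scenario) q.time : ℝ≥0) : ℝ) := by
      convert (h1 0).min (h1 1) using 2 with q
      rw [NNReal.coe_min, coe_claimTime_one]
      exact inf_inf_distrib_right _ _ _
    convert this.real_toNNReal using 2 with q
    exact Real.toNNReal_coe.symm
  have h3 := (h2.coe_nnreal_ennreal.min (measurable_const (a := s))).ennreal_toNNReal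
  convert h3 using 2 with q
  rw [← ENNReal.coe_inj, ENNReal.coe_min, coe_switchTime, ENNReal.coe_toNNReal, ENNReal.coe_min]
  · exact inf_right_comm _ _ _
  · exact ne_top_of_le_ne_top ENNReal.coe_ne_top (min_le_left _ _)

variable {m : Model} {z g : Fin 2 → ℝ} {L M : Fin 2 → ℝ≥0 → Scenario → ℝ} {ω : Scenario}

/-! ### Payoffs -/

/-- The discounted payoff of a strategy in the scenario `ω`. -/
def payoff (m : Model) (z : Fin 2 → ℝ) (L : Fin 2 → ℝ≥0 → Scenario → ℝ) (ω : Scenario) : ℝ≥0∞ :=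
  (∑ k, ENNReal.ofReal (m.a k) *
      discountedDividends m.δ (fun t => L k t ω) (ruinTime m z L ω)) +
    if ruinTime m z L ω = ∞ then 0 else terminalValue m z L (ruinTime m z L ω).toNNReal ω

theorem strategyValue_eq (m : Model) (z : Fin 2 → ℝ) (L : Fin 2 → ℝ≥0 → Scenario → ℝ) :
    strategyValue m z L = ∫⁻ ω, payoff m z L ω ∂(law m) := rfl

theorem IsDividendProcess.discountedDividends_eq {ℱ : Filtration ℝ≥0 inferInstance}
    {L : ℝ≥0 → Scenario → ℝ} (hL : IsDividendProcess ℱ L) {δ : ℝ} (hδ : 0 < δ) (ω : Scenario)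
    (T : ℝ≥0∞) : discountedDividends δ (fun t => L t ω) T =
      ∫⁻ r in Ioi (0 : ℝ), ENNReal.ofReal (δ * Real.exp (-δ * r)) *
        ENNReal.ofReal (L (stopAt T r) ω) :=
  Collab.discountedDividends_eq hδ (hL.mono ω) (hL.zero ω) (hL.left_continuous ω) T

/-- Dividends and terminal value split at `r`, the later ones carrying the additional discount
factor. Equality is lost only through the lump sum right after `r`, which is dropped. -/
theorem Restarts.le_payoff {r : ℝ≥0} (h : Restarts m z g L M ω r) (hg : ∀ k, 0 ≤ g k)
    (hr : ∀ t ≤ r, 0 ≤ surplus m z L 0 t ω + surplus m z L 1 t ω)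
    (hgr : ∀ k, g k ≤ surplus m z L k r ω)
    (hL : ∀ k, IsDividendProcess filtration (L k)) (hM : ∀ k, IsDividendProcess filtration (M k))
    (hadm : PathAdmissible m g M (shift r ω)) :
    (∑ k, ENNReal.ofReal (m.a k) * discountedDividends m.δ (fun t => L k t ω) r) +
      ENNReal.ofReal (Real.exp (-m.δ * r)) * payoff m g M (shift r ω) ≤ payoff m z L ω := by
  have hruin := h.ruinTime_eq hg hr
  have hterm : ENNReal.ofReal (Real.exp (-m.δ * r)) * (if ruinTime m g M (shift r ω) = ∞ then 0 else
      terminalValue m g M (ruinTime m g M (shift r ω)).toNNReal (shift r ω)) ≤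
      if ruinTime m z L ω = ∞ then 0 else terminalValue m z L (ruinTime m z L ω).toNNReal ω := by
    by_cases htop : ruinTime m g M (shift r ω) = ∞
    · simp [htop]
    · obtain ⟨u, hu⟩ : ∃ u : ℝ≥0, (u : ℝ≥0∞) = ruinTime m g M (shift r ω) :=
        ⟨_, ENNReal.coe_toNNReal htop⟩
      have hpos : 0 < u := by
        rcases eq_zero_or_pos u with rfl | hpos
        · have := hadm.ruin 0 hu.symm
          rw [surplus_zero h.start, surplus_zero h.start] at this
          linarith [hg 0, hg 1]
        · exact hpos
      have hu' : ruinTime m z L ω = ((r + u : ℝ≥0) : ℝ≥0∞) := by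
        rw [hruin, ← hu]
        push_cast
        rfl
      rw [if_neg htop, hu', if_neg ENNReal.coe_ne_top, ENNReal.toNNReal_coe, ← hu,
        ENNReal.toNNReal_coe, terminalValue, terminalValue, ← mul_assoc,
        ← ENNReal.ofReal_mul (Real.exp_nonneg _), ← Real.exp_add]
      refine le_of_eq ?_
      congr 1
      · congr 2
        push_cast
        ring
      · refine Finset.sum_congr rfl fun k _ => ?_
        rw [h.surplus_eq hpos]
  rw [payoff, payoff, mul_add, ← add_assoc, Finset.mul_sum, ← Finset.sum_add_distrib]
  refine add_le_add (Finset.sum_le_sum fun k _ => ?_) hterm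
  rw [mul_left_comm, ← mul_add, hruin]
  gcongr
  exact discountedDividends_restart m.δ_pos ((hL k).mono ω) ((hL k).zero ω)
    ((hL k).left_continuous ω) ((hM k).mono _) ((hM k).zero _) ((hM k).left_continuous _)
    (sub_nonneg.2 (hgr k)) fun t ht => h.eq k t ht

/-! ### Paying out everything from the start -/

/-- Take the money and run. -/
def runStrategy (m : Model) (z : Fin 2 → ℝ) (k : Fin 2) (t : ℝ≥0) (_ : Scenario) : ℝ :=
  if t = 0 then 0 else z k + m.p k * t

theorem isDividendProcess_deterministic {ℓ : ℝ≥0 → ℝ} (h0 : ℓ 0 = 0) (hmono : Monotone ℓ)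
    (hcont : ∀ t, ContinuousWithinAt ℓ (Iic t) t) :
    IsDividendProcess filtration fun t _ => ℓ t where
  predictable := isStronglyPredictable_iff.2 (hmono.measurable.comp TimeScenario.measurable_time)
  zero _ := h0
  mono _ := hmono
  left_continuous _ := hcont

theorem isDividendProcess_runStrategy (m : Model) (hz : ∀ k, 0 ≤ z k) (k : Fin 2) :
    IsDividendProcess filtration (runStrategy m z k) := by
  refine isDividendProcess_deterministic (ℓ := fun t => if t = 0 then 0 else z k + m.p k * t)
    (if_pos rfl) (fun s t hst => ?_) fun t => ?_
  · have hp := p_pos m k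
    have hst' : (s : ℝ) ≤ t := by exact_mod_cast hst
    simp only
    split_ifs with h1 h2 h2
    · rfl
    · have := hz k
      positivity
    · exact absurd (le_antisymm (h2 ▸ hst) zero_le) h1
    · gcongr
  · rcases eq_zero_or_pos t with rfl | ht
    · have : Iic (0 : ℝ≥0) = {0} := by ext; simp
      rw [this]
      exact continuousWithinAt_singleton
    · refine ContinuousAt.continuousWithinAt ?_
      have h : (fun t : ℝ≥0 => z k + m.p k * (t : ℝ)) =ᶠ[𝓝 t]
          fun t => if t = 0 then 0 else z k + m.p k * t := by
        filter_upwards [lt_mem_nhds ht] with s hs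
        rw [if_neg hs.ne']
      exact ContinuousAt.congr (by fun_prop) h

theorem sum_aggregateClaims_claimTime_one_pos (ω : Scenario) :
    0 < aggregateClaims 0 (claimTime 1 ω) ω + aggregateClaims 1 (claimTime 1 ω) ω := by
  have h := totalCount_claimTime 1 ω
  have hpos : ∀ k, 0 < claimCount k (claimTime 1 ω) ω →
      0 < aggregateClaims k (claimTime 1 ω) ω := fun k hk =>
    Finset.sum_pos (fun i _ => claimSize_pos k i ω) ⟨0, by simpa using hk⟩
  have h0 := aggregateClaims_nonneg 0 (claimTime 1 ω) ω
  have h1 := aggregateClaims_nonneg 1 (claimTime 1 ω) ω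
  rw [totalCount] at h
  rcases Nat.eq_zero_or_pos (claimCount 0 (claimTime 1 ω) ω) with h2 | h2
  · linarith [hpos 1 (by omega)]
  · linarith [hpos 0 h2]


/-- The strategy `L` pays out everything from the start until the first claim. -/
structure RunsUntilClaim (m : Model) (z : Fin 2 → ℝ) (L : Fin 2 → ℝ≥0 → Scenario → ℝ)
    (ω : Scenario) : Prop where
  zero : ∀ k, L k 0 ω = 0
  eq : ∀ k, ∀ t ≤ claimTime 1 ω, 0 < t → L k t ω = z k + m.p k * t

namespace RunsUntilClaim

theorem surplus_claimTime (h : RunsUntilClaim m z L ω) (k : Fin 2) :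
    surplus m z L k (claimTime 1 ω) ω = -aggregateClaims k (claimTime 1 ω) ω := by
  have h1 : (fun i => freeSurplus m z i (claimTime 1 ω) ω - L i (claimTime 1 ω) ω) =
      fun i => -aggregateClaims i (claimTime 1 ω) ω := by
    funext i
    rw [h.eq i _ le_rfl (claimTime_pos le_rfl ω), freeSurplus]
    ring
  rw [surplus_claimTime_one, h1, settle_of_neg]
  linarith [sum_aggregateClaims_claimTime_one_pos ω]

theorem joint_neg (h : RunsUntilClaim m z L ω) :
    surplus m z L 0 (claimTime 1 ω) ω + surplus m z L 1 (claimTime 1 ω) ω < 0 := by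
  rw [h.surplus_claimTime, h.surplus_claimTime]
  linarith [sum_aggregateClaims_claimTime_one_pos ω]

theorem surplus_nonneg (h : RunsUntilClaim m z L ω) (hz : ∀ k, 0 ≤ z k) {t : ℝ≥0}
    (ht : t < claimTime 1 ω) (k : Fin 2) : 0 ≤ surplus m z L k t ω := by
  rcases eq_zero_or_pos t with rfl | hpos
  · rw [surplus_zero h.zero]
    exact hz k
  · rw [surplus_of_lt_claimTime ht, h.eq k t ht.le hpos, sub_self]

theorem pathAdmissible (h : RunsUntilClaim m z L ω) (hz : ∀ k, 0 ≤ z k) :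
    PathAdmissible m z L ω :=
  pathAdmissible_of_ruin_at_claim (fun _ ht k => h.surplus_nonneg hz ht k) h.joint_neg

theorem ruinTime_eq (h : RunsUntilClaim m z L ω) (hz : ∀ k, 0 ≤ z k) :
    ruinTime m z L ω = claimTime 1 ω :=
  ruinTime_eq_claimTime_one (fun _ ht => add_nonneg (h.surplus_nonneg hz ht 0)
    (h.surplus_nonneg hz ht 1)) h.joint_neg

/-- The surpluses are zero after the initial payment and the first claim causes ruin, so the
starting point enters only through the initial lump sum. This makes V^0 affine. -/
theorem payoff_eq (h : RunsUntilClaim m z L ω) (hz : ∀ k, 0 ≤ z k)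
    (hL : ∀ k, IsDividendProcess filtration (L k)) :
    payoff m z L ω = ENNReal.ofReal (∑ k, m.a k * z k) + payoff m 0 (runStrategy m 0) ω := by
  have hrun : RunsUntilClaim m 0 (runStrategy m 0) ω :=
    ⟨fun k => if_pos rfl, fun k t _ ht => if_neg ht.ne'⟩
  have hp := p_pos m
  rw [payoff, payoff, h.ruinTime_eq hz, hrun.ruinTime_eq fun _ => le_rfl, ← add_assoc,
    if_neg ENNReal.coe_ne_top, if_neg ENNReal.coe_ne_top, ENNReal.toNNReal_coe]
  congr 1
  · rw [ENNReal.ofReal_sum_of_nonneg fun k _ => mul_nonneg (m.a_nonneg k) (hz k),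
      ← Finset.sum_add_distrib]
    refine Finset.sum_congr rfl fun k _ => ?_
    rw [ENNReal.ofReal_mul (m.a_nonneg k), ← mul_add, (hL k).discountedDividends_eq m.δ_pos,
      (isDividendProcess_runStrategy m (z := 0) (fun _ => le_rfl) k).discountedDividends_eq m.δ_pos]
    congr 1
    have h1 : ENNReal.ofReal (z k) = ∫⁻ r in Ioi (0 : ℝ),
        ENNReal.ofReal (m.δ * Real.exp (-m.δ * r)) * ENNReal.ofReal (z k) := by
      rw [lintegral_mul_const _ (by fun_prop), lintegral_exp_Ioi m.δ_pos]
      simp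
    rw [h1, ← lintegral_add_left (by fun_prop)]
    refine setLIntegral_congr_fun measurableSet_Ioi fun r hr => ?_
    have hpos : 0 < stopAt (claimTime 1 ω) r := by
      rw [stopAt_coe]
      exact lt_min (Real.toNNReal_pos.2 hr) (claimTime_pos le_rfl ω)
    have hle : stopAt (claimTime 1 ω) r ≤ claimTime 1 ω := 
      ENNReal.coe_le_coe.1 (stopAt_le _ r)
    rw [h.eq k _ hle hpos, ← mul_add, hrun.eq k _ hle hpos, ← ENNReal.ofReal_add (hz k)
      (by have := hp k; simp only [Pi.zero_apply, zero_add]; positivity)]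
    simp
  · simp only [terminalValue, h.surplus_claimTime, hrun.surplus_claimTime]

end RunsUntilClaim

theorem runsUntilClaim_runStrategy (m : Model) (z : Fin 2 → ℝ) (ω : Scenario) :
    RunsUntilClaim m z (runStrategy m z) ω :=
  ⟨fun _ => if_pos rfl, fun _ _ _ ht => if_neg ht.ne'⟩

theorem isAdmissibleStep_iff {n : ℕ} : IsAdmissibleStep m n z L ↔
    (∀ k, IsDividendProcess filtration (L k)) ∧
      ∀ ω, PathAdmissible m z L ω ∧ RunsAfter m z L ω n := by
  rw [IsAdmissibleStep, isAdmissible_iff, and_assoc, forall_and]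
  rfl

/-- For `n ≥ 1` the condition after the `n`-th claim is void, because already the first claim causes
ruin. The strategy also fills the irrelevant slots of a `SwitchPlan`. -/
theorem isAdmissibleStep_runStrategy (m : Model) (n : ℕ) (hz : ∀ k, 0 ≤ z k) :
    IsAdmissibleStep m n z (runStrategy m z) := by
  refine isAdmissibleStep_iff.2 ⟨isDividendProcess_runStrategy m hz, fun ω => ⟨?_, ?_⟩⟩
  · exact (runsUntilClaim_runStrategy m z ω).pathAdmissible hz
  · intro t ht htr k
    rw [(runsUntilClaim_runStrategy m z ω).ruinTime_eq hz] at htr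
    rcases Nat.eq_zero_or_pos n with rfl | hn
    · rw [claimTime_zero] at ht ⊢
      rw [surplus_zero fun k => if_pos rfl, runStrategy, runStrategy, if_neg ht.ne', if_pos rfl]
      simp
    · have h1 : t ≤ claimTime 1 ω := by exact_mod_cast htr
      exact absurd ((claimTime_strictMono ω).monotone hn) (not_le.2 (ht.trans_le h1))

/-- The definition prescribes the payments only up to ruin. Ruin before the first claim is
impossible, as the joint surplus would then be zero (or the initial one) rather than negative. -/
theorem IsAdmissibleStep.runsUntilClaim (h : IsAdmissibleStep m 0 z L) (hz : ∀ k, 0 ≤ z k)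
    (ω : Scenario) : RunsUntilClaim m z L ω := by
  rw [isAdmissibleStep_iff] at h
  have h0 : ∀ k, L k 0 ω = 0 := fun k => (h.1 k).zero ω
  have hrun : ∀ k, ∀ t : ℝ≥0, (t : ℝ≥0∞) ≤ ruinTime m z L ω → 0 < t → L k t ω = z k + m.p k * t := by
    intro k t ht hpos
    have := (h.2 ω).2 t (by simpa using hpos) ht k
    rwa [claimTime_zero, surplus_zero h0, h0, NNReal.coe_zero, sub_zero, zero_add] at this
  refine ⟨h0, fun k t ht hpos => hrun k t ?_ hpos⟩
  have hle : (claimTime 1 ω : ℝ≥0∞) ≤ ruinTime m z L ω := by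
    by_contra hlt
    obtain ⟨u, hu⟩ : ∃ u : ℝ≥0, (u : ℝ≥0∞) = ruinTime m z L ω :=
      ⟨_, ENNReal.coe_toNNReal (ne_top_of_lt (not_le.1 hlt))⟩
    have hneg := (h.2 ω).1.ruin u hu.symm
    have hlt' : u < claimTime 1 ω := by
      rw [← hu] at hlt
      exact_mod_cast not_le.1 hlt
    rcases eq_zero_or_pos u with rfl | hpos
    · rw [surplus_zero h0, surplus_zero h0] at hneg
      linarith [hz 0, hz 1]
    · rw [surplus_of_lt_claimTime hlt', surplus_of_lt_claimTime hlt', hrun 0 u hu.le hpos,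
        hrun 1 u hu.le hpos] at hneg
      linarith
  exact (ENNReal.coe_le_coe.2 ht).trans hle

/-! ### Pasting strategies at the first claim or at a fixed time -/

/-- A deterministic dividend plan, affordable from `z` as long as there is no claim. -/
structure IsPlan (m : Model) (z : Fin 2 → ℝ) (D : Fin 2 → ℝ≥0 → ℝ) : Prop where
  zero : ∀ k, D k 0 = 0
  mono : ∀ k, Monotone (D k)
  left_continuous : ∀ k t, ContinuousWithinAt (D k) (Iic t) t
  le : ∀ k (t : ℝ≥0), D k t ≤ z k + m.p k * t

/-- Data of a strategy which follows the plan `D` until the first claim, or until time `s` if this is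
earlier, and then switches to one of the strategies `L i`, after reducing the surpluses to `g i`:
to `L 0` if there was no claim, and to `L (sel y + 1)` if there was, where `y` are
the surpluses after the claim. -/
structure SwitchPlan (m : Model) (n : ℕ) (z : Fin 2 → ℝ) where
  D : Fin 2 → ℝ≥0 → ℝ
  s : ℝ≥0∞
  g : ℕ → Fin 2 → ℝ
  L : ℕ → Fin 2 → ℝ≥0 → Scenario → ℝ
  sel : (Fin 2 → ℝ) → ℕ
  isPlan : IsPlan m z D
  measurable_sel : Measurable sel
  sel_le : ∀ y, (∀ k, 0 ≤ y k) → ∀ k, g (sel y + 1) k ≤ y k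
  wait_le : ∀ t : ℝ≥0, (t : ℝ≥0∞) = s → ∀ k, g 0 k ≤ z k + m.p k * t - D k t
  g_nonneg : ∀ i k, 0 ≤ g i k
  isAdmissibleStep_zero : IsAdmissibleStep m (n + 1) (g 0) (L 0)
  isAdmissibleStep_succ : ∀ i, IsAdmissibleStep m n (g (i + 1)) (L (i + 1))

namespace SwitchPlan

variable {m : Model} {n : ℕ} {z : Fin 2 → ℝ} (S : SwitchPlan m n z)

/-- Surpluses at the switching time before transfers. -/
def switchSurplus (ω : Scenario) (i : Fin 2) : ℝ :=
  freeSurplus m z i (switchTime S.s ω) ω - S.D i (switchTime S.s ω)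

def index (ω : Scenario) : ℕ :=
  if totalCount (switchTime S.s ω) ω = 0 then 0 else S.sel (settle (S.switchSurplus ω)) + 1

/-- After a ruinous claim the process is frozen: its values no longer count, but it must remain a
dividend process. The new strategy acts strictly after the switching time, in accordance with left
continuity. -/
def strategy (k : Fin 2) (t : ℝ≥0) (ω : Scenario) : ℝ :=
  if t ≤ switchTime S.s ω then S.D k t
  else if S.switchSurplus ω 0 + S.switchSurplus ω 1 < 0 then S.D k (switchTime S.s ω)
  else S.D k (switchTime S.s ω) + (settle (S.switchSurplus ω) k - S.g (S.index ω) k) +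
    S.L (S.index ω) k (t - switchTime S.s ω) (shift (switchTime S.s ω) ω)

theorem strategy_of_le {ω : Scenario} {t : ℝ≥0} (h : t ≤ switchTime S.s ω) (k : Fin 2) :
    S.strategy k t ω = S.D k t := if_pos h

theorem isDividendProcess_L (i : ℕ) (k : Fin 2) : IsDividendProcess filtration (S.L i k) := by
  cases i with
  | zero => exact S.isAdmissibleStep_zero.1.dividend k
  | succ i => exact (S.isAdmissibleStep_succ i).1.dividend k

theorem totalCount_switchTime (ω : Scenario) :
    (switchTime S.s ω = claimTime 1 ω ∧ totalCount (switchTime S.s ω) ω = 1) ∨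
      (switchTime S.s ω < claimTime 1 ω ∧ (switchTime S.s ω : ℝ≥0∞) = S.s ∧
        totalCount (switchTime S.s ω) ω = 0) := by
  rcases switchTime_eq S.s ω with h | h
  · left
    rw [h]
    exact ⟨rfl, totalCount_claimTime 1 ω⟩
  · exact Or.inr ⟨h.1, h.2, totalCount_eq_zero h.1⟩

theorem surplus_strategy_of_lt {ω : Scenario} {t : ℝ≥0} (h : t ≤ switchTime S.s ω)
    (h' : t < claimTime 1 ω) (k : Fin 2) :
    surplus m z S.strategy k t ω = z k + m.p k * t - S.D k t := by
  rw [surplus_of_lt_claimTime h', S.strategy_of_le h]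

theorem surplus_strategy_nonneg {ω : Scenario} {t : ℝ≥0} (h : t ≤ switchTime S.s ω)
    (h' : t < claimTime 1 ω) (k : Fin 2) : 0 ≤ surplus m z S.strategy k t ω := by
  rw [S.surplus_strategy_of_lt h h']
  linarith [S.isPlan.le k t]

theorem surplus_switchTime (ω : Scenario) (k : Fin 2) :
    surplus m z S.strategy k (switchTime S.s ω) ω = settle (S.switchSurplus ω) k := by
  have heq : S.switchSurplus ω = fun i => freeSurplus m z i (switchTime S.s ω) ω -
      S.strategy i (switchTime S.s ω) ω := by
    funext i
    rw [S.strategy_of_le le_rfl]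
    rfl
  rcases S.totalCount_switchTime ω with h | h
  · rw [heq, h.1]
    exact surplus_claimTime_one k
  · have h1 : ∀ i, S.switchSurplus ω i = surplus m z S.strategy i (switchTime S.s ω) ω := by
      intro i
      rw [heq]
      simp [surplus, h.2.2, received]
    rw [settle_of_nonneg, h1]
    intro i
    rw [h1]
    exact S.surplus_strategy_nonneg le_rfl h.1 i

theorem g_index_le (ω : Scenario) (h : 0 ≤ S.switchSurplus ω 0 + S.switchSurplus ω 1) (k : Fin 2) :
    S.g (S.index ω) k ≤ settle (S.switchSurplus ω) k := by
  rcases S.totalCount_switchTime ω with hc | hc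
  · rw [index, if_neg (by omega)]
    exact S.sel_le _ (settle_nonneg h) k
  · rw [index, if_pos hc.2.2, ← S.surplus_switchTime, S.surplus_strategy_of_lt le_rfl hc.1]
    exact S.wait_le _ hc.2.1 k

/-- Up to the switching time the process is deterministic. Afterwards surpluses, index and restarted
scenario are functions of past claims, and since there are only countably many continuations,
predictability of each of them suffices. Monotonicity at the switch holds because `g` lies below the
surpluses. -/
theorem isDividendProcess_strategy (k : Fin 2) : IsDividendProcess filtration (S.strategy k) := by
  have hLnn : ∀ i t ω, 0 ≤ S.L i k t ω := fun i t ω =>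
    ((S.isDividendProcess_L i k).zero ω) ▸ (S.isDividendProcess_L i k).mono ω (zero_le (a := t))
  constructor
  · rw [isStronglyPredictable_iff]
    have hσ := measurable_min_switchTime S.s
    have hE := TimeScenario.measurableSet_random_lt hσ
    refine measurable_of_restrict_of_restrict_compl hE ?_ ?_
    · have hp : ∀ r, Measurable fun q : {q : TimeScenario | switchTime S.s q.scenario < q.time} =>
          TimeScenario.past r q.1 := fun r =>
        (TimeScenario.measurable_past r).comp measurable_subtype_coe
      have hσ' := TimeScenario.measurable_random_subtype hσ
      have hN := fun k => TimeScenario.measurable_claimCount_of_lt hp hσ' (fun q => q.2) k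
      have hA := fun k => TimeScenario.measurable_aggregateClaims_of_lt hp hσ' (fun q => q.2) k
      have hD : ∀ k, Measurable fun q : {q : TimeScenario | switchTime S.s q.scenario < q.time} =>
          S.D k (switchTime S.s q.1.scenario) := fun k => (S.isPlan.mono k).measurable.comp hσ'
      have hY : Measurable fun q : {q : TimeScenario | switchTime S.s q.scenario < q.time} =>
          S.switchSurplus q.1.scenario :=
        measurable_pi_lambda _ fun i => (((hσ'.coe_nnreal_real.const_mul (m.p i)).const_add
          (z i)).sub (hA i)).sub (hD i)
      have hI : Measurable fun q : {q : TimeScenario | switchTime S.s q.scenario < q.time} =>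
          S.index q.1.scenario := by
        refine Measurable.ite ?_ measurable_const
          ((measurable_of_countable Nat.succ).comp
            (S.measurable_sel.comp (measurable_settle.comp hY)))
        exact ((hN 0).add (hN 1)) (measurableSet_singleton 0)
      have hg : Measurable fun q : {q : TimeScenario | switchTime S.s q.scenario < q.time} =>
          S.g (S.index q.1.scenario) k :=
        (measurable_of_countable fun i => S.g i k).comp hI
      have hL : Measurable fun y : ℕ × {q : TimeScenario | switchTime S.s q.scenario < q.time} =>
          S.L y.1 k (TimeScenario.restart (switchTime S.s) y.2.1).time
            (TimeScenario.restart (switchTime S.s) y.2.1).scenario :=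
        measurable_from_prod_countable_right fun i =>
          (isStronglyPredictable_iff.1 (S.isDividendProcess_L i k).predictable).comp
            ((TimeScenario.measurable_restart hσ).comp measurable_subtype_coe)
      have hneg : MeasurableSet {q : {q : TimeScenario | switchTime S.s q.scenario < q.time} |
          S.switchSurplus q.1.scenario 0 + S.switchSurplus q.1.scenario 1 < 0} :=
        measurableSet_lt (((measurable_pi_apply 0).comp hY).add ((measurable_pi_apply 1).comp hY))
          measurable_const
      have heq : {q : TimeScenario | switchTime S.s q.scenario < q.time}.domRestrict
          (fun q => S.strategy k q.time q.scenario) = fun q =>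
            if S.switchSurplus q.1.scenario 0 + S.switchSurplus q.1.scenario 1 < 0 then
              S.D k (switchTime S.s q.1.scenario)
            else S.D k (switchTime S.s q.1.scenario) +
              (settle (S.switchSurplus q.1.scenario) k - S.g (S.index q.1.scenario) k) +
              S.L (S.index q.1.scenario) k (q.1.time - switchTime S.s q.1.scenario)
                (shift (switchTime S.s q.1.scenario) q.1.scenario) :=
        funext fun q => if_neg (not_le.2 q.2)
      rw [heq]
      exact Measurable.ite hneg (hD k)
        (((hD k).add ((((measurable_pi_apply k).comp (measurable_settle.comp hY))).sub hg)).add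
          (hL.comp (hI.prodMk measurable_id)))
    · have heq : {q : TimeScenario | switchTime S.s q.scenario < q.time}ᶜ.domRestrict
          (fun q => S.strategy k q.time q.scenario) = fun q => S.D k q.1.time :=
        funext fun q => S.strategy_of_le (not_lt.1 q.2) k
      rw [heq]
      exact (S.isPlan.mono k).measurable.comp
        (TimeScenario.measurable_time.comp measurable_subtype_coe)
  · intro ω
    rw [S.strategy_of_le zero_le, S.isPlan.zero]
  · intro ω t u htu
    simp only [strategy]
    by_cases hu : u ≤ switchTime S.s ω
    · rw [if_pos hu, if_pos (htu.trans hu)]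
      exact S.isPlan.mono k htu
    · rw [if_neg hu]
      by_cases hneg : S.switchSurplus ω 0 + S.switchSurplus ω 1 < 0
      · rw [if_pos hneg, if_pos hneg]
        split_ifs with ht
        · exact S.isPlan.mono k ht
        · exact le_rfl
      · rw [if_neg hneg, if_neg hneg]
        have h1 := S.g_index_le ω (not_lt.1 hneg) k
        split_ifs with ht
        · have h2 := S.isPlan.mono k ht
          have h3 := hLnn (S.index ω) (u - switchTime S.s ω) (shift (switchTime S.s ω) ω)
          linarith
        · have h2 := (S.isDividendProcess_L (S.index ω) k).mono (shift (switchTime S.s ω) ω)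
            (tsub_le_tsub_right htu (switchTime S.s ω))
          simp only at h2
          linarith
  · intro ω t
    by_cases ht : t ≤ switchTime S.s ω
    · refine (S.isPlan.left_continuous k t).congr (fun u hu => ?_) (S.strategy_of_le ht k)
      exact S.strategy_of_le (le_trans hu ht) k
    · have hev : ∀ᶠ u in 𝓝[Iic t] t, ¬ u ≤ switchTime S.s ω := by
        filter_upwards [mem_nhdsWithin_of_mem_nhds (lt_mem_nhds (not_le.1 ht))] with u hu
        exact not_le.2 hu
      by_cases hneg : S.switchSurplus ω 0 + S.switchSurplus ω 1 < 0
      · refine ContinuousWithinAt.congr_of_eventuallyEq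
          (continuousWithinAt_const (b := S.D k (switchTime S.s ω))) ?_ ?_
        · filter_upwards [hev] with u hu
          rw [strategy, if_neg hu, if_pos hneg]
        · rw [strategy, if_neg ht, if_pos hneg]
      · have hc : ContinuousWithinAt (fun u => S.D k (switchTime S.s ω) +
            (settle (S.switchSurplus ω) k - S.g (S.index ω) k) +
            S.L (S.index ω) k (u - switchTime S.s ω) (shift (switchTime S.s ω) ω)) (Iic t) t := by
          refine ContinuousWithinAt.add continuousWithinAt_const ?_
          refine ContinuousWithinAt.comp (f := fun u => u - switchTime S.s ω)
            (g := fun u => S.L (S.index ω) k u (shift (switchTime S.s ω) ω))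
            (t := Iic (t - switchTime S.s ω)) ((S.isDividendProcess_L (S.index ω) k).left_continuous _ _) ?_ ?_
          · exact (continuous_id.sub continuous_const).continuousWithinAt
          · exact fun u hu => tsub_le_tsub_right (mem_Iic.1 hu) _
        refine hc.congr_of_eventuallyEq ?_ ?_
        · filter_upwards [hev] with u hu
          rw [strategy, if_neg hu, if_neg hneg]
        · rw [strategy, if_neg ht, if_neg hneg]

theorem restarts (ω : Scenario) (h : 0 ≤ S.switchSurplus ω 0 + S.switchSurplus ω 1) :
    Restarts m z (S.g (S.index ω)) S.strategy (S.L (S.index ω)) ω (switchTime S.s ω) where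
  start k := (S.isDividendProcess_L _ k).zero _
  eq k t ht := by
    rw [S.surplus_switchTime, S.strategy_of_le le_rfl, strategy, if_neg (by simpa using ht.ne'),
      if_neg (not_lt.2 h), add_tsub_cancel_left]

theorem surplus_nonneg_of_le {ω : Scenario} (h : 0 ≤ S.switchSurplus ω 0 + S.switchSurplus ω 1)
    (t : ℝ≥0) (ht : t ≤ switchTime S.s ω) (k : Fin 2) : 0 ≤ surplus m z S.strategy k t ω := by
  rcases ht.lt_or_eq with ht | rfl
  · exact S.surplus_strategy_nonneg ht.le (ht.trans_le (switchTime_le _ _)) k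
  · rw [S.surplus_switchTime]
    exact settle_nonneg h k

theorem switchTime_of_neg {ω : Scenario} (h : S.switchSurplus ω 0 + S.switchSurplus ω 1 < 0) :
    switchTime S.s ω = claimTime 1 ω := by
  rcases S.totalCount_switchTime ω with hc | hc
  · exact hc.1
  · have h0 := S.surplus_strategy_nonneg le_rfl hc.1
    rw [← settle_sum, ← S.surplus_switchTime, ← S.surplus_switchTime] at h
    linarith [h0 0, h0 1]

theorem joint_neg {ω : Scenario} (h : S.switchSurplus ω 0 + S.switchSurplus ω 1 < 0) :
    surplus m z S.strategy 0 (claimTime 1 ω) ω + surplus m z S.strategy 1 (claimTime 1 ω) ω < 0 := by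
  rwa [← S.switchTime_of_neg h, S.surplus_switchTime, S.surplus_switchTime, settle_sum]

theorem ruinTime_of_neg {ω : Scenario} (h : S.switchSurplus ω 0 + S.switchSurplus ω 1 < 0) :
    ruinTime m z S.strategy ω = claimTime 1 ω := by
  refine ruinTime_eq_claimTime_one (fun t ht => ?_) (S.joint_neg h)
  have ht' : t ≤ switchTime S.s ω := by
    rw [S.switchTime_of_neg h]
    exact ht.le
  exact add_nonneg (S.surplus_strategy_nonneg ht' ht 0) (S.surplus_strategy_nonneg ht' ht 1)

theorem isAdmissibleStep : IsAdmissibleStep m (n + 1) z S.strategy := by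
  refine isAdmissibleStep_iff.2 ⟨S.isDividendProcess_strategy, fun ω => ?_⟩
  rcases lt_or_ge (S.switchSurplus ω 0 + S.switchSurplus ω 1) 0 with h | h
  · refine ⟨pathAdmissible_of_ruin_at_claim (fun t ht k => ?_) (S.joint_neg h), ?_⟩
    · refine S.surplus_strategy_nonneg ?_ ht k
      rw [S.switchTime_of_neg h]
      exact ht.le
    · intro t ht htr
      rw [S.ruinTime_of_neg h] at htr
      have h1 : t ≤ claimTime 1 ω := by exact_mod_cast htr
      exact absurd ((claimTime_strictMono ω).monotone (Nat.le_add_left 1 n))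
        (not_le.2 (ht.trans_le h1))
  -- If the switch happens at a claim, one of the `n + 1` admitted claims is used up and `n' = n`;
  -- if it happens before, all remain and `n' = n + 1`.
  · have hadm : ∃ n', claimTime (n + 1) ω =
        switchTime S.s ω + claimTime n' (shift (switchTime S.s ω) ω) ∧
        IsAdmissibleStep m n' (S.g (S.index ω)) (S.L (S.index ω)) := by
      rcases S.totalCount_switchTime ω with hc | hc
      · refine ⟨n, ?_, ?_⟩
        · rcases Nat.eq_zero_or_pos n with rfl | hn
          · rw [claimTime_zero, add_zero, hc.1]
          · rw [← claimTime_shift _ _ hn, hc.2, add_comm]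
        · rw [index, if_neg (by omega)]
          exact S.isAdmissibleStep_succ _
      · refine ⟨n + 1, ?_, ?_⟩
        · rw [← claimTime_shift _ _ (by omega), hc.2.2, zero_add]
        · rw [index, if_pos hc.2.2]
          exact S.isAdmissibleStep_zero
    obtain ⟨n', hn', hadm⟩ := hadm
    have hadm' := (isAdmissibleStep_iff.1 hadm).2 (shift (switchTime S.s ω) ω)
    have hnn := S.surplus_nonneg_of_le h
    exact ⟨(S.restarts ω h).pathAdmissible (S.g_nonneg _) hnn hadm'.1,
      (S.restarts ω h).runsAfter (S.g_nonneg _) (fun t ht => add_nonneg (hnn t ht 0) (hnn t ht 1))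
        hn' hadm'.2⟩

theorem discountedDividends_strategy (ω : Scenario) (k : Fin 2) :
    discountedDividends m.δ (fun t => S.strategy k t ω) (switchTime S.s ω) =
      discountedDividends m.δ (S.D k) (switchTime S.s ω) := by
  rw [(S.isDividendProcess_strategy k).discountedDividends_eq m.δ_pos,
    discountedDividends_eq m.δ_pos (S.isPlan.mono k) (S.isPlan.zero k) (S.isPlan.left_continuous k)]
  refine lintegral_congr fun r => ?_
  rw [S.strategy_of_le (ENNReal.coe_le_coe.1 (stopAt_le _ r))]

theorem le_payoff_of_nonneg {ω : Scenario} (h : 0 ≤ S.switchSurplus ω 0 + S.switchSurplus ω 1) :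
    (∑ k, ENNReal.ofReal (m.a k) * discountedDividends m.δ (S.D k) (switchTime S.s ω)) +
      ENNReal.ofReal (Real.exp (-m.δ * switchTime S.s ω)) *
        payoff m (S.g (S.index ω)) (S.L (S.index ω)) (shift (switchTime S.s ω) ω) ≤
      payoff m z S.strategy ω := by
  simp only [← S.discountedDividends_strategy ω]
  have hnn := S.surplus_nonneg_of_le h
  refine (S.restarts ω h).le_payoff (S.g_nonneg _) (fun t ht => add_nonneg (hnn t ht 0)
    (hnn t ht 1)) (fun k => ?_) S.isDividendProcess_strategy (S.isDividendProcess_L _) ?_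
  · rw [S.surplus_switchTime]
    exact S.g_index_le ω h k
  · unfold index
    split_ifs
    · exact ((isAdmissibleStep_iff.1 S.isAdmissibleStep_zero).2 _).1
    · exact ((isAdmissibleStep_iff.1 (S.isAdmissibleStep_succ _)).2 _).1

theorem payoff_of_neg {ω : Scenario} (h : S.switchSurplus ω 0 + S.switchSurplus ω 1 < 0) :
    payoff m z S.strategy ω =
      (∑ k, ENNReal.ofReal (m.a k) * discountedDividends m.δ (S.D k) (switchTime S.s ω)) +
      ENNReal.ofReal (Real.exp (-m.δ * switchTime S.s ω)) *
        ∑ k, ENNReal.ofReal (m.a k) * valueAlone m k (S.switchSurplus ω k) := by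
  rw [payoff, S.ruinTime_of_neg h, if_neg ENNReal.coe_ne_top, ENNReal.toNNReal_coe,
    ← S.switchTime_of_neg h, terminalValue]
  simp only [S.discountedDividends_strategy, S.surplus_switchTime, settle_of_neg h]

end SwitchPlan

/-! ### Product measures and exponential waiting times -/

section Product

variable {ι : Type*} [DecidableEq ι] {X : ι → Type*} [∀ i, MeasurableSpace (X i)] (μ : ∀ i, Measure (X i))
  [∀ i, IsProbabilityMeasure (μ i)]

theorem measurable_update_prod (r : ι) :
    Measurable fun x : X r × (∀ i, X i) => Function.update x.2 r x.1 := by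
  refine measurable_pi_lambda _ fun i => ?_
  by_cases h : i = r
  · subst h
    simpa using measurable_fst
  · simp only [Function.update_of_ne h]
    exact (measurable_pi_apply i).comp measurable_snd

/-- Replacing one coordinate by an independent copy does not change a product law. This allows
integrating over a single waiting time or claim with all others fixed. -/
theorem map_update_infinitePi (r : ι) :
    ((μ r).prod (Measure.infinitePi μ)).map (fun x => Function.update x.2 r x.1) =
      Measure.infinitePi μ := by
  refine Measure.eq_infinitePi μ fun s t ht => ?_
  rw [Measure.map_apply (measurable_update_prod r) (MeasurableSet.pi s.countable_toSet fun i _ => ht i)]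
  by_cases hr : r ∈ s
  · have : (fun x : X r × (∀ i, X i) => Function.update x.2 r x.1) ⁻¹' (Set.pi s t) =
        t r ×ˢ Set.pi (s.erase r) t := by
      ext ⟨x, q⟩
      simp only [mem_preimage, Set.mem_pi, Finset.mem_coe, mem_prod, Finset.mem_erase, ne_eq, and_imp]
      constructor
      · intro h
        refine ⟨by simpa using h r hr, fun i hi his => ?_⟩
        simpa [hi] using h i his
      · rintro ⟨h1, h2⟩ i hi
        by_cases hir : i = r
        · subst hir
          simpa using h1
        · simpa [hir] using h2 i hir hi
    rw [this, Measure.prod_prod, Measure.infinitePi_pi _ fun i _ => ht i,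
      Finset.mul_prod_erase s (fun i => μ i (t i)) hr]
  · have : (fun x : X r × (∀ i, X i) => Function.update x.2 r x.1) ⁻¹' (Set.pi s t) =
        univ ×ˢ Set.pi s t := by
      ext ⟨x, q⟩
      simp only [mem_preimage, Set.mem_pi, Finset.mem_coe, mem_prod, mem_univ, true_and]
      refine forall₂_congr fun i hi => ?_
      have : i ≠ r := fun h => hr (h ▸ hi)
      simp [this]
    rw [this, Measure.prod_prod, Measure.infinitePi_pi _ fun i _ => ht i]
    simp

theorem lintegral_infinitePi_update (r : ι) {f : (∀ i, X i) → ℝ≥0∞} (hf : Measurable f) :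
    ∫⁻ q, f q ∂(Measure.infinitePi μ) =
      ∫⁻ q, ∫⁻ x, f (Function.update q r x) ∂(μ r) ∂(Measure.infinitePi μ) := by
  conv_lhs => rw [← map_update_infinitePi μ r]
  rw [lintegral_map hf (measurable_update_prod r)]
  exact lintegral_prod_symm _ (hf.comp (measurable_update_prod r)).aemeasurable

end Product

theorem lintegral_expMeasure (r : ℝ) {f : ℝ → ℝ≥0∞} (hf : Measurable f) :
    ∫⁻ x, f x ∂(expMeasure r) =
      ∫⁻ x in Ioi (0 : ℝ), ENNReal.ofReal (r * Real.exp (-r * x)) * f x := by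
  have hd : Measurable (exponentialPDF r) := (measurable_exponentialPDFReal r).ennreal_ofReal
  have h0 : expMeasure r = volume.withDensity (exponentialPDF r) := rfl
  rw [h0, lintegral_withDensity_eq_lintegral_mul _ hd hf, setLIntegral_congr Ioi_ae_eq_Ici,
    ← lintegral_indicator measurableSet_Ici]
  refine lintegral_congr fun x => ?_
  by_cases hx : 0 ≤ x
  · rw [indicator_of_mem (by exact hx), Pi.mul_apply, exponentialPDF_of_nonneg hx, neg_mul]
  · rw [indicator_of_notMem (by exact hx), Pi.mul_apply, exponentialPDF_of_neg (not_le.1 hx), zero_mul]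

/-- The exponential distribution has no memory. -/
theorem setLIntegral_Ioi_expMeasure (r : ℝ) {w : ℝ} (hw : 0 ≤ w) {f : ℝ → ℝ≥0∞}
    (hf : Measurable f) :
    ∫⁻ x in Ioi w, f x ∂(expMeasure r) =
      ENNReal.ofReal (Real.exp (-r * w)) * ∫⁻ x, f (x + w) ∂(expMeasure r) := by
  rw [← lintegral_indicator measurableSet_Ioi,
    lintegral_expMeasure r (hf.indicator measurableSet_Ioi),
    lintegral_expMeasure r (f := fun x => f (x + w)) (hf.comp (measurable_id.add_const w)),
    ← lintegral_const_mul _ (f := fun x => ENNReal.ofReal (r * Real.exp (-r * x)) * f (x + w))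
      (Measurable.mul (by fun_prop) (hf.comp (measurable_id.add_const w))),
    ← lintegral_indicator measurableSet_Ioi, ← lintegral_indicator measurableSet_Ioi,
    ← lintegral_add_right_eq_self _ w]
  refine lintegral_congr fun x => ?_
  by_cases hx : 0 < x
  · rw [indicator_of_mem (show x + w ∈ Ioi (0 : ℝ) by simp only [mem_Ioi]; linarith),
      indicator_of_mem (show x + w ∈ Ioi w by simpa using hx), indicator_of_mem (by exact hx),
      ← mul_assoc, ← ENNReal.ofReal_mul (Real.exp_nonneg _)]
    congr 2
    rw [mul_left_comm, ← Real.exp_add]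
    congr 2
    ring
  · rw [indicator_of_notMem (show x ∉ Ioi (0 : ℝ) from hx)]
    by_cases hxw : x + w ∈ Ioi (0 : ℝ)
    · rw [indicator_of_mem hxw, indicator_of_notMem (show x + w ∉ Ioi w by simpa using hx), mul_zero]
    · rw [indicator_of_notMem hxw]

instance (m : Model) (k : Fin 2) : IsProbabilityMeasure (m.F k) := m.F_prob k

instance (m : Model) (k : Fin 2) : IsProbabilityMeasure (expMeasure (m.lam k)) :=
  isProbabilityMeasure_expMeasure (m.lam_pos k)

/-! ### Raw scenarios -/

/-- The distribution of a waiting time and the subsequent claim. -/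
def claimLaw (m : Model) (r : Fin 2 × ℕ) : Measure (ℝ × ℝ) :=
  (expMeasure (m.lam r.1)).prod (m.F r.1)

instance (m : Model) (r : Fin 2 × ℕ) : IsProbabilityMeasure (claimLaw m r) := by
  unfold claimLaw
  infer_instance

def rawLaw (m : Model) : Measure (Fin 2 × ℕ → ℝ × ℝ) := Measure.infinitePi (claimLaw m)

instance (m : Model) : IsProbabilityMeasure (rawLaw m) := by
  unfold rawLaw
  infer_instance

/-- Prolongs a waiting time by `w`. -/
def bump (r : Fin 2 × ℕ) (w : ℝ) (q : Fin 2 × ℕ → ℝ × ℝ) : Fin 2 × ℕ → ℝ × ℝ :=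
  Function.update q r ((q r).1 + w, (q r).2)

theorem measurable_bump (r : Fin 2 × ℕ) :
    Measurable fun x : ℝ × (Fin 2 × ℕ → ℝ × ℝ) => bump r x.1 x.2 := by
  refine measurable_pi_lambda _ fun i => ?_
  by_cases h : i = r
  · subst h
    simp only [bump, Function.update_self]
    exact ((((measurable_pi_apply i).comp measurable_snd).fst).add measurable_fst).prodMk
      ((measurable_pi_apply i).comp measurable_snd).snd
  · simp only [bump, Function.update_of_ne h]
    exact (measurable_pi_apply i).comp measurable_snd

/-- Lack of memory of one waiting time: given that it exceeds `w`, the excess has the original law,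
independently of all other coordinates. -/
theorem setLIntegral_rawLaw_bump (m : Model) (r : Fin 2 × ℕ) {w : ℝ} (hw : 0 ≤ w)
    {f : (Fin 2 × ℕ → ℝ × ℝ) → ℝ≥0∞} (hf : Measurable f) :
    ∫⁻ q in {q | w < (q r).1}, f q ∂(rawLaw m) =
      ENNReal.ofReal (Real.exp (-m.lam r.1 * w)) * ∫⁻ q, f (bump r w q) ∂(rawLaw m) := by
  have hS : MeasurableSet {q : Fin 2 × ℕ → ℝ × ℝ | w < (q r).1} :=
    measurableSet_lt measurable_const (measurable_pi_apply r).fst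
  have hb : Measurable fun q => f (bump r w q) :=
    hf.comp ((measurable_bump r).comp (measurable_const.prodMk measurable_id))
  have hU := measurable_update_prod (X := fun _ : Fin 2 × ℕ => ℝ × ℝ) r
  rw [← lintegral_indicator hS, rawLaw, lintegral_infinitePi_update _ r (hf.indicator hS),
    lintegral_infinitePi_update _ r hb, ← lintegral_const_mul]
  · refine lintegral_congr fun q => ?_
    have h1 : Measurable fun x : ℝ × ℝ => f (Function.update q r x) :=
      hf.comp (hU.comp (measurable_id.prodMk measurable_const))
    have h2 : ∀ x : ℝ × ℝ, {q : Fin 2 × ℕ → ℝ × ℝ | w < (q r).1}.indicator f (Function.update q r x) =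
        (Ioi w ×ˢ univ).indicator (fun x : ℝ × ℝ => f (Function.update q r x)) x := by
      intro x
      by_cases hx : w < x.1 <;> simp [indicator, hx]
    have h3 : ∀ x : ℝ × ℝ, f (bump r w (Function.update q r x)) =
        f (Function.update q r (x.1 + w, x.2)) := by
      intro x
      simp [bump]
    have h4 : Measurable fun x : ℝ × ℝ => f (Function.update q r (x.1 + w, x.2)) :=
      h1.comp ((measurable_fst.add_const w).prodMk measurable_snd)
    simp only [h2, h3]
    rw [claimLaw, lintegral_prod_symm _ (h1.indicator (measurableSet_Ioi.prod .univ)).aemeasurable,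
      lintegral_prod_symm _ h4.aemeasurable, ← lintegral_const_mul]
    · refine lintegral_congr fun y => ?_
      have h5 : Measurable fun x : ℝ => f (Function.update q r (x, y)) :=
        h1.comp (measurable_id.prodMk measurable_const)
      rw [← setLIntegral_Ioi_expMeasure _ hw h5, ← lintegral_indicator measurableSet_Ioi]
      refine lintegral_congr fun x => ?_
      by_cases hx : w < x <;> simp [indicator, hx]
    · exact Measurable.lintegral_prod_left' h4
  · exact Measurable.lintegral_prod_right' (f := fun x : (Fin 2 × ℕ → ℝ × ℝ) × (ℝ × ℝ) =>
      f (bump r w (Function.update x.1 r x.2))) (hb.comp (hU.comp measurable_swap))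

/-! ### Almost every raw scenario is a scenario -/

theorem measurable_rawArrival (k : Fin 2) (i : ℕ) : Measurable fun q => rawArrival q k i :=
  Finset.measurable_sum _ fun j _ => (measurable_pi_apply (k, j)).fst

theorem ae_claimLaw_pos (m : Model) (r : Fin 2 × ℕ) : ∀ᵐ x ∂(claimLaw m r), 0 < x.1 ∧ 0 < x.2 := by
  have h2 : ∀ᵐ x ∂(expMeasure (m.lam r.1)), 0 < x := by
    have h3 := lintegral_expMeasure (m.lam r.1) (f := (Iic (0 : ℝ)).indicator 1)
      (measurable_one.indicator measurableSet_Iic)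
    rw [lintegral_indicator_one measurableSet_Iic] at h3
    have h4 : expMeasure (m.lam r.1) (Iic 0) = 0 := by
      rw [h3]
      refine (setLIntegral_congr_fun measurableSet_Ioi fun x hx => ?_).trans lintegral_zero
      rw [indicator_of_notMem (by simpa using hx), mul_zero]
    filter_upwards [measure_eq_zero_iff_ae_notMem.1 h4] with x hx
    exact not_le.1 hx
  have h5 : ∀ᵐ x ∂(m.F r.1), 0 < x := by
    filter_upwards [measure_eq_zero_iff_ae_notMem.1 (m.F_pos r.1)] with x hx
    exact not_le.1 hx
  have h6 : ∀ᵐ x ∂(claimLaw m r), 0 < x.1 := Measure.quasiMeasurePreserving_fst.ae h2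
  have h7 : ∀ᵐ x ∂(claimLaw m r), 0 < x.2 := Measure.quasiMeasurePreserving_snd.ae h5
  filter_upwards [h6, h7] with x h h' using ⟨h, h'⟩

theorem ae_rawLaw_pos (m : Model) (r : Fin 2 × ℕ) :
    ∀ᵐ q ∂(rawLaw m), 0 < (q r).1 ∧ 0 < (q r).2 :=
  (measurePreserving_eval_infinitePi (claimLaw m) r).quasiMeasurePreserving.ae (ae_claimLaw_pos m r)

/-- With all other coordinates fixed, a coincidence forces the first waiting time of Company One to
take a single value `c`, and the exponential law has no atoms. -/
theorem ae_rawLaw_arrival_ne (m : Model) (i j : ℕ) :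
    ∀ᵐ q ∂(rawLaw m), rawArrival q 0 i ≠ rawArrival q 1 j := by
  have hS : MeasurableSet {q : Fin 2 × ℕ → ℝ × ℝ | rawArrival q 0 i = rawArrival q 1 j} :=
    measurableSet_eq_fun (measurable_rawArrival 0 i) (measurable_rawArrival 1 j)
  have h0 : rawLaw m {q | rawArrival q 0 i = rawArrival q 1 j} = 0 := by
    rw [← lintegral_indicator_one hS, rawLaw,
      lintegral_infinitePi_update _ (0, 0) (measurable_one.indicator hS)]
    refine (lintegral_congr fun q => ?_).trans lintegral_zero
    set c : ℝ := rawArrival q 1 j - ∑ l ∈ Finset.range i, (q (0, l + 1)).1 with hc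
    have h1 : ∀ x : ℝ × ℝ, {q : Fin 2 × ℕ → ℝ × ℝ | rawArrival q 0 i = rawArrival q 1 j}.indicator
        (1 : (Fin 2 × ℕ → ℝ × ℝ) → ℝ≥0∞) (Function.update q (0, 0) x) =
          ({c} ×ˢ univ : Set (ℝ × ℝ)).indicator 1 x := by
      intro x
      have h2 : rawArrival (Function.update q (0, 0) x) 0 i =
          ∑ l ∈ Finset.range i, (q (0, l + 1)).1 + x.1 := by
        rw [rawArrival, Finset.sum_range_succ']
        simp
      have h3 : rawArrival (Function.update q (0, 0) x) 1 j = rawArrival q 1 j := by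
        simp [rawArrival]
      have h4 : Function.update q (0, 0) x ∈
          {q : Fin 2 × ℕ → ℝ × ℝ | rawArrival q 0 i = rawArrival q 1 j} ↔
            x ∈ ({c} ×ˢ univ : Set (ℝ × ℝ)) := by
        simp only [mem_ofPred_eq, h2, h3, mem_prod, mem_singleton_iff, mem_univ, and_true, hc]
        constructor <;> intro h <;> linarith
      by_cases h : x ∈ ({c} ×ˢ univ : Set (ℝ × ℝ))
      · rw [indicator_of_mem h, indicator_of_mem (h4.2 h)]; rfl
      · rw [indicator_of_notMem h, indicator_of_notMem (mt h4.1 h)]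
    simp only [h1]
    rw [lintegral_indicator_one ((measurableSet_singleton c).prod .univ), claimLaw,
      Measure.prod_prod]
    have h5 : expMeasure (m.lam 0) {c} = 0 := by
      have h0 : expMeasure (m.lam 0) = volume.withDensity (exponentialPDF (m.lam 0)) := rfl
      rw [h0]
      exact withDensity_absolutelyContinuous _ _ (measure_singleton c)
    simp [h5]
  exact measure_eq_zero_iff_ae_notMem.1 h0

/-- By the second Borel–Cantelli lemma, infinitely many of the independent waiting times are at
least 1. -/
theorem ae_rawLaw_tendsto (m : Model) (k : Fin 2) :
    ∀ᵐ q ∂(rawLaw m), Tendsto (rawArrival q k) atTop atTop := by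
  set s : ℕ → Set (Fin 2 × ℕ → ℝ × ℝ) := fun n => {q | 1 ≤ (q (k, n)).1} with hs
  have hsm : ∀ n, MeasurableSet (s n) := fun n =>
    measurableSet_le measurable_const (measurable_pi_apply (k, n)).fst
  have hB : MeasurableSet {x : ℝ × ℝ | 1 ≤ x.1} := measurableSet_le measurable_const measurable_fst
  have hval' : ∀ n, rawLaw m (s n) = claimLaw m (k, n) {x | 1 ≤ x.1} := fun n =>
    (measurePreserving_eval_infinitePi (claimLaw m) (k, n)).measure_preimage hB.nullMeasurableSet
  have hval : ∀ n, rawLaw m (s n) = expMeasure (m.lam k) (Ici 1) := by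
    intro n
    have : {x : ℝ × ℝ | 1 ≤ x.1} = Ici 1 ×ˢ univ := by
      ext x
      simp
    rw [hval', this, claimLaw, Measure.prod_prod, measure_univ, mul_one]
  have hind : iIndepSet s (rawLaw m) := by
    refine (iIndepSet_iff_meas_biInter hsm).2 fun S => ?_
    have h1 : ⋂ i ∈ S, s i = Set.pi (S.image fun n => (k, n) : Finset (Fin 2 × ℕ))
        fun _ => {x : ℝ × ℝ | 1 ≤ x.1} := by
      ext q
      simp [hs]
    rw [h1, rawLaw, Measure.infinitePi_pi _ fun i _ => hB,
      Finset.prod_image fun a _ b _ h => (Prod.ext_iff.1 h).2]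
    exact Finset.prod_congr rfl fun n _ => (hval' n).symm
  have hpos : expMeasure (m.lam k) (Ici 1) ≠ 0 := by
    have h1 := setLIntegral_Ioi_expMeasure (m.lam k) zero_le_one (f := 1) measurable_one
    simp only [Pi.one_apply, lintegral_const, measure_univ, MeasurableSet.univ,
      Measure.restrict_apply, univ_inter, one_mul, mul_one] at h1
    have h2 : 0 < expMeasure (m.lam k) (Ioi 1) := by
      rw [h1]
      exact ENNReal.ofReal_pos.2 (Real.exp_pos _)
    exact (h2.trans_le (measure_mono Ioi_subset_Ici_self)).ne'
  have h1 := measure_limsup_eq_one hsm hind (by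
    simp only [hval]
    exact ENNReal.tsum_const_eq_top_of_ne_zero hpos)
  have h2 : ∀ᵐ q ∂(rawLaw m), q ∈ limsup s atTop :=
    (prob_compl_eq_zero_iff (MeasurableSet.measurableSet_limsup hsm)).2 h1
  have h3 : ∀ᵐ q ∂(rawLaw m), ∀ r, 0 < (q r).1 ∧ 0 < (q r).2 := ae_all_iff.2 (ae_rawLaw_pos m)
  filter_upwards [h2, h3] with q hq hpos
  rw [mem_limsup_iff_frequently_mem] at hq
  have hmono : Monotone (rawArrival q k) := by
    refine monotone_nat_of_le_succ fun i => ?_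
    rw [rawArrival, rawArrival, Finset.sum_range_succ _ (i + 1)]
    linarith [(hpos (k, i + 1)).1]
  have hunb : ∀ N : ℕ, ∃ i, (N : ℝ) ≤ rawArrival q k i := by
    intro N
    induction N with
    | zero => exact ⟨0, by simpa [rawArrival] using (hpos (k, 0)).1.le⟩
    | succ N ih =>
      obtain ⟨i, hi⟩ := ih
      obtain ⟨j, hj, hj'⟩ := frequently_atTop.1 hq (i + 1)
      obtain ⟨l, rfl⟩ : ∃ l, j = l + 1 := ⟨j - 1, by omega⟩
      refine ⟨l + 1, ?_⟩
      have h4 : rawArrival q k (l + 1) = rawArrival q k l + (q (k, l + 1)).1 := by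
        rw [rawArrival, rawArrival, Finset.sum_range_succ _ (l + 1)]
      have h5 : 1 ≤ (q (k, l + 1)).1 := hj'
      have h6 := hmono (show i ≤ l by omega)
      push_cast
      linarith
  refine tendsto_atTop_atTop_of_monotone hmono fun b => ?_
  obtain ⟨N, hN⟩ := exists_nat_ge b
  obtain ⟨i, hi⟩ := hunb N
  exact ⟨i, hN.trans hi⟩

/-! ### The law of the scenarios -/

theorem measurableSet_scenario : MeasurableSet {q : Fin 2 × ℕ → ℝ × ℝ |
    (∀ r, 0 < (q r).1 ∧ 0 < (q r).2) ∧ (∀ k, Tendsto (rawArrival q k) atTop atTop) ∧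
      (∀ i j, rawArrival q 0 i ≠ rawArrival q 1 j)} := by
  refine MeasurableSet.inter ?_ (MeasurableSet.inter ?_ ?_)
  · refine MeasurableSet.iInter (fun r => ?_) |>.congr (s := ⋂ r, {q : Fin 2 × ℕ → ℝ × ℝ |
      0 < (q r).1 ∧ 0 < (q r).2}) (by ext; simp; rfl)
    have h : Measurable fun q : Fin 2 × ℕ → ℝ × ℝ => q r := measurable_pi_apply r
    exact (measurableSet_lt measurable_const h.fst).inter (measurableSet_lt measurable_const h.snd)
  · refine MeasurableSet.iInter (fun k => ?_) |>.congr (s := ⋂ k, {q : Fin 2 × ℕ → ℝ × ℝ |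
      Tendsto (rawArrival q k) atTop atTop}) (by ext; simp; rfl)
    exact measurableSet_tendsto _ fun i => measurable_rawArrival k i
  · refine MeasurableSet.iInter (fun i => MeasurableSet.iInter fun j => ?_) |>.congr
      (s := ⋂ i, ⋂ j, {q : Fin 2 × ℕ → ℝ × ℝ | rawArrival q 0 i ≠ rawArrival q 1 j})
      (by ext; simp; rfl)
    exact (measurableSet_eq_fun (measurable_rawArrival 0 i) (measurable_rawArrival 1 j)).compl

def Scenario.raw (ω : Scenario) : Fin 2 × ℕ → ℝ × ℝ := ω.1

theorem measurableEmbedding_raw : MeasurableEmbedding Scenario.raw :=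
  MeasurableEmbedding.subtype_coe measurableSet_scenario

theorem map_raw_law (m : Model) : (law m).map Scenario.raw = rawLaw m := by
  have h : (law m).map Scenario.raw = (rawLaw m).restrict (range Scenario.raw) :=
    measurableEmbedding_raw.map_comap (rawLaw m)
  rw [h]
  refine Measure.restrict_eq_self_of_ae_mem ?_
  filter_upwards [ae_all_iff.2 (ae_rawLaw_pos m), ae_all_iff.2 (ae_rawLaw_tendsto m),
    ae_all_iff.2 fun i => ae_all_iff.2 (ae_rawLaw_arrival_ne m i)] with q h1 h2 h3
  exact ⟨⟨q, h1, h2, h3⟩, rfl⟩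

instance (m : Model) : IsProbabilityMeasure (law m) := by
  constructor
  have h := congrArg (fun ν => ν univ) (map_raw_law m)
  simpa [measurableEmbedding_raw.map_apply] using h

theorem lintegral_rawLaw (m : Model) (f : (Fin 2 × ℕ → ℝ × ℝ) → ℝ≥0∞) :
    ∫⁻ q, f q ∂(rawLaw m) = ∫⁻ ω, f ω.raw ∂(law m) := by
  rw [← map_raw_law, measurableEmbedding_raw.lintegral_map]

/-! ### Decomposition at the first claim -/

/-- Puts a first claim of company `k` before all other claims of this company. -/
def consRaw (k : Fin 2) (x : ℝ × ℝ) (q : Fin 2 × ℕ → ℝ × ℝ) (r : Fin 2 × ℕ) : ℝ × ℝ :=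
  if r.1 = k then if r.2 = 0 then x else q (k, r.2 - 1) else q r

theorem measurable_consRaw (k : Fin 2) :
    Measurable fun x : (ℝ × ℝ) × (Fin 2 × ℕ → ℝ × ℝ) => consRaw k x.1 x.2 := by
  refine measurable_pi_lambda _ fun r => ?_
  unfold consRaw
  split_ifs
  · exact measurable_fst
  · exact (measurable_pi_apply _).comp measurable_snd
  · exact (measurable_pi_apply _).comp measurable_snd

/-- Deleting the first claim of company `k` is a reindexing along the injection `e`, which preserves
the law because the claims of one company are identically distributed. -/
theorem lintegral_rawLaw_consRaw (m : Model) (k : Fin 2) {f : (Fin 2 × ℕ → ℝ × ℝ) → ℝ≥0∞}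
    (hf : Measurable f) :
    ∫⁻ q, f q ∂(rawLaw m) =
      ∫⁻ x, ∫⁻ q, f (consRaw k x q) ∂(rawLaw m) ∂(claimLaw m (k, 0)) := by
  set e : Fin 2 × ℕ → Fin 2 × ℕ := fun r => if r.1 = k then (r.1, r.2 + 1) else r with he
  have hinj : Function.Injective e := by
    rintro ⟨i, a⟩ ⟨j, b⟩ h
    simp only [he] at h
    split_ifs at h <;> simp_all
  have hmap : (rawLaw m).map (fun q r => q (e r)) = rawLaw m := by
    have h1 := Measure.map_infinitePi_infinitePi_of_inj (P := claimLaw m) hinj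
    have h2 : (fun r => claimLaw m (e r)) = claimLaw m := by
      funext r
      simp only [he, claimLaw]
      split_ifs <;> rfl
    rw [rawLaw]
    refine h1.trans ?_
    simp only [h2]
  have hmeas : Measurable fun q : Fin 2 × ℕ → ℝ × ℝ => fun r => q (e r) :=
    measurable_pi_lambda _ fun r => measurable_pi_apply _
  have hc := hf.comp (measurable_consRaw k)
  have hup : ∀ (q : Fin 2 × ℕ → ℝ × ℝ) x,
      Function.update q (k, 0) x = consRaw k x fun r => q (e r) := by
    intro q x
    funext ⟨i, a⟩
    simp only [consRaw, he, Function.update_apply, Prod.mk.injEq]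
    by_cases hi : i = k
    · subst hi
      by_cases ha : a = 0
      · simp [ha]
      · simp [ha, Nat.sub_add_cancel (Nat.one_le_iff_ne_zero.2 ha)]
    · simp [hi]
  rw [rawLaw, lintegral_infinitePi_update _ (k, 0) hf, ← rawLaw,
    lintegral_lintegral_swap (f := fun x q => f (consRaw k x q)) (μ := claimLaw m (k, 0))
      (ν := rawLaw m) hc.aemeasurable]
  simp only [hup]
  conv_rhs => rw [← hmap]
  rw [lintegral_map (Measurable.lintegral_prod_right' (f := fun x : (Fin 2 × ℕ → ℝ × ℝ) × (ℝ × ℝ) =>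
    f (consRaw k x.2 x.1)) (hc.comp measurable_swap)) hmeas]

/-- Competing exponential clocks: the density of the waiting time of company `k` is multiplied by
the probability that the other company waits longer. By lack of memory the remaining waiting time of
the other company starts afresh, so what follows the first claim has the original law. -/
theorem setLIntegral_rawLaw_first (m : Model) (k : Fin 2) {f : (Fin 2 × ℕ → ℝ × ℝ) → ℝ≥0∞}
    (hf : Measurable f) :
    ∫⁻ q in {q | (q (k, 0)).1 < (q (other k, 0)).1}, f q ∂(rawLaw m) =
      ∫⁻ w in Ioi (0 : ℝ), ENNReal.ofReal (m.lam k * Real.exp (-(m.lam 0 + m.lam 1) * w)) *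
        ∫⁻ α, ∫⁻ q, f (consRaw k (w, α) (bump (other k, 0) w q)) ∂(rawLaw m) ∂(m.F k) := by
  have hS : MeasurableSet {q : Fin 2 × ℕ → ℝ × ℝ | (q (k, 0)).1 < (q (other k, 0)).1} :=
    measurableSet_lt (measurable_pi_apply (k, 0)).fst (measurable_pi_apply (other k, 0)).fst
  have hg : Measurable fun x : (ℝ × ℝ) × (Fin 2 × ℕ → ℝ × ℝ) =>
      f (consRaw k x.1 (bump (other k, 0) x.1.1 x.2)) :=
    (hf.comp (measurable_consRaw k)).comp (measurable_fst.prodMk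
      ((measurable_bump _).comp ((measurable_fst.comp measurable_fst).prodMk measurable_snd)))
  have hg' := Measurable.lintegral_prod_right' (ν := rawLaw m) hg
  rw [← lintegral_indicator hS, lintegral_rawLaw_consRaw m k (hf.indicator hS)]
  have h1 : ∀ x : ℝ × ℝ, 0 ≤ x.1 → ∫⁻ q, {q : Fin 2 × ℕ → ℝ × ℝ |
      (q (k, 0)).1 < (q (other k, 0)).1}.indicator f (consRaw k x q) ∂(rawLaw m) =
        ENNReal.ofReal (Real.exp (-m.lam (other k) * x.1)) *
          ∫⁻ q, f (consRaw k x (bump (other k, 0) x.1 q)) ∂(rawLaw m) := by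
    intro x hx
    rw [← setLIntegral_rawLaw_bump m (other k, 0) hx (f := fun q => f (consRaw k x q))
      ((hf.comp (measurable_consRaw k)).comp (measurable_const.prodMk measurable_id)),
      ← lintegral_indicator (measurableSet_lt measurable_const
        (measurable_pi_apply (other k, 0)).fst)]
    refine lintegral_congr fun q => ?_
    have h2 : consRaw k x q ∈ {q : Fin 2 × ℕ → ℝ × ℝ | (q (k, 0)).1 < (q (other k, 0)).1} ↔
        q ∈ {q : Fin 2 × ℕ → ℝ × ℝ | x.1 < (q (other k, 0)).1} := by
      simp [consRaw, other_ne]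
    by_cases h : q ∈ {q : Fin 2 × ℕ → ℝ × ℝ | x.1 < (q (other k, 0)).1}
    · rw [indicator_of_mem h, indicator_of_mem (h2.2 h)]
    · rw [indicator_of_notMem h, indicator_of_notMem (mt h2.1 h)]
  have hsum : m.lam 0 + m.lam 1 = m.lam k + m.lam (other k) := by
    rw [← Fin.sum_univ_two]
    exact sum_fin_two_other _ k
  have h2 : Measurable fun x : ℝ × ℝ => ENNReal.ofReal (Real.exp (-m.lam (other k) * x.1)) *
      ∫⁻ q, f (consRaw k x (bump (other k, 0) x.1 q)) ∂(rawLaw m) :=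
    Measurable.mul (by fun_prop) hg'
  rw [lintegral_congr_ae ((ae_claimLaw_pos m (k, 0)).mono fun x hx => h1 x hx.1.le), claimLaw,
    lintegral_prod _ h2.aemeasurable, lintegral_expMeasure _ h2.lintegral_prod_right']
  refine setLIntegral_congr_fun measurableSet_Ioi fun w _ => ?_
  simp only
  have h3 : Measurable fun α : ℝ =>
      ∫⁻ q, f (consRaw k (w, α) (bump (other k, 0) w q)) ∂(rawLaw m) :=
    hg'.comp (measurable_const.prodMk measurable_id)
  rw [lintegral_const_mul _ h3, ← mul_assoc,
    ← ENNReal.ofReal_mul (mul_nonneg (m.lam_pos k).le (Real.exp_nonneg _)), mul_assoc,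
    ← Real.exp_add, hsum]
  congr 4
  ring

/-! ### Time and size of the first claim, and the scenario thereafter -/

/-- Puts a first claim `x.2` of company `k` at time `x.1` before all claims. -/
def insRaw (k : Fin 2) (x : ℝ × ℝ) (q : Fin 2 × ℕ → ℝ × ℝ) : Fin 2 × ℕ → ℝ × ℝ :=
  consRaw k x (bump (other k, 0) x.1 q)

theorem insRaw_zero (k : Fin 2) (x : ℝ × ℝ) (q : Fin 2 × ℕ → ℝ × ℝ) : insRaw k x q (k, 0) = x := by
  simp [insRaw, consRaw]

theorem insRaw_succ (k : Fin 2) (x : ℝ × ℝ) (q : Fin 2 × ℕ → ℝ × ℝ) (i : ℕ) :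
    insRaw k x q (k, i + 1) = q (k, i) := by
  simp [insRaw, consRaw, bump, (other_ne k).symm]

theorem insRaw_other_zero (k : Fin 2) (x : ℝ × ℝ) (q : Fin 2 × ℕ → ℝ × ℝ) :
    insRaw k x q (other k, 0) = ((q (other k, 0)).1 + x.1, (q (other k, 0)).2) := by
  simp [insRaw, consRaw, bump, other_ne]

theorem insRaw_other_succ (k : Fin 2) (x : ℝ × ℝ) (q : Fin 2 × ℕ → ℝ × ℝ) (i : ℕ) :
    insRaw k x q (other k, i + 1) = q (other k, i + 1) := by
  simp [insRaw, consRaw, bump, other_ne]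

theorem measurable_insRaw (k : Fin 2) :
    Measurable fun y : (ℝ × ℝ) × (Fin 2 × ℕ → ℝ × ℝ) => insRaw k y.1 y.2 :=
  (measurable_consRaw k).comp (measurable_fst.prodMk
      ((measurable_bump _).comp ((measurable_fst.comp measurable_fst).prodMk measurable_snd)))

theorem injective_insRaw (k : Fin 2) :
    Function.Injective fun y : (ℝ × ℝ) × (Fin 2 × ℕ → ℝ × ℝ) => insRaw k y.1 y.2 := by
  rintro ⟨x, q⟩ ⟨x', q'⟩ h
  have h' : ∀ r, insRaw k x q r = insRaw k x' q' r := fun r => congrFun h r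
  have h1 : x = x' := by rw [← insRaw_zero k x q, h', insRaw_zero]
  subst h1
  have h2 : q = q' := by
    funext ⟨i, a⟩
    rcases eq_or_eq_other k i with rfl | rfl
    · rw [← insRaw_succ i x q, h', insRaw_succ]
    · cases a with
      | zero =>
        have h3 := h' (other k, 0)
        rw [insRaw_other_zero, insRaw_other_zero, Prod.mk.injEq] at h3
        exact Prod.ext (by linarith [h3.1]) h3.2
      | succ a => rw [← insRaw_other_succ k x q, h', insRaw_other_succ]
  rw [h2]

theorem measurableEmbedding_insRaw (k : Fin 2) :
    MeasurableEmbedding fun y : (ℝ × ℝ) × (Fin 2 × ℕ → ℝ × ℝ) => insRaw k y.1 y.2 :=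
  (measurable_insRaw k).measurableEmbedding (injective_insRaw k)

/-- The distribution of the time and the size of the first claim, on the event that this claim is one
of company `k`. -/
def firstLaw (m : Model) (k : Fin 2) : Measure (ℝ × ℝ) :=
  ((volume.restrict (Ioi (0 : ℝ))).withDensity fun w =>
    ENNReal.ofReal (m.lam k * Real.exp (-(m.lam 0 + m.lam 1) * w))).prod (m.F k)

instance (m : Model) (k : Fin 2) : SFinite (firstLaw m k) := by
  unfold firstLaw
  infer_instance

theorem lintegral_firstLaw (m : Model) (k : Fin 2) {f : ℝ × ℝ → ℝ≥0∞} (hf : Measurable f) :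
    ∫⁻ x, f x ∂(firstLaw m k) = ∫⁻ w in Ioi (0 : ℝ),
      ENNReal.ofReal (m.lam k * Real.exp (-(m.lam 0 + m.lam 1) * w)) * ∫⁻ α, f (w, α) ∂(m.F k) := by
  rw [firstLaw, lintegral_prod _ hf.aemeasurable,
    lintegral_withDensity_eq_lintegral_mul _ (by fun_prop) hf.lintegral_prod_right']
  rfl

theorem restrict_rawLaw_first (m : Model) (k : Fin 2) :
    (rawLaw m).restrict {q | (q (k, 0)).1 < (q (other k, 0)).1} =
      ((firstLaw m k).prod (rawLaw m)).map fun y => insRaw k y.1 y.2 := by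
  ext A hA
  have hm : Measurable fun y : (ℝ × ℝ) × (Fin 2 × ℕ → ℝ × ℝ) =>
      A.indicator (1 : (Fin 2 × ℕ → ℝ × ℝ) → ℝ≥0∞) (insRaw k y.1 y.2) :=
    (measurable_one.indicator hA).comp (measurable_insRaw k)
  rw [← lintegral_indicator_one hA, setLIntegral_rawLaw_first m k (measurable_one.indicator hA),
    ← lintegral_indicator_one hA, lintegral_map (measurable_one.indicator hA) (measurable_insRaw k),
    lintegral_prod _ hm.aemeasurable, lintegral_firstLaw m k hm.lintegral_prod_right']
  rfl

theorem ae_firstLaw_pos (m : Model) (k : Fin 2) : ∀ᵐ x ∂(firstLaw m k), 0 < x.1 ∧ 0 < x.2 := by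
  have h1 : ∀ᵐ x ∂(firstLaw m k), 0 < x.1 :=
    Measure.quasiMeasurePreserving_fst.ae ((withDensity_absolutelyContinuous _ _).ae_le
      (ae_restrict_mem measurableSet_Ioi))
  have h2 : ∀ᵐ x ∂(firstLaw m k), 0 < x.2 :=
    Measure.quasiMeasurePreserving_snd.ae (by
      filter_upwards [measure_eq_zero_iff_ae_notMem.1 (m.F_pos k)] with x hx
      exact not_le.1 hx)
  filter_upwards [h1, h2] with x h h' using ⟨h, h'⟩

/-- No measurability of `f` is assumed: `insRaw` and `Scenario.raw` are measurable embeddings, for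
which the change of variables holds for arbitrary functions. Extension by `0` is harmless, since
almost every raw scenario is a scenario. -/
theorem lintegral_law_eq (m : Model) (f : Scenario → ℝ≥0∞) :
    ∫⁻ ω, f ω ∂(law m) = ∑ k, ∫⁻ y, Function.extend Scenario.raw f 0 (insRaw k y.1 y.2.raw)
      ∂((firstLaw m k).prod (law m)) := by
  set f' := Function.extend Scenario.raw f 0 with hf'
  have h1 : ∫⁻ ω, f ω ∂(law m) = ∫⁻ q, f' q ∂(rawLaw m) := by
    rw [lintegral_rawLaw]
    refine lintegral_congr fun ω => ?_
    rw [hf', measurableEmbedding_raw.injective.extend_apply]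
  have h2 : ∀ k, ∫⁻ q in {q | (q (k, 0)).1 < (q (other k, 0)).1}, f' q ∂(rawLaw m) =
      ∫⁻ y, f' (insRaw k y.1 y.2.raw) ∂((firstLaw m k).prod (law m)) := by
    intro k
    have h3 : MeasurableEmbedding (Prod.map (id : ℝ × ℝ → ℝ × ℝ) Scenario.raw) :=
      MeasurableEmbedding.id.prodMap measurableEmbedding_raw
    rw [restrict_rawLaw_first, (measurableEmbedding_insRaw k).lintegral_map, ← map_raw_law,
      ← Measure.map_id (μ := firstLaw m k), Measure.map_prod_map _ _ measurable_id
        measurableEmbedding_raw.measurable, h3.lintegral_map, Measure.map_id]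
    rfl
  have hS : ∀ k : Fin 2, MeasurableSet {q : Fin 2 × ℕ → ℝ × ℝ | (q (k, 0)).1 < (q (other k, 0)).1} :=
    fun k => measurableSet_lt (measurable_pi_apply (k, 0)).fst (measurable_pi_apply (other k, 0)).fst
  rw [h1, Fin.sum_univ_two, ← h2, ← h2, ← lintegral_union (hS 1), Measure.restrict_eq_self_of_ae_mem]
  · filter_upwards [ae_rawLaw_arrival_ne m 0 0] with q hq
    have h4 : (q (0, 0)).1 ≠ (q (1, 0)).1 := by simpa [rawArrival] using hq
    exact h4.lt_or_gt
  · refine Set.disjoint_left.2 fun q h h' => ?_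
    exact lt_asymm (show (q (0, 0)).1 < (q (1, 0)).1 from h) h'

/-! ### Scenarios with a prescribed first claim -/

/-- The scenario `ω` consists of a claim `α` of company `k` at time `w` and, thereafter, of `q`. -/
structure FirstClaim (k : Fin 2) (w α : ℝ) (q ω : Scenario) : Prop where
  time_pos : 0 < w
  size_pos : 0 < α
  raw : ω.raw = insRaw k (w, α) q.raw

theorem rawArrival_insRaw_succ (k : Fin 2) (x : ℝ × ℝ) (q : Scenario) (i : ℕ) :
    rawArrival (insRaw k x q.raw) k (i + 1) = x.1 + arrival k i q := by
  rw [rawArrival, Finset.sum_range_succ', insRaw_zero, add_comm]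
  simp only [insRaw_succ]
  rfl

theorem rawArrival_insRaw_other (k : Fin 2) (x : ℝ × ℝ) (q : Scenario) (i : ℕ) :
    rawArrival (insRaw k x q.raw) (other k) i = x.1 + arrival (other k) i q := by
  rw [rawArrival, Finset.sum_range_succ', insRaw_other_zero]
  simp only [insRaw_other_succ]
  rw [arrival, rawArrival, Finset.sum_range_succ' (fun j => (q.1 (other k, j)).1)]
  simp only [Scenario.raw]
  ring

theorem exists_firstClaim (k : Fin 2) {w α : ℝ} (hw : 0 < w) (hα : 0 < α) (q : Scenario) :
    ∃ ω, FirstClaim k w α q ω := by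
  have h1 := rawArrival_insRaw_succ k (w, α) q
  have h0 : rawArrival (insRaw k (w, α) q.raw) k 0 = w := by simp [rawArrival, insRaw_zero]
  have h2 := rawArrival_insRaw_other k (w, α) q
  have hne : ∀ i j, rawArrival (insRaw k (w, α) q.raw) k i ≠
      rawArrival (insRaw k (w, α) q.raw) (other k) j := by
    intro i j
    rw [h2]
    cases i with
    | zero =>
      rw [h0]
      exact (lt_add_of_pos_right _ (arrival_pos (other k) j q)).ne
    | succ i =>
      rw [h1]
      simpa using arrival_ne k i j q
  refine ⟨⟨insRaw k (w, α) q.raw, fun ⟨i, a⟩ => ?_, fun i => ?_, fun i j => ?_⟩, hw, hα, rfl⟩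
  · rcases eq_or_eq_other k i with rfl | rfl
    · cases a with
      | zero => rw [insRaw_zero]; exact ⟨hw, hα⟩
      | succ a => rw [insRaw_succ]; exact q.2.1 _
    · cases a with
      | zero => rw [insRaw_other_zero]; exact ⟨add_pos (q.2.1 _).1 hw, (q.2.1 _).2⟩
      | succ a => rw [insRaw_other_succ]; exact q.2.1 _
  · rcases eq_or_eq_other k i with rfl | rfl
    · refine (tendsto_add_atTop_iff_nat 1).1 ?_
      simp only [h1]
      exact tendsto_atTop_add_const_left _ _ (q.2.2.1 i)
    · rw [funext h2]
      exact tendsto_atTop_add_const_left _ _ (q.2.2.1 (other k))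
  · fin_cases k
    · exact hne i j
    · exact (hne j i).symm

theorem lintegral_law_first_eq (m : Model) {G : Fin 2 → (ℝ × ℝ) × Scenario → ℝ≥0∞} (hG : ∀ k, Measurable (G k)) :
    (∑ k, ∫⁻ w in Ioi (0 : ℝ),
      ENNReal.ofReal (m.lam k * Real.exp (-(m.lam 0 + m.lam 1) * w)) *
        ∫⁻ α, ∫⁻ q, G k ((w, α), q) ∂(law m) ∂(m.F k)) =
    ∑ k, ∫⁻ y, G k y ∂((firstLaw m k).prod (law m)) := by
  refine Finset.sum_congr rfl fun k _ => ?_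
  rw [lintegral_prod _ (hG k).aemeasurable, lintegral_firstLaw m k (hG k).lintegral_prod_right']

theorem ae_firstLaw_prod_extend (m : Model) (k : Fin 2) (f : Scenario → ℝ≥0∞) :
    ∀ᵐ y ∂((firstLaw m k).prod (law m)), ∃ ω, FirstClaim k y.1.1 y.1.2 y.2 ω ∧
      Function.extend Scenario.raw f 0 (insRaw k y.1 y.2.raw) = f ω := by
  have h : ∀ᵐ y ∂((firstLaw m k).prod (law m)), 0 < y.1.1 ∧ 0 < y.1.2 :=
    Measure.quasiMeasurePreserving_fst.ae (ae_firstLaw_pos m k)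
  filter_upwards [h] with y hy
  obtain ⟨ω, hω⟩ := exists_firstClaim k hy.1 hy.2 y.2
  exact ⟨ω, hω, by rw [← Prod.mk.eta (p := y.1), ← hω.raw,
    measurableEmbedding_raw.injective.extend_apply]⟩

namespace FirstClaim

variable {k : Fin 2} {w α : ℝ} {q ω : Scenario}

theorem arrival_zero (h : FirstClaim k w α q ω) : arrival k 0 ω = w := by
  have h1 : ω.raw (k, 0) = (w, α) := by rw [h.raw, insRaw_zero]
  simp only [arrival, rawArrival, zero_add, Finset.range_one, Finset.sum_singleton]
  exact congrArg Prod.fst h1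

theorem arrival_succ (h : FirstClaim k w α q ω) (i : ℕ) :
    arrival k (i + 1) ω = w + arrival k i q := by
  have h1 : arrival k (i + 1) ω = rawArrival (insRaw k (w, α) q.raw) k (i + 1) := by
    rw [← h.raw]
    rfl
  rw [h1, rawArrival_insRaw_succ]

theorem arrival_other (h : FirstClaim k w α q ω) (i : ℕ) :
    arrival (other k) i ω = w + arrival (other k) i q := by
  have h1 : arrival (other k) i ω = rawArrival (insRaw k (w, α) q.raw) (other k) i := by
    rw [← h.raw]
    rfl
  rw [h1, rawArrival_insRaw_other]

theorem coe_claimTime (h : FirstClaim k w α q ω) : (claimTime 1 ω : ℝ) = w := by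
  have h1 : min (arrival 0 0 ω) (arrival 1 0 ω) = min (arrival k 0 ω) (arrival (other k) 0 ω) := by
    rcases eq_or_eq_other 0 k with rfl | rfl
    · rfl
    · exact min_comm _ _
  rw [coe_claimTime_one, h1, h.arrival_zero, h.arrival_other]
  exact min_eq_left (le_add_of_nonneg_right (arrival_pos _ _ _).le)

theorem claimCount_self (h : FirstClaim k w α q ω) : claimCount k (claimTime 1 ω) ω = 1 := by
  refine le_antisymm ((claimCount_le_iff _ _ _ _).2 ?_) ((lt_claimCount_iff _ _ _ _).2 ?_)
  · rw [h.coe_claimTime, ← zero_add 1, h.arrival_succ]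
    exact lt_add_of_pos_right _ (arrival_pos _ _ _)
  · rw [h.coe_claimTime, h.arrival_zero]

theorem claimCount_other (h : FirstClaim k w α q ω) :
    claimCount (other k) (claimTime 1 ω) ω = 0 := by
  refine Nat.le_zero.1 ((claimCount_le_iff _ _ _ _).2 ?_)
  rw [h.coe_claimTime, h.arrival_other]
  exact lt_add_of_pos_right _ (arrival_pos _ _ _)

theorem freeSurplus_eq (h : FirstClaim k w α q ω) (m : Model) (z : Fin 2 → ℝ) (i : Fin 2) :
    freeSurplus m z i (claimTime 1 ω) ω = z i + m.p i * w - if i = k then α else 0 := by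
  rw [freeSurplus, h.coe_claimTime]
  congr 1
  rcases eq_or_eq_other k i with rfl | rfl
  · have h1 : ω.raw (i, 0) = (w, α) := by rw [h.raw, insRaw_zero]
    rw [if_pos rfl, aggregateClaims, h.claimCount_self, Finset.sum_range_one]
    exact congrArg Prod.snd h1
  · rw [if_neg (other_ne k), aggregateClaims_eq_zero h.claimCount_other]

theorem shift_eq (h : FirstClaim k w α q ω) : shift (claimTime 1 ω) ω = q := by
  have h1 : ∀ r, ω.1 r = insRaw k (w, α) q.raw r := fun r => congrFun h.raw r
  refine Subtype.ext (funext fun ⟨i, a⟩ => ?_)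
  have h2 : (shift (claimTime 1 ω) ω).1 (i, a) = shiftRaw (claimTime 1 ω) ω (i, a) := rfl
  rw [h2, shiftRaw]
  simp only
  rcases eq_or_eq_other k i with rfl | rfl
  · rw [h.claimCount_self, h.coe_claimTime, ← zero_add 1, h.arrival_succ, h1, zero_add, add_comm 1 a,
      insRaw_succ]
    cases a with
    | zero => simp [arrival, rawArrival, Scenario.raw]
    | succ a => simp [Scenario.raw]
  · rw [h.claimCount_other, h.coe_claimTime, h.arrival_other, h1, zero_add]
    cases a with
    | zero => simp [arrival, rawArrival, Scenario.raw, insRaw_other_zero]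
    | succ a => simp [Scenario.raw, insRaw_other_succ]

end FirstClaim

/-- Iterated integrals require measurability, which is not available for payoffs. It is therefore
imposed on the bound `G` only, expressed in terms of the first claim and the later scenario. -/
theorem le_lintegral_law (m : Model) {f : Scenario → ℝ≥0∞}
    {G : Fin 2 → (ℝ × ℝ) × Scenario → ℝ≥0∞} (hG : ∀ k, Measurable (G k))
    (h : ∀ k w α q ω, FirstClaim k w α q ω → G k ((w, α), q) ≤ f ω) :
    (∑ k, ∫⁻ w in Ioi (0 : ℝ),
      ENNReal.ofReal (m.lam k * Real.exp (-(m.lam 0 + m.lam 1) * w)) *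
        ∫⁻ α, ∫⁻ q, G k ((w, α), q) ∂(law m) ∂(m.F k)) ≤ ∫⁻ ω, f ω ∂(law m) := by
  rw [lintegral_law_first_eq m hG, lintegral_law_eq m f]
  refine Finset.sum_le_sum fun k _ => lintegral_mono_ae ?_
  filter_upwards [ae_firstLaw_prod_extend m k f] with y ⟨ω, hω, hy⟩
  rw [hy]
  exact h k _ _ _ _ hω

theorem lintegral_law_le (m : Model) {f : Scenario → ℝ≥0∞}
    {G : Fin 2 → (ℝ × ℝ) × Scenario → ℝ≥0∞} (hG : ∀ k, Measurable (G k))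
    (h : ∀ k w α q ω, FirstClaim k w α q ω → f ω ≤ G k ((w, α), q)) :
    ∫⁻ ω, f ω ∂(law m) ≤ ∑ k, ∫⁻ w in Ioi (0 : ℝ),
      ENNReal.ofReal (m.lam k * Real.exp (-(m.lam 0 + m.lam 1) * w)) *
        ∫⁻ α, ∫⁻ q, G k ((w, α), q) ∂(law m) ∂(m.F k) := by
  rw [lintegral_law_first_eq m hG, lintegral_law_eq m f]
  refine Finset.sum_le_sum fun k _ => lintegral_mono_ae ?_
  filter_upwards [ae_firstLaw_prod_extend m k f] with y ⟨ω, hω, hy⟩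
  rw [hy]
  exact h k _ _ _ _ hω

/-! ### Waiting for a claim -/

/-- Prolongs the time until the first claim by `s`. -/
def delayRaw (s : ℝ) (q : Fin 2 × ℕ → ℝ × ℝ) : Fin 2 × ℕ → ℝ × ℝ := bump (0, 0) s (bump (1, 0) s q)

theorem delayRaw_zero (s : ℝ) (q : Fin 2 × ℕ → ℝ × ℝ) (k : Fin 2) :
    delayRaw s q (k, 0) = ((q (k, 0)).1 + s, (q (k, 0)).2) := by
  fin_cases k <;> simp [delayRaw, bump]

theorem delayRaw_succ (s : ℝ) (q : Fin 2 × ℕ → ℝ × ℝ) (k : Fin 2) (i : ℕ) :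
    delayRaw s q (k, i + 1) = q (k, i + 1) := by
  simp [delayRaw, bump]

theorem measurable_bump_left (r : Fin 2 × ℕ) (s : ℝ) : Measurable (bump r s) :=
  (measurable_bump r).comp (measurable_const.prodMk measurable_id)

theorem measurableEmbedding_delayRaw (s : ℝ) : MeasurableEmbedding (delayRaw s) := by
  refine ((measurable_bump_left _ _).comp (measurable_bump_left _ _)).measurableEmbedding ?_
  intro q q' h
  have h' : ∀ r, delayRaw s q r = delayRaw s q' r := fun r => congrFun h r
  funext ⟨k, i⟩
  cases i with
  | zero =>
    have h1 := h' (k, 0)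
    rw [delayRaw_zero, delayRaw_zero, Prod.mk.injEq] at h1
    exact Prod.ext (by linarith [h1.1]) h1.2
  | succ i =>
    rw [← delayRaw_succ s q, h', delayRaw_succ]

/-- Lack of memory applied to the first waiting times of both companies. The left side is the law
restricted to the event that both exceed `s`, whence the inequality. -/
theorem smul_map_delayRaw_le (m : Model) {s : ℝ} (hs : 0 ≤ s) :
    ENNReal.ofReal (Real.exp (-(m.lam 0 + m.lam 1) * s)) • (rawLaw m).map (delayRaw s) ≤ rawLaw m := by
  refine Measure.le_iff.2 fun A hA => ?_
  have h1 := setLIntegral_rawLaw_bump m (0, 0) hs (f := A.indicator 1) (measurable_one.indicator hA)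
  have h2 := setLIntegral_rawLaw_bump m (1, 0) hs (f := fun q => A.indicator 1 (bump (0, 0) s q))
    ((measurable_one.indicator hA).comp (measurable_bump_left _ _))
  have h3 : ∫⁻ q, A.indicator 1 (bump (0, 0) s (bump (1, 0) s q)) ∂(rawLaw m) =
      (rawLaw m).map (delayRaw s) A := by
    rw [← lintegral_indicator_one hA, lintegral_map (measurable_one.indicator hA)
      (measurableEmbedding_delayRaw s).measurable]
    rfl
  rw [h3] at h2
  have h4 : Real.exp (-(m.lam 0 + m.lam 1) * s) =
      Real.exp (-m.lam 0 * s) * Real.exp (-m.lam 1 * s) := by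
    rw [← Real.exp_add]
    congr 1
    ring
  rw [Measure.smul_apply, smul_eq_mul, h4, ENNReal.ofReal_mul (Real.exp_nonneg _), mul_assoc, ← h2]
  calc _ ≤ ENNReal.ofReal (Real.exp (-m.lam 0 * s)) *
        ∫⁻ q, A.indicator 1 (bump (0, 0) s q) ∂(rawLaw m) := by
        exact mul_le_mul_right (setLIntegral_le_lintegral _ _) _
    _ ≤ rawLaw m A := by
        rw [← h1, ← lintegral_indicator_one hA]
        exact setLIntegral_le_lintegral _ _

theorem exists_shift_eq (s : ℝ≥0) (q : Scenario) :
    ∃ ω : Scenario, ω.raw = delayRaw s q.raw ∧ shift s ω = q ∧ s < claimTime 1 ω := by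
  have h1 : ∀ k i, rawArrival (delayRaw s q.raw) k i = s + arrival k i q := by
    intro k i
    rw [rawArrival, Finset.sum_range_succ', delayRaw_zero]
    simp only [delayRaw_succ]
    rw [arrival, rawArrival, Finset.sum_range_succ' (fun j => (q.1 (k, j)).1)]
    simp only [Scenario.raw]
    ring
  have hω : ∃ ω : Scenario, ω.raw = delayRaw s q.raw := by
    refine ⟨⟨delayRaw s q.raw, fun ⟨k, i⟩ => ?_, fun k => ?_, fun i j => ?_⟩, rfl⟩
    · cases i with
      | zero =>
        rw [delayRaw_zero]
        exact ⟨add_pos_of_pos_of_nonneg (q.2.1 _).1 s.coe_nonneg, (q.2.1 _).2⟩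
      | succ i => rw [delayRaw_succ]; exact q.2.1 _
    · rw [funext (h1 k)]
      exact tendsto_atTop_add_const_left _ _ (q.2.2.1 k)
    · rw [h1, h1]
      simpa using arrival_ne 0 i j q
  obtain ⟨ω, hω⟩ := hω
  have h2 : ∀ k i, arrival k i ω = s + arrival k i q := by
    intro k i
    rw [← h1, ← hω]
    rfl
  have h3 : ∀ k, claimCount k s ω = 0 := by
    intro k
    refine Nat.le_zero.1 ((claimCount_le_iff _ _ _ _).2 ?_)
    rw [h2]
    exact lt_add_of_pos_right _ (arrival_pos _ _ _)
  refine ⟨ω, hω, Subtype.ext (funext fun ⟨k, i⟩ => ?_), ?_⟩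
  · have h4 : (shift s ω).1 (k, i) = shiftRaw s ω (k, i) := rfl
    have h5 : ∀ r, ω.1 r = delayRaw s q.raw r := fun r => congrFun hω r
    rw [h4, shiftRaw]
    simp only
    rw [h3, h2, zero_add, h5]
    cases i with
    | zero => simp [arrival, rawArrival, Scenario.raw, delayRaw_zero]
    | succ i => simp [Scenario.raw, delayRaw_succ]
  · rw [lt_claimTime_iff, totalCount, h3, h3]
    norm_num

/-- No claim occurs up to `s` with probability e^{-λs}, and the scenario seen from `s` then has the
original law; all other scenarios are dropped from the right side. -/
theorem mul_lintegral_shift_le (m : Model) (s : ℝ≥0) {f g : Scenario → ℝ≥0∞}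
    (h : ∀ ω, s < claimTime 1 ω → g (shift s ω) ≤ f ω) :
    ENNReal.ofReal (Real.exp (-(m.lam 0 + m.lam 1) * s)) * ∫⁻ q, g q ∂(law m) ≤
      ∫⁻ ω, f ω ∂(law m) := by
  have h1 : ∫⁻ ω, f ω ∂(law m) = ∫⁻ q, Function.extend Scenario.raw f 0 q ∂(rawLaw m) := by
    rw [lintegral_rawLaw]
    refine lintegral_congr fun ω => ?_
    rw [measurableEmbedding_raw.injective.extend_apply]
  rw [h1]
  refine le_trans ?_ (lintegral_mono' (smul_map_delayRaw_le m s.coe_nonneg) le_rfl)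
  rw [lintegral_smul_measure, (measurableEmbedding_delayRaw s).lintegral_map, lintegral_rawLaw,
    smul_eq_mul]
  gcongr with q
  obtain ⟨ω, hω, hq, hs⟩ := exists_shift_eq s q
  rw [← hω, measurableEmbedding_raw.injective.extend_apply]
  simpa only [hq] using h ω hs

variable {m : Model} {z g : Fin 2 → ℝ} {L M : Fin 2 → ℝ≥0 → Scenario → ℝ} {ω : Scenario}

/-! ### Bounds for dividends and surpluses -/

theorem freeSurplus_le (m : Model) (z : Fin 2 → ℝ) (k : Fin 2) (t : ℝ≥0) (ω : Scenario) :
    freeSurplus m z k t ω ≤ z k + m.p k * t :=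
  sub_le_self _ (aggregateClaims_nonneg k t ω)

theorem sum_surplus_add_dividends_le (m : Model) (z : Fin 2 → ℝ)
    (L : Fin 2 → ℝ≥0 → Scenario → ℝ) (t : ℝ≥0) (ω : Scenario) :
    surplus m z L 0 t ω + surplus m z L 1 t ω + (L 0 t ω + L 1 t ω) ≤
      z 0 + z 1 + (m.p 0 + m.p 1) * t := by
  rw [surplus_add]
  linarith [freeSurplus_le m z 0 t ω, freeSurplus_le m z 1 t ω]

theorem dividends_le_of_lt_ruinTime (hL : ∀ k t, 0 ≤ L k t ω) {t : ℝ≥0}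
    (ht : (t : ℝ≥0∞) < ruinTime m z L ω) (k : Fin 2) :
    L k t ω ≤ z 0 + z 1 + (m.p 0 + m.p 1) * t := by
  have h1 := joint_nonneg_of_lt_ruinTime ht
  have h2 := sum_surplus_add_dividends_le m z L t ω
  have h3 : L 0 t ω + L 1 t ω = L k t ω + L (other k) t ω := by
    rw [← sum_fin_two_other (fun i => L i t ω) k, Fin.sum_univ_two]
  linarith [hL (other k) t]

theorem surplus_le_of_lt_ruinTime (h : PathAdmissible m z L ω) (hL : ∀ k t, 0 ≤ L k t ω) {t : ℝ≥0}
    (ht : (t : ℝ≥0∞) < ruinTime m z L ω) (k : Fin 2) :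
    surplus m z L k t ω ≤ z 0 + z 1 + (m.p 0 + m.p 1) * t := by
  have h1 := h.nonneg t ht (other k)
  have h2 := sum_surplus_add_dividends_le m z L t ω
  have h3 : surplus m z L 0 t ω + surplus m z L 1 t ω =
      surplus m z L k t ω + surplus m z L (other k) t ω := by
    rw [← sum_fin_two_other (fun i => surplus m z L i t ω) k, Fin.sum_univ_two]
  linarith [hL 0 t, hL 1 t]

/-- At ruin no transfer takes place. So each surplus is at most its value at some earlier time after
the last settled transfer plus the premium since then, as claims and dividends only decrease it. The
surviving company may have a positive surplus at ruin, and its continuation value must be bounded.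
-/
theorem surplus_ruinTime_le (h : PathAdmissible m z L ω) (hL : ∀ k, Monotone fun t => L k t ω)
    (h0 : ∀ k, L k 0 ω = 0) (hz : ∀ k, 0 ≤ z k) {T : ℝ≥0} (hT : ruinTime m z L ω = T) (k : Fin 2) :
    surplus m z L k T ω ≤ z 0 + z 1 + (m.p 0 + m.p 1) * T := by
  have hneg := h.ruin T hT
  have hp := p_pos m
  have hLnn : ∀ k t, 0 ≤ L k t ω := fun k t => (h0 k) ▸ hL k (zero_le (a := t))
  have hTpos : 0 < T := by
    rcases eq_zero_or_pos T with rfl | hT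
    · rw [surplus_zero h0, surplus_zero h0] at hneg
      linarith [hz 0, hz 1]
    · exact hT
  have key : ∀ u < T, ∀ n, totalCount u ω = n →
      freeSurplus m z k T ω - L k T ω + received m z L ω n k - received m z L ω n (other k) ≤
        z 0 + z 1 + (m.p 0 + m.p 1) * T := by
    intro u hu n hn
    have h1 := surplus_le_of_lt_ruinTime h hLnn (t := u) (by rw [hT]; exact_mod_cast hu) k
    rw [surplus, hn] at h1
    have h2 := hL k hu.le
    have h3 := aggregateClaims_mono k ω hu.le
    simp only at h2 h3
    have h4 : freeSurplus m z k T ω ≤ freeSurplus m z k u ω + m.p k * (T - u) := by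
      simp only [freeSurplus]
      linarith
    have h5 : m.p k * ((T : ℝ) - u) ≤ (m.p 0 + m.p 1) * ((T : ℝ) - u) := by
      refine mul_le_mul_of_nonneg_right ?_ (sub_nonneg.2 (by exact_mod_cast hu.le))
      rcases eq_or_eq_other 0 k with rfl | rfl
      · linarith [hp 1]
      · rw [other_zero]
        linarith [hp 0]
    linarith
  have hle : claimTime (totalCount T ω) ω ≤ T := (claimTime_le_iff _ _ _).2 le_rfl
  rcases hle.lt_or_eq with hlt | heq
  · exact key _ hlt _ (totalCount_claimTime _ _)
  · obtain ⟨n, hn⟩ : ∃ n, totalCount T ω = n + 1 := by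
      refine Nat.exists_eq_succ_of_ne_zero fun h0 => ?_
      rw [h0, claimTime_zero] at heq
      exact hTpos.ne heq
    rw [hn] at heq
    obtain ⟨u, hu, hNu⟩ := exists_lt_totalCount T hTpos ω
    have hNu' : totalCount u ω = n := by
      have := (lt_claimTime_iff (n + 1) u ω).1 (heq ▸ hu)
      omega
    have h1 := key u hu n hNu'
    have h2 : ∀ k, surplus m z L k T ω = settle (fun i => freeSurplus m z i T ω - L i T ω +
        received m z L ω n i - received m z L ω n (other i)) k := by
      intro k
      have := surplus_claimTime_succ (m := m) (z := z) (L := L) (ω := ω) n k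
      rwa [heq] at this
    rw [h2, h2, settle_sum] at hneg
    rw [h2, settle_of_neg hneg]
    exact h1

/-! ### Bounds for the value functions -/

theorem valueAlone_le (m : Model) (k : Fin 2) {x : ℝ} (hx : 0 ≤ x) :
    valueAlone m k x ≤ ENNReal.ofReal (2 * x + 4 * m.p k / m.δ) := by
  rw [valueAlone, if_neg (not_lt.2 hx)]
  refine iSup₂_le fun L hL => ?_
  refine (lintegral_mono (g := fun _ => ENNReal.ofReal (2 * x + 4 * m.p k / m.δ)) fun ω => ?_).trans_eq
    ((lintegral_const _).trans ?_)
  · refine discountedDividends_le m.δ_pos (hL.1.mono ω) (hL.1.zero ω) (hL.1.left_continuous ω) hx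
      (p_pos m k).le fun t ht => ?_
    by_contra hlt
    refine absurd (iInf₂_le t ?_) (not_le.2 ht)
    have := aggregateClaims_nonneg k t ω
    linarith
  · rw [measure_univ, mul_one]

/-- A company starting from `y` may pay `y - x` immediately and then imitate a strategy from `x`;
the ruin time is the same. Monotonicity supplies the measurability of `valueAlone` used below. -/
theorem valueAlone_mono (m : Model) (k : Fin 2) : Monotone (valueAlone m k) := by
  intro x y hxy
  rcases lt_or_ge x 0 with hx | hx
  · rw [valueAlone, if_pos hx]
    exact zero_le
  · rw [valueAlone, if_neg (not_lt.2 hx), valueAlone, if_neg (not_lt.2 (hx.trans hxy))]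
    refine iSup₂_le fun L hL => ?_
    set L' : ℝ≥0 → Scenario → ℝ := fun t ω => L t ω + if t = 0 then 0 else y - x with hL'
    have hle : ∀ t ω, L t ω ≤ L' t ω := by
      intro t ω
      simp only [hL']
      split_ifs <;> linarith
    have hL0 : ∀ ω, L' 0 ω = 0 := fun ω => by simp [hL', hL.1.zero]
    have hruin : ∀ ω t, x + m.p k * (t : ℝ≥0) - aggregateClaims k t ω - L t ω < 0 ↔
        y + m.p k * t - aggregateClaims k t ω - L' t ω < 0 := by
      intro ω t
      rcases eq_or_ne t 0 with rfl | ht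
      · have h1 : aggregateClaims k 0 ω = 0 := aggregateClaims_eq_zero (claimCount_zero k ω)
        rw [h1, hL.1.zero, hL0]
        simp only [NNReal.coe_zero, mul_zero, add_zero, sub_zero]
        constructor <;> intro h <;> linarith
      · simp only [hL', if_neg ht]
        constructor <;> intro h <;> linarith
    have hT : ∀ ω, ruinTimeAlone m k y L' ω = ruinTimeAlone m k x L ω := by
      intro ω
      simp only [ruinTimeAlone, hruin ω]
    have hmono : ∀ ω, Monotone fun t => L' t ω := by
      intro ω s t hst
      have h1 := hL.1.mono ω hst
      have h2 : (if s = 0 then 0 else y - x) ≤ if t = 0 then 0 else y - x := by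
        split_ifs with h3 h4 h4
        · rfl
        · linarith
        · exact absurd (le_antisymm (h4 ▸ hst) zero_le) h3
        · rfl
      exact add_le_add h1 h2
    have hdiv : IsDividendProcess (filtrationAlone k) L' := by
      refine ⟨?_, hL0, hmono, fun ω t => ?_⟩
      · have hset : MeasurableSet[(filtrationAlone k).predictable]
            ((Ioi (0 : ℝ≥0)) ×ˢ (univ : Set Scenario)) :=
          measurableSet_predictable_Ioi_prod MeasurableSet.univ
        have h1 : StronglyMeasurable[(filtrationAlone k).predictable]
            (((Ioi (0 : ℝ≥0)) ×ˢ (univ : Set Scenario)).indicator fun _ => y - x) :=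
          stronglyMeasurable_const.indicator hset
        have h2 : Function.uncurry L' = Function.uncurry L +
            ((Ioi (0 : ℝ≥0)) ×ˢ (univ : Set Scenario)).indicator fun _ => y - x := by
          funext ⟨t, ω⟩
          rcases eq_or_ne t 0 with rfl | ht
          · simp [hL', Function.uncurry]
          · simp [hL', Function.uncurry, ht, pos_iff_ne_zero.2 ht]
        rw [IsStronglyPredictable, h2]
        exact hL.1.predictable.add h1
      · refine (hL.1.left_continuous ω t).add ?_
        rcases eq_zero_or_pos t with rfl | ht
        · have : Iic (0 : ℝ≥0) = {0} := by ext; simp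
          rw [this]
          exact continuousWithinAt_singleton
        · refine ContinuousWithinAt.congr_of_eventuallyEq
            (continuousWithinAt_const (b := y - x)) ?_ (if_neg ht.ne')
          filter_upwards [mem_nhdsWithin_of_mem_nhds (lt_mem_nhds ht)] with s hs
          exact if_neg hs.ne'
    refine le_trans (lintegral_mono fun ω => ?_) (le_iSup₂
      (f := fun L (_ : IsAdmissibleAlone m k y L) => ∫⁻ ω, discountedDividends m.δ (fun t => L t ω)
        (ruinTimeAlone m k y L ω) ∂(law m)) L' ⟨hdiv, fun ω t ht => ?_⟩)
    · simp only
      rw [hdiv.discountedDividends_eq m.δ_pos, hL.1.discountedDividends_eq m.δ_pos, hT]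
      gcongr
      exact hle _ _
    · rw [hT] at ht
      exact (hruin ω t).1 (hL.2 ω t ht)

theorem valueAlone_of_neg {k : Fin 2} {x : ℝ} (hx : x < 0) : valueAlone m k x = 0 := if_pos hx

theorem sum_weights_mul_le {f : Fin 2 → ℝ≥0∞} {C : ℝ≥0∞} (h : ∀ k, f k ≤ C) :
    ∑ k, ENNReal.ofReal (m.a k) * f k ≤ C := by
  calc ∑ k, ENNReal.ofReal (m.a k) * f k ≤ ∑ k, ENNReal.ofReal (m.a k) * C := by
        gcongr with k; exact h k
    _ = C := by
        rw [← Finset.sum_mul, ← ENNReal.ofReal_sum_of_nonneg fun k _ => m.a_nonneg k,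
          Fin.sum_univ_two, m.a_sum, ENNReal.ofReal_one, one_mul]

theorem p_le_sum (m : Model) (k : Fin 2) : m.p k ≤ m.p 0 + m.p 1 := by
  rcases eq_or_eq_other 0 k with rfl | rfl
  · linarith [p_pos m 1]
  · rw [other_zero]
    linarith [p_pos m 0]

theorem payoff_le (hL : ∀ k, IsDividendProcess filtration (L k)) (h : PathAdmissible m z L ω)
    (hz : ∀ k, 0 ≤ z k) :
    payoff m z L ω ≤ ENNReal.ofReal (4 * (z 0 + z 1) + 10 * (m.p 0 + m.p 1) / m.δ) := by
  set A := z 0 + z 1 with hA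
  set P := m.p 0 + m.p 1 with hP
  have hδ := m.δ_pos
  have hA0 : 0 ≤ A := add_nonneg (hz 0) (hz 1)
  have hP0 : 0 ≤ P := add_nonneg (p_pos m 0).le (p_pos m 1).le
  have hLnn : ∀ k t, 0 ≤ L k t ω := fun k t => ((hL k).zero ω) ▸ (hL k).mono ω (zero_le (a := t))
  -- The dividends before ruin contribute 2A + 4P/δ. The survivor starts with at most A + PT, so its
  -- continuation is worth at most 2(A + PT) + 4P/δ; discounting at T turns 2PT into at most 2P/δ.
  have hsplit : ENNReal.ofReal (4 * A + 10 * P / m.δ) =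
      ENNReal.ofReal (2 * A + 4 * P / m.δ) + ENNReal.ofReal (2 * A + 4 * P / m.δ + 2 * P / m.δ) := by
    rw [← ENNReal.ofReal_add (by positivity) (by positivity)]
    congr 1
    ring
  rw [payoff, hsplit]
  refine add_le_add (sum_weights_mul_le fun k => discountedDividends_le hδ ((hL k).mono ω)
    ((hL k).zero ω) ((hL k).left_continuous ω) hA0 hP0 fun t ht =>
      dividends_le_of_lt_ruinTime hLnn ht k) ?_
  split_ifs with htop
  · exact zero_le
  · obtain ⟨T, hT⟩ : ∃ T : ℝ≥0, (T : ℝ≥0∞) = ruinTime m z L ω := ⟨_, ENNReal.coe_toNNReal htop⟩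
    rw [← hT, ENNReal.toNNReal_coe, terminalValue]
    have h1 : ∀ k, valueAlone m k (surplus m z L k T ω) ≤
        ENNReal.ofReal (2 * A + 4 * P / m.δ + 2 * P * T) := by
      intro k
      rcases lt_or_ge (surplus m z L k T ω) 0 with hneg | hnn
      · rw [valueAlone_of_neg hneg]
        exact zero_le
      · refine (valueAlone_le m k hnn).trans (ENNReal.ofReal_le_ofReal ?_)
        have h2 := surplus_ruinTime_le h (fun k => (hL k).mono ω) (fun k => (hL k).zero ω) hz hT.symm k
        have h3 : 4 * m.p k / m.δ ≤ 4 * P / m.δ := by gcongr; exact p_le_sum m k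
        linarith
    refine (mul_le_mul_right (sum_weights_mul_le h1) _).trans ?_
    rw [← ENNReal.ofReal_mul (Real.exp_nonneg _)]
    exact ENNReal.ofReal_le_ofReal (exp_mul_linear_le hδ (by positivity) (by positivity) T.coe_nonneg)

theorem stepValue_le (m : Model) (n : ℕ) (hz : ∀ k, 0 ≤ z k) :
    stepValue m n z ≤ ENNReal.ofReal (4 * (z 0 + z 1) + 10 * (m.p 0 + m.p 1) / m.δ) := by
  refine iSup₂_le fun L hL => ?_
  rw [strategyValue_eq]
  refine (lintegral_mono fun ω => payoff_le hL.1.dividend ((isAdmissible_iff.1 hL.1).2 ω) hz).trans_eq ?_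
  rw [lintegral_const, measure_univ, mul_one]

theorem stepValue_ne_top (m : Model) (n : ℕ) (hz : ∀ k, 0 ≤ z k) : stepValue m n z ≠ ∞ :=
  ne_top_of_le_ne_top ENNReal.ofReal_ne_top (stepValue_le m n hz)

/-- All strategies admitted for `n = 0` have the same payoff, so the supremum is over a constant. -/
theorem stepValue_zero (m : Model) (hz : ∀ k, 0 ≤ z k) :
    stepValue m 0 z = ENNReal.ofReal (∑ k, m.a k * z k) + stepValue m 0 0 := by
  have h : ∀ z : Fin 2 → ℝ, (∀ k, 0 ≤ z k) → stepValue m 0 z =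
      ENNReal.ofReal (∑ k, m.a k * z k) + strategyValue m 0 (runStrategy m 0) := by
    intro z hz
    have h1 : ∀ L, IsAdmissibleStep m 0 z L → strategyValue m z L =
        ENNReal.ofReal (∑ k, m.a k * z k) + strategyValue m 0 (runStrategy m 0) := by
      intro L hL
      rw [strategyValue_eq, strategyValue_eq, lintegral_congr fun ω =>
        (hL.runsUntilClaim hz ω).payoff_eq hz hL.1.dividend, lintegral_add_left measurable_const,
        lintegral_const, measure_univ, mul_one]
    refine le_antisymm (iSup₂_le fun L hL => (h1 L hL).le) ?_
    rw [← h1 _ (isAdmissibleStep_runStrategy m 0 hz)]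
    exact le_iSup₂ (f := fun L (_ : IsAdmissibleStep m 0 z L) => strategyValue m z L) _
      (isAdmissibleStep_runStrategy m 0 hz)
  rw [h z hz, h 0 fun _ => le_rfl]
  simp

/-- Waiting until the surpluses have grown to `g`. -/
theorem exp_mul_stepValue_le (m : Model) (n : ℕ) (hz : ∀ k, 0 ≤ z k) (hg : ∀ k, 0 ≤ g k) (s : ℝ≥0)
    (hgz : ∀ k, g k ≤ z k + m.p k * s) :
    ENNReal.ofReal (Real.exp (-(m.δ + (m.lam 0 + m.lam 1)) * s)) * stepValue m (n + 1) g ≤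
      stepValue m (n + 1) z := by
  rw [stepValue, ENNReal.mul_iSup]
  refine iSup_le fun L => ?_
  rw [ENNReal.mul_iSup]
  refine iSup_le fun hL => ?_
  have hp := p_pos m
  -- Nothing is paid until time `s`. Scenarios with a claim before `s` are dropped from the
  -- estimate, so the continuations after a claim are arbitrary.
  let S : SwitchPlan m n z :=
    { D := fun _ _ => 0
      s := s
      g := fun i => if i = 0 then g else 0
      L := fun i => if i = 0 then L else runStrategy m 0
      sel := fun _ => 0
      isPlan := ⟨fun _ => rfl, fun _ _ _ _ => le_rfl, fun _ _ => continuousWithinAt_const,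
        fun k t => add_nonneg (hz k) (mul_nonneg (hp k).le t.coe_nonneg)⟩
      measurable_sel := measurable_const
      sel_le := fun y hy k => by simpa using hy k
      wait_le := fun t ht k => by
        have : t = s := by exact_mod_cast ht
        simpa [this] using hgz k
      g_nonneg := fun i k => by
        split_ifs
        · exact hg k
        · exact le_rfl
      isAdmissibleStep_zero := by simpa using hL
      isAdmissibleStep_succ := fun i => by
        simpa using isAdmissibleStep_runStrategy m n (z := 0) fun _ => le_rfl }
  refine le_trans ?_ (le_iSup₂ (f := fun L (_ : IsAdmissibleStep m (n + 1) z L) =>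
    strategyValue m z L) S.strategy S.isAdmissibleStep)
  have h1 : ∀ ω, s < claimTime 1 ω →
      ENNReal.ofReal (Real.exp (-m.δ * s)) * payoff m g L (shift s ω) ≤ payoff m z S.strategy ω := by
    intro ω hω
    have h2 : switchTime S.s ω = s := by
      rw [← ENNReal.coe_inj, coe_switchTime]
      exact min_eq_right (ENNReal.coe_le_coe.2 hω.le)
    have h3 : S.index ω = 0 := by
      rw [SwitchPlan.index, h2, if_pos (totalCount_eq_zero hω)]
    have h4 : ∀ k, 0 ≤ S.switchSurplus ω k := by
      intro k
      rw [SwitchPlan.switchSurplus, h2, freeSurplus, aggregateClaims_eq_zero (claimCount_eq_zero hω k)]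
      have : S.D k s = 0 := rfl
      rw [this, sub_zero, sub_zero]
      exact add_nonneg (hz k) (mul_nonneg (hp k).le s.coe_nonneg)
    have h5 := S.le_payoff_of_nonneg (ω := ω) (add_nonneg (h4 0) (h4 1))
    rw [h2, h3] at h5
    exact le_trans le_add_self h5
  have h2 := mul_lintegral_shift_le m s (g := fun q => ENNReal.ofReal (Real.exp (-m.δ * s)) * payoff m g L q) h1
  rw [lintegral_const_mul' _ _ ENNReal.ofReal_ne_top, ← mul_assoc, ← ENNReal.ofReal_mul
    (Real.exp_nonneg _), ← Real.exp_add] at h2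
  rw [strategyValue_eq, strategyValue_eq]
  refine le_trans (le_of_eq ?_) h2
  congr 3
  ring

/-! ### Continuity of the value functions -/

/-- Waiting gives e^{-qs}V(y') ≤ V(y) whenever y' ≤ y + ps. Used in both directions between `z` and
`z'`, with a time `d z'` proportional to their distance, it squeezes V(z') between e^{-qd}V(z) and
e^{qd}V(z). For `n = 0` waiting is not admitted, but the value is affine. -/
theorem continuousOn_stepValue (m : Model) (n : ℕ) :
    ContinuousOn (fun z => (stepValue m n z).toReal) {z | ∀ k, 0 ≤ z k} := by
  cases n with
  | zero =>
    have h : ∀ z ∈ {z : Fin 2 → ℝ | ∀ k, 0 ≤ z k}, (stepValue m 0 z).toReal =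
        ∑ k, m.a k * z k + (stepValue m 0 0).toReal := by
      intro z hz
      rw [stepValue_zero m hz, ENNReal.toReal_add ENNReal.ofReal_ne_top
        (stepValue_ne_top m 0 (z := 0) fun _ => le_rfl), ENNReal.toReal_ofReal]
      exact Finset.sum_nonneg fun k _ => mul_nonneg (m.a_nonneg k) (hz k)
    refine ContinuousOn.congr ?_ h
    fun_prop
  | succ n =>
    intro z hz
    set d : (Fin 2 → ℝ) → ℝ := fun z' => |z' 0 - z 0| / m.p 0 + |z' 1 - z 1| / m.p 1 with hd
    have hp := p_pos m
    have hd0 : ∀ z', 0 ≤ d z' := fun z' =>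
      add_nonneg (div_nonneg (abs_nonneg _) (hp 0).le) (div_nonneg (abs_nonneg _) (hp 1).le)
    have hd1 : ∀ z' k, |z' k - z k| ≤ m.p k * d z' := by
      intro z' k
      have h1 : ∀ i, m.p i * (|z' i - z i| / m.p i) = |z' i - z i| := fun i =>
        mul_div_cancel₀ _ (hp i).ne'
      have h2 : ∀ i, 0 ≤ |z' i - z i| / m.p i := fun i => div_nonneg (abs_nonneg _) (hp i).le
      rw [← h1 k]
      refine mul_le_mul_of_nonneg_left ?_ (hp k).le
      rcases eq_or_eq_other 0 k with rfl | rfl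
      · exact le_add_of_nonneg_right (h2 1)
      · rw [other_zero]
        exact le_add_of_nonneg_left (h2 0)
    set q := m.δ + (m.lam 0 + m.lam 1) with hq
    have key : ∀ y y' : Fin 2 → ℝ, (∀ k, 0 ≤ y k) → (∀ k, 0 ≤ y' k) → ∀ s : ℝ, 0 ≤ s →
        (∀ k, y' k ≤ y k + m.p k * s) →
        Real.exp (-q * s) * (stepValue m (n + 1) y').toReal ≤ (stepValue m (n + 1) y).toReal := by
      intro y y' hy hy' s hs h
      have h1 := exp_mul_stepValue_le m n hy hy' ⟨s, hs⟩ h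
      have h2 := ENNReal.toReal_mono (stepValue_ne_top m _ hy) h1
      rwa [ENNReal.toReal_mul, ENNReal.toReal_ofReal (Real.exp_nonneg _)] at h2
    have hcont : ∀ c : ℝ, Tendsto (fun z' => Real.exp (c * d z') * (stepValue m (n + 1) z).toReal)
        (𝓝[{z | ∀ k, 0 ≤ z k}] z) (𝓝 (stepValue m (n + 1) z).toReal) := by
      intro c
      have h1 : Continuous fun z' => Real.exp (c * d z') * (stepValue m (n + 1) z).toReal := by
        simp only [hd]
        fun_prop
      have h2 := (h1.tendsto z).mono_left (nhdsWithin_le_nhds (s := {z | ∀ k, 0 ≤ z k}))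
      simpa [hd] using h2
    refine tendsto_of_tendsto_of_tendsto_of_le_of_le' (hcont (-q)) (hcont q) ?_ ?_
    · filter_upwards [self_mem_nhdsWithin] with z' hz'
      exact key z' z hz' hz _ (hd0 z') fun k => by linarith [(abs_le.1 (hd1 z' k)).1]
    · filter_upwards [self_mem_nhdsWithin] with z' hz'
      have h1 := key z z' hz hz' _ (hd0 z') fun k => by linarith [(abs_le.1 (hd1 z' k)).2]
      calc _ = Real.exp (q * d z') * (Real.exp (-q * d z') * (stepValue m (n + 1) z').toReal) := by
            rw [← mul_assoc, ← Real.exp_add]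
            simp
        _ ≤ _ := mul_le_mul_of_nonneg_left h1 (Real.exp_nonneg _)

variable {m : Model} {z : Fin 2 → ℝ} {L : Fin 2 → ℝ≥0 → Scenario → ℝ} {ω : Scenario} {n : ℕ}

/-! ### Measurability and approximation of the value functions -/

/-- The value function is controlled on the closed quadrant only; composed with positive parts it is
continuous everywhere. -/
theorem measurable_stepValue_max (m : Model) (n : ℕ) :
    Measurable fun y : Fin 2 → ℝ => stepValue m n fun k => max (y k) 0 := by
  have hnn : ∀ y : Fin 2 → ℝ, ∀ k, 0 ≤ max (y k) 0 := fun y k => le_max_right _ _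
  have h1 : Continuous fun y : Fin 2 → ℝ => (stepValue m n fun k => max (y k) 0).toReal := by
    have h2 : Continuous fun y : Fin 2 → ℝ => fun k => max (y k) 0 := by fun_prop
    rw [← continuousOn_univ] at h2 ⊢
    exact (continuousOn_stepValue m n).comp h2 fun y _ => hnn y
  have h3 := h1.measurable.ennreal_ofReal
  simpa only [ENNReal.ofReal_toReal (stepValue_ne_top m n (hnn _))] using h3

theorem exists_nnrat_le_stepValue_le (m : Model) (n : ℕ) {y : Fin 2 → ℝ} (hy : ∀ k, 0 ≤ y k) {ε : ℝ}
    (hε : 0 < ε) : ∃ r : Fin 2 → ℚ≥0, (∀ k, ((r k : ℚ≥0) : ℝ) ≤ y k) ∧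
      stepValue m n y ≤ stepValue m n (fun k => ((r k : ℚ≥0) : ℝ)) + ENNReal.ofReal ε := by
  obtain ⟨d, hd, h⟩ := Metric.continuousWithinAt_iff.1 (continuousOn_stepValue m n y hy) ε hε
  have h1 : ∀ k, ∃ r : ℚ≥0, (r : ℝ) ≤ y k ∧ y k - d < r := by
    intro k
    rcases (hy k).eq_or_lt with h0 | hpos
    · exact ⟨0, by simpa using hy k, by simpa [← h0] using hd⟩
    · obtain ⟨r, hr, hr'⟩ := exists_rat_btwn (max_lt hpos (sub_lt_self (y k) hd))
      rw [max_lt_iff] at hr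
      have hr0 : 0 ≤ r := by exact_mod_cast hr.1.le
      exact ⟨⟨r, hr0⟩, hr'.le, hr.2⟩
  choose r hr hr' using h1
  refine ⟨r, hr, ?_⟩
  have hrnn : ∀ k, 0 ≤ ((r k : ℚ≥0) : ℝ) := fun k => NNRat.cast_nonneg _
  have h2 := h (x := fun k => ((r k : ℚ≥0) : ℝ)) hrnn (by
    rw [dist_pi_lt_iff hd]
    intro k
    rw [Real.dist_eq, abs_lt]
    constructor <;> linarith [hr k, hr' k])
  rw [Real.dist_eq, abs_lt] at h2
  rw [← ENNReal.ofReal_toReal (stepValue_ne_top m n hy),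
    ← ENNReal.ofReal_toReal (stepValue_ne_top m n hrnn),
    ← ENNReal.ofReal_add ENNReal.toReal_nonneg hε.le]
  exact ENNReal.ofReal_le_ofReal (by linarith [h2.1])

theorem exists_strategy_le (m : Model) (n : ℕ) (hz : ∀ k, 0 ≤ z k) {ε : ℝ≥0∞} (hε : ε ≠ 0) :
    ∃ L, IsAdmissibleStep m n z L ∧ stepValue m n z ≤ strategyValue m z L + ε := by
  rcases eq_or_ne (stepValue m n z) 0 with h0 | h0
  · exact ⟨_, isAdmissibleStep_runStrategy m n hz, by rw [h0]; exact zero_le⟩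
  · have h1 := ENNReal.sub_lt_self (stepValue_ne_top m n hz) h0 hε
    conv_rhs at h1 => rw [stepValue]
    obtain ⟨L, h2⟩ := lt_iSup_iff.1 h1
    obtain ⟨hL, h3⟩ := lt_iSup_iff.1 h2
    exact ⟨L, hL, tsub_le_iff_right.1 h3.le⟩

/-! ### The situation after the first claim -/

/-- Surpluses after a claim `α` of company `k`, before transfers. -/
def hit (y : Fin 2 → ℝ) (k : Fin 2) (α : ℝ) (i : Fin 2) : ℝ := y i - if i = k then α else 0

theorem hit_add (y : Fin 2 → ℝ) (k : Fin 2) (α : ℝ) : hit y k α 0 + hit y k α 1 = y 0 + y 1 - α := by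
  rcases eq_or_eq_other 0 k with rfl | rfl <;> simp [hit, other_zero] <;> ring

/-- The value of the collaboration after a claim `α` of company `k`, if `n` further claims
are admitted. -/
def afterClaim (m : Model) (n : ℕ) (k : Fin 2) (y : Fin 2 → ℝ) (α : ℝ) : ℝ≥0∞ :=
  if hit y k α 0 + hit y k α 1 < 0 then
    ∑ j, ENNReal.ofReal (m.a j) * valueAlone m j (hit y k α j)
  else stepValue m n (settle (hit y k α))

theorem measurable_hit (k : Fin 2) :
    Measurable fun x : (Fin 2 → ℝ) × ℝ => hit x.1 k x.2 := by
  refine measurable_pi_lambda _ fun i => ?_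
  have h1 : Measurable fun x : (Fin 2 → ℝ) × ℝ => x.1 i :=
    (measurable_pi_apply i).comp measurable_fst
  simp only [hit]
  split_ifs
  · exact h1.sub measurable_snd
  · exact h1.sub measurable_const

theorem measurableSet_hit_neg (k : Fin 2) :
    MeasurableSet {x : (Fin 2 → ℝ) × ℝ | hit x.1 k x.2 0 + hit x.1 k x.2 1 < 0} :=
  measurableSet_lt (((measurable_pi_apply 0).comp (measurable_hit k)).add
    ((measurable_pi_apply 1).comp (measurable_hit k))) measurable_const

theorem measurable_valueAlone_hit (m : Model) (k : Fin 2) : Measurable fun x : (Fin 2 → ℝ) × ℝ =>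
    ∑ j, ENNReal.ofReal (m.a j) * valueAlone m j (hit x.1 k x.2 j) :=
  Finset.measurable_sum _ fun j _ => ((valueAlone_mono m j).measurable.comp
    ((measurable_pi_apply j).comp (measurable_hit k))).const_mul _

theorem measurable_afterClaim (m : Model) (n : ℕ) (k : Fin 2) :
    Measurable fun x : (Fin 2 → ℝ) × ℝ => afterClaim m n k x.1 x.2 := by
  have h : Measurable fun x : (Fin 2 → ℝ) × ℝ =>
      if hit x.1 k x.2 0 + hit x.1 k x.2 1 < 0 then
        ∑ j, ENNReal.ofReal (m.a j) * valueAlone m j (hit x.1 k x.2 j)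
      else stepValue m n fun i => max (settle (hit x.1 k x.2) i) 0 :=
    Measurable.ite (measurableSet_hit_neg k) (measurable_valueAlone_hit m k)
      ((measurable_stepValue_max m n).comp (measurable_settle.comp (measurable_hit k)))
  convert h using 2 with x
  rw [afterClaim]
  refine ite_congr rfl (fun _ => rfl) fun hnn => ?_
  congr 1
  funext i
  exact (max_eq_left (settle_nonneg (not_lt.1 hnn) i)).symm

/-! ### The value of a dividend plan -/

/-- Surpluses under the plan `D` as long as there is no claim. -/
def planPath (m : Model) (z : Fin 2 → ℝ) (D : Fin 2 → ℝ≥0 → ℝ) (w : ℝ) (i : Fin 2) : ℝ :=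
  z i + m.p i * w - D i w.toNNReal

/-- Discounted weighted dividends of the plan `D` up to time `w`. -/
def planDividends (m : Model) (D : Fin 2 → ℝ≥0 → ℝ) (w : ℝ) : ℝ≥0∞ :=
  ∑ j, ENNReal.ofReal (m.a j) * discountedDividends m.δ (D j) (ENNReal.ofReal w)

/-- The value of following the plan `D` until the first claim, if `n` further claims
are admitted. -/
def planValue (m : Model) (n : ℕ) (z : Fin 2 → ℝ) (D : Fin 2 → ℝ≥0 → ℝ) : ℝ≥0∞ :=
  ∑ k, ∫⁻ w in Ioi (0 : ℝ), ENNReal.ofReal (m.lam k * Real.exp (-(m.lam 0 + m.lam 1) * w)) *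
    ∫⁻ α, (planDividends m D w +
      ENNReal.ofReal (Real.exp (-m.δ * w)) * afterClaim m n k (planPath m z D w) α) ∂(m.F k)

theorem measurable_planDividends (m : Model) (D : Fin 2 → ℝ≥0 → ℝ) :
    Measurable (planDividends m D) := by
  refine Finset.measurable_sum _ fun j _ => (Monotone.measurable fun w w' h => ?_).const_mul _
  exact lintegral_mono_set fun s hs => ⟨hs.1, hs.2.trans_le (ENNReal.ofReal_le_ofReal h)⟩

variable {D : Fin 2 → ℝ≥0 → ℝ}

theorem IsPlan.measurable (h : IsPlan m z D) (i : Fin 2) : Measurable fun w : ℝ => D i w.toNNReal :=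
  Monotone.measurable fun _ _ hw => h.mono i (Real.toNNReal_mono hw)

theorem IsPlan.measurable_planPath (h : IsPlan m z D) : Measurable (planPath m z D) :=
  measurable_pi_lambda _ fun i => (Measurable.sub (by fun_prop) (h.measurable i))

theorem IsPlan.planPath_nonneg (h : IsPlan m z D) {w : ℝ} (hw : 0 ≤ w) (i : Fin 2) :
    0 ≤ planPath m z D w i := by
  have := h.le i w.toNNReal
  rw [Real.coe_toNNReal _ hw] at this
  exact sub_nonneg.2 this

namespace FirstClaim

variable {k : Fin 2} {w α : ℝ} {q : Scenario}

theorem claimTime_eq (h : FirstClaim k w α q ω) : claimTime 1 ω = w.toNNReal := by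
  rw [← h.coe_claimTime, Real.toNNReal_coe]

theorem freeSurplus_sub_eq (h : FirstClaim k w α q ω) (m : Model) (z : Fin 2 → ℝ)
    (D : Fin 2 → ℝ≥0 → ℝ) : (fun i => freeSurplus m z i (claimTime 1 ω) ω - D i (claimTime 1 ω)) =
      hit (planPath m z D w) k α := by
  funext i
  rw [h.freeSurplus_eq, h.claimTime_eq, hit, planPath]
  ring

end FirstClaim

/-- Countably many strategies suffice, one for each non-negative rational point: by continuity a
suitable rational point below `y` costs at most `ε`, and the first suitable index depends measurably
on `y`. The second `ε` is for the suboptimality of `L i`. The function `h i` is a measurable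
minorant with the same integral as the payoff. -/
theorem exists_optimal_selection (m : Model) (n : ℕ) {ε : ℝ≥0} (hε : 0 < ε) :
    ∃ (g : ℕ → Fin 2 → ℝ) (L : ℕ → Fin 2 → ℝ≥0 → Scenario → ℝ) (sel : (Fin 2 → ℝ) → ℕ)
      (h : ℕ → Scenario → ℝ≥0∞), (∀ i k, 0 ≤ g i k) ∧ (∀ i, IsAdmissibleStep m n (g i) (L i)) ∧
        Measurable sel ∧ (∀ i, Measurable (h i)) ∧ (∀ i ω, h i ω ≤ payoff m (g i) (L i) ω) ∧
          ∀ y, (∀ k, 0 ≤ y k) → (∀ k, g (sel y) k ≤ y k) ∧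
            stepValue m n y ≤ ∫⁻ ω, h (sel y) ω ∂(law m) + 2 * ε := by
  classical
  obtain ⟨e, he⟩ := exists_surjective_nat (Fin 2 → ℚ≥0)
  set g : ℕ → Fin 2 → ℝ := fun i k => ((e i k : ℚ≥0) : ℝ) with hg
  have hg0 : ∀ i k, 0 ≤ g i k := fun i k => NNRat.cast_nonneg _
  have h1 := fun i => exists_strategy_le m n (hg0 i) (ε := (ε : ℝ≥0∞)) (by simpa using hε.ne')
  choose L hL hL' using h1
  have h2 := fun i => exists_measurable_le_lintegral_eq (μ := law m) (payoff m (g i) (L i))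
  choose h hhm hhle hheq using h2
  set P : (Fin 2 → ℝ) → ℕ → Prop := fun y i => (∀ k, g i k ≤ max (y k) 0) ∧
    (stepValue m n fun k => max (y k) 0) ≤ stepValue m n (g i) + ε with hP
  have hex : ∀ y, ∃ i, P y i := by
    intro y
    obtain ⟨r, hr, hr'⟩ := exists_nnrat_le_stepValue_le m n (y := fun k => max (y k) 0)
      (fun k => le_max_right _ _) (NNReal.coe_pos.2 hε)
    obtain ⟨i, rfl⟩ := he r
    exact ⟨i, hr, by simpa using hr'⟩
  have hmeas : ∀ i, MeasurableSet {y | P y i} := by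
    intro i
    refine MeasurableSet.inter ?_ (measurableSet_le (measurable_stepValue_max m n) measurable_const)
    have h3 : {y : Fin 2 → ℝ | ∀ k, g i k ≤ max (y k) 0} = ⋂ k, {y | g i k ≤ max (y k) 0} := by
      ext
      simp
    refine MeasurableSet.congr (MeasurableSet.iInter fun k => ?_) h3.symm
    exact measurableSet_le measurable_const
      ((measurable_pi_apply k).max measurable_const)
  obtain ⟨sel, hsel, hfind⟩ : ∃ sel : (Fin 2 → ℝ) → ℕ, Measurable sel ∧ ∀ y, P y (sel y) :=
    ⟨fun y => Nat.find (hex y), measurable_find hex hmeas, fun y => Nat.find_spec (hex y)⟩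
  refine ⟨g, L, sel, h, hg0, hL, hsel, hhm,
    fun i ω => hhle i ω, fun y hy => ?_⟩
  have h4 := hfind y
  have h5 : (fun k => max (y k) 0) = y := funext fun k => max_eq_left (hy k)
  simp only [hP, h5] at h4
  refine ⟨fun k => (h4.1 k).trans_eq (max_eq_left (hy k)), h4.2.trans ?_⟩
  refine (add_le_add_left (hL' _) _).trans_eq ?_
  rw [strategyValue_eq, hheq, two_mul, add_assoc]

theorem lintegral_first_rate (m : Model) :
    ∑ k, ∫⁻ w in Ioi (0 : ℝ), ENNReal.ofReal (m.lam k * Real.exp (-(m.lam 0 + m.lam 1) * w)) = 1 := by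
  have h := lintegral_exp_Ioi (add_pos (m.lam_pos 0) (m.lam_pos 1)) 0
  rw [mul_zero, Real.exp_zero, ENNReal.ofReal_one] at h
  rw [← h, Fin.sum_univ_two, ← lintegral_add_left (by fun_prop)]
  refine lintegral_congr fun w => ?_
  rw [← ENNReal.ofReal_add (mul_nonneg (m.lam_pos 0).le (Real.exp_nonneg _))
    (mul_nonneg (m.lam_pos 1).le (Real.exp_nonneg _)), add_mul]

/-- The payoff after a claim `α` of company `k`, if the payoffs after claims which do not cause ruin are
given by one of the functions `h i`. -/
def selectedPayoff (m : Model) (k : Fin 2) (sel : (Fin 2 → ℝ) → ℕ) (h : ℕ → Scenario → ℝ≥0∞)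
    (y : Fin 2 → ℝ) (α : ℝ) (q : Scenario) : ℝ≥0∞ :=
  if hit y k α 0 + hit y k α 1 < 0 then
    ∑ j, ENNReal.ofReal (m.a j) * valueAlone m j (hit y k α j)
  else h (sel (settle (hit y k α))) q

theorem measurable_selectedPayoff (m : Model) (k : Fin 2) {sel : (Fin 2 → ℝ) → ℕ}
    (hsel : Measurable sel) {h : ℕ → Scenario → ℝ≥0∞} (hh : ∀ i, Measurable (h i)) :
    Measurable fun x : ((Fin 2 → ℝ) × ℝ) × Scenario => selectedPayoff m k sel h x.1.1 x.1.2 x.2 := by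
  have h1 : Measurable fun x : ℕ × Scenario => h x.1 x.2 :=
    measurable_from_prod_countable_right hh
  have h2 : Measurable fun x : ((Fin 2 → ℝ) × ℝ) × Scenario =>
      h (sel (settle (hit x.1.1 k x.1.2))) x.2 :=
    h1.comp ((hsel.comp (measurable_settle.comp ((measurable_hit k).comp measurable_fst))).prodMk
      measurable_snd)
  exact Measurable.ite (measurable_fst (measurableSet_hit_neg k))
    ((measurable_valueAlone_hit m k).comp measurable_fst) h2

/-- Follow `D` up to the first claim and then the selected nearly optimal strategy: this is
admissible for `n + 1` claims and loses at most `ε`. With `s = ∞` the switch always occurs at a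
claim. -/
theorem IsPlan.planValue_le (hD : IsPlan m z D) : planValue m n z D ≤ stepValue m (n + 1) z := by
  refine ENNReal.le_of_forall_pos_le_add fun ε hε _ => ?_
  obtain ⟨g, L, sel, h, hg0, hL, hsel, hhm, hhle, hy⟩ := exists_optimal_selection m n (half_pos hε)
  let S : SwitchPlan m n z :=
    { D := D
      s := ∞
      g := fun i => Nat.casesOn i 0 g
      L := fun i => Nat.casesOn i (runStrategy m 0) L
      sel := sel
      isPlan := hD
      measurable_sel := hsel
      sel_le := fun y hy' => (hy y hy').1
      wait_le := fun t ht => absurd ht ENNReal.coe_ne_top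
      g_nonneg := fun i => by
        cases i with
        | zero => exact fun _ => le_rfl
        | succ i => exact hg0 i
      isAdmissibleStep_zero := isAdmissibleStep_runStrategy m (n + 1) fun _ => le_rfl
      isAdmissibleStep_succ := hL }
  set G : Fin 2 → (ℝ × ℝ) × Scenario → ℝ≥0∞ := fun k x => planDividends m D x.1.1 +
    ENNReal.ofReal (Real.exp (-m.δ * x.1.1)) *
      selectedPayoff m k sel h (planPath m z D x.1.1) x.1.2 x.2 with hG
  have hpath : Measurable fun x : (ℝ × ℝ) × Scenario => ((planPath m z D x.1.1, x.1.2), x.2) :=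
    ((hD.measurable_planPath.comp (measurable_fst.comp measurable_fst)).prodMk
      (measurable_snd.comp measurable_fst)).prodMk measurable_snd
  have hGm : ∀ k, Measurable (G k) := by
    intro k
    have h1 := (measurable_selectedPayoff m k hsel hhm).comp hpath
    refine Measurable.add ((measurable_planDividends m D).comp (measurable_fst.comp measurable_fst))
      (Measurable.mul (by fun_prop) h1)
  have hle : ∀ k w α q ω, FirstClaim k w α q ω → G k ((w, α), q) ≤ payoff m z S.strategy ω := by
    intro k w α q ω hω
    have h1 : switchTime S.s ω = claimTime 1 ω := switchTime_top ω
    have h2 : S.switchSurplus ω = hit (planPath m z D w) k α := by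
      rw [← hω.freeSurplus_sub_eq m z D, ← h1]
      rfl
    have h3 : S.index ω = sel (settle (hit (planPath m z D w) k α)) + 1 := by
      rw [SwitchPlan.index, h1, totalCount_claimTime, if_neg one_ne_zero, h2]
    have h4 : ((claimTime 1 ω : ℝ≥0) : ℝ≥0∞) = ENNReal.ofReal w := by
      rw [hω.claimTime_eq]
      rfl
    rcases lt_or_ge (S.switchSurplus ω 0 + S.switchSurplus ω 1) 0 with hneg | hnn
    · have h5 := S.payoff_of_neg hneg
      rw [h1, h4, hω.coe_claimTime] at h5
      rw [h5]
      simp only [hG, selectedPayoff]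
      rw [← h2, if_pos hneg]
      exact le_rfl
    · have h5 := S.le_payoff_of_nonneg hnn
      rw [h1, h4, hω.coe_claimTime, hω.shift_eq, h3] at h5
      refine le_trans ?_ h5
      simp only [hG, selectedPayoff]
      rw [← h2, if_neg (not_lt.2 hnn)]
      refine add_le_add le_rfl (mul_le_mul_right ?_ _)
      exact hhle _ q
  have h1 : planValue m n z D ≤ (∑ k, ∫⁻ w in Ioi (0 : ℝ),
      ENNReal.ofReal (m.lam k * Real.exp (-(m.lam 0 + m.lam 1) * w)) *
        ∫⁻ α, ∫⁻ q, G k ((w, α), q) ∂(law m) ∂(m.F k)) + ε := by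
    have h2 : ∀ k w, 0 < w → ∀ α, planDividends m D w +
        ENNReal.ofReal (Real.exp (-m.δ * w)) * afterClaim m n k (planPath m z D w) α ≤
          ∫⁻ q, G k ((w, α), q) ∂(law m) + ε := by
      intro k w hw α
      have h3 : Measurable fun q => selectedPayoff m k sel h (planPath m z D w) α q :=
        (measurable_selectedPayoff m k hsel hhm).comp
          ((measurable_const (a := (planPath m z D w, α))).prodMk measurable_id)
      simp only [hG]
      rw [lintegral_add_left measurable_const, lintegral_const_mul _ h3, lintegral_const,
        measure_univ, mul_one, add_assoc]
      refine add_le_add le_rfl ?_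
      have h4 : afterClaim m n k (planPath m z D w) α ≤ 
          ∫⁻ q, selectedPayoff m k sel h (planPath m z D w) α q ∂(law m) + ε := by
        simp only [afterClaim, selectedPayoff]
        split_ifs with hneg
        · rw [lintegral_const, measure_univ, mul_one]
          exact le_self_add
        · refine (hy _ (settle_nonneg (not_lt.1 hneg))).2.trans_eq ?_
          congr 1
          rw [← ENNReal.coe_ofNat, ← ENNReal.coe_mul, mul_div_cancel₀ _ two_ne_zero]
      refine (mul_le_mul_right h4 _).trans ?_
      rw [mul_add]
      refine add_le_add le_rfl (mul_le_of_le_one_left zero_le ?_)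
      rw [ENNReal.ofReal_le_one, Real.exp_le_one_iff]
      nlinarith [m.δ_pos]
    calc planValue m n z D ≤ ∑ k, ∫⁻ w in Ioi (0 : ℝ),
        ENNReal.ofReal (m.lam k * Real.exp (-(m.lam 0 + m.lam 1) * w)) *
          (∫⁻ α, ∫⁻ q, G k ((w, α), q) ∂(law m) ∂(m.F k) + ε) := by
          refine Finset.sum_le_sum fun k _ => setLIntegral_mono' measurableSet_Ioi fun w hw => ?_
          refine mul_le_mul_right ((lintegral_mono (h2 k w hw)).trans_eq ?_) _
          rw [lintegral_add_right _ measurable_const, lintegral_const, measure_univ, mul_one]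
      _ = _ := by
          have h3 : (ε : ℝ≥0∞) = ∑ k, (∫⁻ w in Ioi (0 : ℝ),
              ENNReal.ofReal (m.lam k * Real.exp (-(m.lam 0 + m.lam 1) * w))) * ε := by
            rw [← Finset.sum_mul, lintegral_first_rate, one_mul]
          conv_rhs => rw [h3]
          rw [← Finset.sum_add_distrib]
          refine Finset.sum_congr rfl fun k _ => ?_
          rw [← lintegral_mul_const _ (by fun_prop),
            ← lintegral_add_right _ (by fun_prop)]
          simp only [mul_add]
  refine h1.trans (add_le_add ?_ le_rfl)
  refine (le_lintegral_law m hGm hle).trans ?_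
  exact le_iSup₂ (f := fun L (_ : IsAdmissibleStep m (n + 1) z L) => strategyValue m z L)
    S.strategy S.isAdmissibleStep

/-! ### Curve strategies as plans -/

theorem IsPlan.discountedDividends_min (hD : IsPlan m z D) (k : Fin 2) (T : ℝ≥0) :
    discountedDividends m.δ (fun t => D k (min t T)) T = discountedDividends m.δ (D k) T := by
  have hmin : Continuous fun t : ℝ≥0 => min t T := by fun_prop
  have hmono : Monotone fun t : ℝ≥0 => min t T := fun s t h => min_le_min h le_rfl
  rw [discountedDividends_eq (ℓ := fun t => D k (min t T)) m.δ_pos ((hD.mono k).comp hmono)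
    (by simp [hD.zero]) (fun t => (hD.left_continuous k _).comp hmin.continuousWithinAt fun s hs => hmono hs),
    discountedDividends_eq m.δ_pos (hD.mono k) (hD.zero k) (hD.left_continuous k)]
  refine lintegral_congr fun r => ?_
  rw [min_eq_left (ENNReal.coe_le_coe.1 (stopAt_le _ r))]

/-- After the first claim the stopped process pays nothing, so the joint surplus cannot decrease
before the next claim. This yields the strict inequality by which `Curve.oneStepValue` recognizes
survival. -/
theorem claimTime_one_lt_ruinTime_of_stopped (hD : IsPlan m z D)
    (hL : ∀ k t, L k t ω = D k (min t (claimTime 1 ω)))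
    (h : 0 ≤ surplus m z L 0 (claimTime 1 ω) ω + surplus m z L 1 (claimTime 1 ω) ω) :
    (claimTime 1 ω : ℝ≥0∞) < ruinTime m z L ω := by
  obtain ⟨t', ht', hcount⟩ := exists_gt_claimCount_eq (claimTime 1 ω) ω
  refine lt_of_lt_of_le (ENNReal.coe_lt_coe.2 ht') (le_iInf₂ fun t ht => ENNReal.coe_le_coe.2 ?_)
  by_contra hlt
  refine absurd ht (not_lt.2 ?_)
  rcases lt_or_ge t (claimTime 1 ω) with h1 | h1
  · have h2 : ∀ k, 0 ≤ surplus m z L k t ω := by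
      intro k
      rw [surplus_of_lt_claimTime h1, hL, min_eq_left h1.le]
      linarith [hD.le k t]
    exact add_nonneg (h2 0) (h2 1)
  · have h2 : ∀ k, freeSurplus m z k (claimTime 1 ω) ω - L k (claimTime 1 ω) ω ≤
        freeSurplus m z k t ω - L k t ω := by
      intro k
      have h3 : claimCount k t ω = claimCount k (claimTime 1 ω) ω :=
        le_antisymm ((claimCount_mono k ω (not_le.1 hlt).le).trans_eq (hcount k))
          (claimCount_mono k ω h1)
      have h4 : m.p k * (claimTime 1 ω : ℝ) ≤ m.p k * t :=
        mul_le_mul_of_nonneg_left (by exact_mod_cast h1) (p_pos m k).le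
      rw [hL, hL, min_self, min_eq_right h1]
      simp only [freeSurplus, aggregateClaims, h3]
      linarith
    rw [surplus_add] at h ⊢
    linarith [h2 0, h2 1]

/-- Scenario by scenario, the payoff in the curve value is at most `planDividends` plus the
discounted `afterClaim`, which is a measurable function of the first claim. This direction is
enough, since `IsPlan.planValue_le` bounds plans from above. -/
theorem Curve.oneStepValue_le (c : Curve m) (hD : IsPlan m z (c.dividends z)) :
    c.oneStepValue (stepValue m n) z ≤ planValue m n z (c.dividends z) := by
  set D := c.dividends z with hDdef
  set G : Fin 2 → (ℝ × ℝ) × Scenario → ℝ≥0∞ := fun k x => planDividends m D x.1.1 +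
    ENNReal.ofReal (Real.exp (-m.δ * x.1.1)) * afterClaim m n k (planPath m z D x.1.1) x.1.2 with hG
  have hpath : Measurable fun x : (ℝ × ℝ) × Scenario => (planPath m z D x.1.1, x.1.2) :=
    (hD.measurable_planPath.comp (measurable_fst.comp measurable_fst)).prodMk
      (measurable_snd.comp measurable_fst)
  have hGm : ∀ k, Measurable (G k) := fun k =>
    Measurable.add ((measurable_planDividends m D).comp (measurable_fst.comp measurable_fst))
      (Measurable.mul (by fun_prop) ((measurable_afterClaim m n k).comp hpath))
  refine (lintegral_law_le m hGm fun k w α q ω hω => ?_).trans_eq ?_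
  · have h4 : ((claimTime 1 ω : ℝ≥0) : ℝ≥0∞) = ENNReal.ofReal w := by
      rw [hω.claimTime_eq]
      rfl
    have h1 : ∀ k t, c.firstStep z k t ω = D k (min t (claimTime 1 ω)) := fun _ _ => rfl
    have h2 : (fun i => surplus m z (c.firstStep z) i (claimTime 1 ω) ω) =
        settle (hit (planPath m z D w) k α) := by
      funext i
      rw [surplus_claimTime_one, ← hω.freeSurplus_sub_eq m z D]
      simp only [h1, min_self]
    have h2' := fun i => congrFun h2 i
    have hdiv : ∀ k, discountedDividends m.δ (fun t => c.firstStep z k t ω) (claimTime 1 ω) =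
        discountedDividends m.δ (D k) (ENNReal.ofReal w) := by
      intro k
      simp only [h1]
      rw [hD.discountedDividends_min, h4]
    simp only [hG, hdiv]
    rw [add_assoc, hω.coe_claimTime]
    refine add_le_add le_rfl ?_
    rw [afterClaim]
    have hsum : surplus m z (c.firstStep z) 0 (claimTime 1 ω) ω +
        surplus m z (c.firstStep z) 1 (claimTime 1 ω) ω =
          hit (planPath m z D w) k α 0 + hit (planPath m z D w) k α 1 := by
      rw [h2', h2', settle_sum]
    rcases lt_or_ge (hit (planPath m z D w) k α 0 + hit (planPath m z D w) k α 1) 0 with h7 | h7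
    · rw [if_pos h7, if_neg (not_lt.2 (ruinTime_le (hsum ▸ h7))), zero_add]
      split_ifs
      · rw [terminalValue, hω.coe_claimTime]
        simp only [h2', settle_of_neg h7]
        exact le_rfl
      · exact zero_le
    · have h8 := claimTime_one_lt_ruinTime_of_stopped hD (fun k t => h1 k t) (hsum ▸ h7)
      rw [if_neg (not_lt.2 h7), if_pos h8, if_neg h8.ne, add_zero, h2]
  · refine Finset.sum_congr rfl fun k _ => ?_
    simp only [hG, lintegral_const, measure_univ, mul_one]

variable {m : Model} {z : Fin 2 → ℝ} {n : ℕ} {D : Fin 2 → ℝ≥0 → ℝ}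

/-! ### The expected value after the first claim -/

theorem afterClaim_of_le {k : Fin 2} {y : Fin 2 → ℝ} {α : ℝ} (h : α ≤ y 0 + y 1) :
    afterClaim m n k y α = stepValue m n (settle (hit y k α)) := by
  rw [afterClaim, if_neg]
  rw [hit_add]
  linarith

theorem afterClaim_of_lt {k : Fin 2} {y : Fin 2 → ℝ} (hy : ∀ i, 0 ≤ y i) {α : ℝ}
    (h : y 0 + y 1 < α) : afterClaim m n k y α =
      ENNReal.ofReal (m.a (other k)) * valueAlone m (other k) (y (other k)) := by
  have h1 : y 0 + y 1 = y k + y (other k) := by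
    rw [← sum_fin_two_other y k, Fin.sum_univ_two]
  have h2 : hit y k α k < 0 := by
    simp only [hit, if_true]
    linarith [hy (other k)]
  have h3 : hit y k α (other k) = y (other k) := by simp [hit, other_ne]
  rw [afterClaim, if_pos (by rw [hit_add]; linarith), sum_fin_two_other _ k, valueAlone_of_neg h2,
    mul_zero, zero_add, h3]

theorem settle_hit_of_le {k : Fin 2} {y : Fin 2 → ℝ} (hy : ∀ i, 0 ≤ y i) {α : ℝ} (h : α ≤ y k) :
    settle (hit y k α) = hit y k α := by
  refine settle_of_nonneg fun i => ?_
  simp only [hit]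
  split_ifs with hi
  · subst hi
    linarith
  · linarith [hy i]

theorem settle_hit_of_lt {k : Fin 2} {y : Fin 2 → ℝ} (hy : 0 ≤ y (other k)) {α : ℝ} (h : y k < α)
    (h' : α ≤ y 0 + y 1) (i : Fin 2) :
    settle (hit y k α) i = if i = k then 0 else y 0 + y 1 - α := by
  have h1 : y 0 + y 1 = y k + y (other k) := by
    rw [← sum_fin_two_other y k, Fin.sum_univ_two]
  have h2 : hit y k α k = y k - α := by simp [hit]
  have h3 : hit y k α (other k) = y (other k) := by simp [hit, other_ne]
  have h4 : 0 ≤ hit y k α 0 + hit y k α 1 := by rw [hit_add]; linarith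
  have h5 : hit y k α k < 0 := by linarith
  have h6 : ¬ hit y k α (other k) < 0 := by rw [h3]; exact not_lt.2 hy
  rcases eq_or_eq_other k i with rfl | rfl
  · rw [settle, if_pos ⟨h5, h4⟩, if_neg (by tauto), abs_of_neg h5, if_pos rfl]
    ring
  · rw [settle, other_other, if_neg (by tauto), if_pos ⟨h5, h4⟩, abs_of_neg h5, h2, h3,
      if_neg (other_ne k)]
    linarith

theorem afterClaim_le {k : Fin 2} {y : Fin 2 → ℝ} {α : ℝ} (hα : 0 ≤ α) (h : α ≤ y 0 + y 1) :
    afterClaim m n k y α ≤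
      ENNReal.ofReal (4 * (y 0 + y 1) + 10 * (m.p 0 + m.p 1) / m.δ) := by
  rw [afterClaim_of_le h]
  refine (stepValue_le m n (settle_nonneg (by rw [hit_add]; linarith))).trans
    (ENNReal.ofReal_le_ofReal ?_)
  rw [settle_sum, hit_add]
  linarith

theorem setLIntegral_afterClaim {k : Fin 2} {y : Fin 2 → ℝ} {s : Set ℝ} (hs : MeasurableSet s)
    (hs' : s ⊆ Ioc 0 (y 0 + y 1)) :
    ∫⁻ α in s, afterClaim m n k y α ∂(m.F k) =
      ENNReal.ofReal (∫ α in s, (stepValue m n (settle (hit y k α))).toReal ∂(m.F k)) := by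
  have hmeas : Measurable fun α => afterClaim m n k y α :=
    (measurable_afterClaim m n k).comp (measurable_const.prodMk measurable_id)
  have h1 : ∀ α ∈ s, afterClaim m n k y α ≤
      ENNReal.ofReal (4 * (y 0 + y 1) + 10 * (m.p 0 + m.p 1) / m.δ) := fun α hα =>
    afterClaim_le (hs' hα).1.le (hs' hα).2
  have h2 : ∫⁻ α in s, afterClaim m n k y α ∂(m.F k) ≠ ∞ := by
    refine ne_top_of_le_ne_top ?_ (setLIntegral_mono' hs h1)
    rw [lintegral_const]
    exact ENNReal.mul_ne_top ENNReal.ofReal_ne_top (measure_ne_top _ _)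
  have h3 : ∫ α in s, (stepValue m n (settle (hit y k α))).toReal ∂(m.F k) =
      ∫ α in s, (afterClaim m n k y α).toReal ∂(m.F k) :=
    setIntegral_congr_fun hs fun α hα => by rw [afterClaim_of_le (hs' hα).2]
  rw [h3, integral_toReal hmeas.aemeasurable, ENNReal.ofReal_toReal h2]
  filter_upwards [ae_restrict_mem hs] with α hα
  exact (h1 α hα).trans_lt ENNReal.ofReal_lt_top

/-- The contribution of claims of company `k` to `H`. -/
def claimValue (m : Model) (n : ℕ) (k : Fin 2) (y : Fin 2 → ℝ) : ℝ :=
  (∫ α in Ioc 0 (y k), (stepValue m n (settle (hit y k α))).toReal ∂(m.F k)) +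
    (∫ α in Ioc (y k) (y 0 + y 1), (stepValue m n (settle (hit y k α))).toReal ∂(m.F k)) +
    m.a (other k) * (valueAlone m (other k) (y (other k))).toReal * (1 - cdf (m.F k) (y 0 + y 1))

theorem claimValue_nonneg (m : Model) (n : ℕ) (k : Fin 2) (y : Fin 2 → ℝ) :
    0 ≤ claimValue m n k y := by
  have h1 : 0 ≤ 1 - cdf (m.F k) (y 0 + y 1) := sub_nonneg.2 (cdf_le_one _ _)
  have h2 := m.a_nonneg (other k)
  exact add_nonneg (add_nonneg (integral_nonneg fun _ => ENNReal.toReal_nonneg)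
    (integral_nonneg fun _ => ENNReal.toReal_nonneg))
    (mul_nonneg (mul_nonneg h2 ENNReal.toReal_nonneg) h1)

/-- The claim is either paid by the company itself, or covered with the help of the other, or it
exceeds the joint surplus; the three ranges give the three terms. In the last case only the other
company keeps a non-negative surplus. -/
theorem lintegral_afterClaim (m : Model) (n : ℕ) (k : Fin 2) {y : Fin 2 → ℝ} (hy : ∀ i, 0 ≤ y i) :
    ∫⁻ α, afterClaim m n k y α ∂(m.F k) = ENNReal.ofReal (claimValue m n k y) := by
  have hk : y k ≤ y 0 + y 1 := by
    have h1 : y 0 + y 1 = y k + y (other k) := by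
      rw [← sum_fin_two_other y k, Fin.sum_univ_two]
    linarith [hy (other k)]
  have h0 : ∫⁻ α, afterClaim m n k y α ∂(m.F k) = ∫⁻ α in Ioi 0, afterClaim m n k y α ∂(m.F k) := by
    rw [Measure.restrict_eq_self_of_ae_mem]
    filter_upwards [measure_eq_zero_iff_ae_notMem.1 (m.F_pos k)] with α hα
    exact not_le.1 (show ¬ α ≤ 0 from hα)
  have hsplit : (Ioi 0 : Set ℝ) = (Ioc 0 (y k) ∪ Ioc (y k) (y 0 + y 1)) ∪ Ioi (y 0 + y 1) := by
    rw [Ioc_union_Ioc_eq_Ioc (hy k) hk, Ioc_union_Ioi_eq_Ioi ((hy k).trans hk)]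
  have hlast : ∫⁻ α in Ioi (y 0 + y 1), afterClaim m n k y α ∂(m.F k) =
      ENNReal.ofReal (m.a (other k) * (valueAlone m (other k) (y (other k))).toReal *
        (1 - cdf (m.F k) (y 0 + y 1))) := by
    have h1 : (m.F k) (Ioi (y 0 + y 1)) = ENNReal.ofReal (1 - cdf (m.F k) (y 0 + y 1)) := by
      rw [← compl_Iic, prob_compl_eq_one_sub measurableSet_Iic, ← ofReal_cdf,
        ENNReal.ofReal_sub _ (cdf_nonneg _ _), ENNReal.ofReal_one]
    have h2 : valueAlone m (other k) (y (other k)) ≠ ∞ :=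
      ne_top_of_le_ne_top ENNReal.ofReal_ne_top (valueAlone_le m _ (hy _))
    rw [setLIntegral_congr_fun measurableSet_Ioi fun α hα => afterClaim_of_lt hy hα,
      setLIntegral_const, h1, ENNReal.ofReal_mul (mul_nonneg (m.a_nonneg _) ENNReal.toReal_nonneg),
      ENNReal.ofReal_mul (m.a_nonneg _), ENNReal.ofReal_toReal h2]
  have hI : ∀ s : Set ℝ, 0 ≤ ∫ α in s, (stepValue m n (settle (hit y k α))).toReal ∂(m.F k) :=
    fun s => integral_nonneg fun _ => ENNReal.toReal_nonneg
  rw [h0, hsplit, lintegral_union measurableSet_Ioi, lintegral_union measurableSet_Ioc, hlast,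
    setLIntegral_afterClaim measurableSet_Ioc (Ioc_subset_Ioc_right hk),
    setLIntegral_afterClaim measurableSet_Ioc (Ioc_subset_Ioc_left (hy k)),
    ← ENNReal.ofReal_add (hI _) (hI _), ← ENNReal.ofReal_add (add_nonneg (hI _) (hI _))]
  · rfl
  · exact mul_nonneg (mul_nonneg (m.a_nonneg _) ENNReal.toReal_nonneg)
      (sub_nonneg.2 (cdf_le_one _ _))
  · exact (Ioc_disjoint_Ioc_of_le le_rfl)
  · rw [Ioc_union_Ioc_eq_Ioc (hy k) hk]
    exact Ioc_disjoint_Ioi le_rfl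

theorem H_eq (m : Model) (n : ℕ) {y : Fin 2 → ℝ} (hy : ∀ i, 0 ≤ y i) :
    H m n (y 0) (y 1) = ∑ k, m.lam k * claimValue m n k y := by
  have h1 : ∀ k, ∀ α ∈ Ioc 0 (y k), settle (hit y k α) = hit y k α := fun k α hα =>
    settle_hit_of_le hy hα.2
  have h2 : ∀ k, ∀ α ∈ Ioc (y k) (y 0 + y 1), settle (hit y k α) =
      fun i => if i = k then 0 else y 0 + y 1 - α := fun k α hα =>
    funext fun i => settle_hit_of_lt (hy _) hα.1 hα.2 i
  have e1 : ∫ α in Ioc 0 (y 0), (stepValue m n (settle (hit y 0 α))).toReal ∂(m.F 0) =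
      ∫ α in Ioc 0 (y 0), (stepValue m n ![y 0 - α, y 1]).toReal ∂(m.F 0) := by
    refine setIntegral_congr_fun measurableSet_Ioc fun α hα => ?_
    rw [h1 0 α hα]
    congr 2
    funext i
    fin_cases i <;> simp [hit]
  have e2 : ∫ α in Ioc 0 (y 1), (stepValue m n (settle (hit y 1 α))).toReal ∂(m.F 1) =
      ∫ α in Ioc 0 (y 1), (stepValue m n ![y 0, y 1 - α]).toReal ∂(m.F 1) := by
    refine setIntegral_congr_fun measurableSet_Ioc fun α hα => ?_
    rw [h1 1 α hα]
    congr 2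
    funext i
    fin_cases i <;> simp [hit]
  have e3 : ∫ α in Ioc (y 0) (y 0 + y 1), (stepValue m n (settle (hit y 0 α))).toReal ∂(m.F 0) =
      ∫ α in Ioc (y 0) (y 0 + y 1), (stepValue m n ![0, y 0 + y 1 - α]).toReal ∂(m.F 0) := by
    refine setIntegral_congr_fun measurableSet_Ioc fun α hα => ?_
    rw [h2 0 α hα]
    congr 2
    funext i
    fin_cases i <;> simp
  have e4 : ∫ α in Ioc (y 1) (y 0 + y 1), (stepValue m n (settle (hit y 1 α))).toReal ∂(m.F 1) =
      ∫ α in Ioc (y 1) (y 0 + y 1), (stepValue m n ![y 0 + y 1 - α, 0]).toReal ∂(m.F 1) := by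
    refine setIntegral_congr_fun measurableSet_Ioc fun α hα => ?_
    rw [h2 1 α hα]
    congr 2
    funext i
    fin_cases i <;> simp
  rw [Fin.sum_univ_two, claimValue, claimValue, e1, e2, e3, e4, H, claimOperator, ruinTerm, other_zero,
    other_one]
  ring

theorem H_nonneg (m : Model) (n : ℕ) {y : Fin 2 → ℝ} (hy : ∀ i, 0 ≤ y i) : 0 ≤ H m n (y 0) (y 1) := by
  rw [H_eq m n hy]
  exact Finset.sum_nonneg fun k _ => mul_nonneg (m.lam_pos k).le (claimValue_nonneg m n k y)

theorem sum_lintegral_afterClaim (m : Model) (n : ℕ) {y : Fin 2 → ℝ} (hy : ∀ i, 0 ≤ y i) :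
    ∑ k, ENNReal.ofReal (m.lam k) * ∫⁻ α, afterClaim m n k y α ∂(m.F k) =
      ENNReal.ofReal (H m n (y 0) (y 1)) := by
  rw [H_eq m n hy, ENNReal.ofReal_sum_of_nonneg fun k _ =>
    mul_nonneg (m.lam_pos k).le (claimValue_nonneg m n k y)]
  refine Finset.sum_congr rfl fun k _ => ?_
  rw [lintegral_afterClaim m n k hy, ENNReal.ofReal_mul (m.lam_pos k).le]

/-! ### The value of a plan as an integral along its path -/

/-- The minimum of two independent exponential times is exponential. -/
theorem lintegral_exp_min {a b : ℝ} (ha : 0 < a) (hb : 0 < b) {f : ℝ → ℝ≥0∞} (hf : Measurable f) :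
    ∫⁻ w in Ioi (0 : ℝ), ENNReal.ofReal (b * Real.exp (-b * w)) *
      ∫⁻ r in Ioi (0 : ℝ), ENNReal.ofReal (a * Real.exp (-a * r)) * f (min r w) =
    ∫⁻ r in Ioi (0 : ℝ), ENNReal.ofReal ((a + b) * Real.exp (-(a + b) * r)) * f r := by
  set A : ℝ → ℝ≥0∞ := fun r => ENNReal.ofReal (a * Real.exp (-a * r)) * f r with hA
  set B : ℝ → ℝ≥0∞ := fun w => ENNReal.ofReal (b * Real.exp (-b * w)) with hB
  have hAm : Measurable A := Measurable.mul (by fun_prop) hf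
  have hBm : Measurable B := by fun_prop
  -- Split according to which clock rings first: for r ≤ w the value is f(r) and is integrated over
  -- w afterwards; for r > w it is f(w), weighted by the tail e^{-aw}.
  have h1 : ∀ w ∈ Ioi (0 : ℝ), B w *
      ∫⁻ r in Ioi (0 : ℝ), ENNReal.ofReal (a * Real.exp (-a * r)) * f (min r w) =
      (∫⁻ r in Ioi (0 : ℝ), (Ici r).indicator B w * A r) +
        ENNReal.ofReal (b * Real.exp (-(a + b) * w)) * f w := by
    intro w hw
    have h2 : ∫⁻ r in Ioi (0 : ℝ), ENNReal.ofReal (a * Real.exp (-a * r)) * f (min r w) =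
        (∫⁻ r in Ioc 0 w, A r) + ENNReal.ofReal (Real.exp (-a * w)) * f w := by
      rw [← Ioc_union_Ioi_eq_Ioi (le_of_lt hw), lintegral_union measurableSet_Ioi
        (Ioc_disjoint_Ioi le_rfl), ← lintegral_exp_Ioi ha w, ← lintegral_mul_const _ (by fun_prop)]
      congr 1
      · refine setLIntegral_congr_fun measurableSet_Ioc fun r hr => ?_
        simp only [min_eq_left hr.2, hA]
      · refine setLIntegral_congr_fun measurableSet_Ioi fun r hr => ?_
        rw [min_eq_right (show w ≤ r from le_of_lt hr)]
    have h3 : ∫⁻ r in Ioi (0 : ℝ), (Ici r).indicator B w * A r = B w * ∫⁻ r in Ioc 0 w, A r := by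
      rw [← lintegral_const_mul _ hAm, ← lintegral_indicator measurableSet_Ioi,
        ← lintegral_indicator measurableSet_Ioc]
      refine lintegral_congr fun r => ?_
      simp only [indicator_apply, mem_Ioi, mem_Ici, mem_Ioc]
      by_cases hr : 0 < r <;> by_cases hr' : r ≤ w <;> simp [hr, hr']
    rw [h2, mul_add, h3, ← mul_assoc, hB]
    simp only
    rw [← ENNReal.ofReal_mul (mul_nonneg hb.le (Real.exp_nonneg _)), mul_assoc b, ← Real.exp_add]
    congr 6
    ring
  have hswap : Measurable (Function.uncurry fun w r : ℝ => (Ici r).indicator B w * A r) := by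
    have h2 : (Function.uncurry fun w r : ℝ => (Ici r).indicator B w * A r) =
        {x : ℝ × ℝ | x.2 ≤ x.1}.indicator fun x => B x.1 * A x.2 := by
      funext ⟨w, r⟩
      simp only [Function.uncurry_apply_pair, indicator_apply, mem_Ici, mem_ofPred_eq]
      split_ifs <;> simp
    rw [h2]
    exact ((hBm.comp measurable_fst).mul (hAm.comp measurable_snd)).indicator
      (measurableSet_le measurable_snd measurable_fst)
  have h4 : ∫⁻ w in Ioi (0 : ℝ), ∫⁻ r in Ioi (0 : ℝ), (Ici r).indicator B w * A r =
      ∫⁻ r in Ioi (0 : ℝ), ENNReal.ofReal (Real.exp (-b * r)) * A r := by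
    rw [lintegral_lintegral_swap hswap.aemeasurable]
    refine setLIntegral_congr_fun measurableSet_Ioi fun r hr => ?_
    rw [lintegral_mul_const _ (hBm.indicator measurableSet_Ici), lintegral_indicator measurableSet_Ici,
      Measure.restrict_restrict measurableSet_Ici, inter_eq_self_of_subset_left
        (Ici_subset_Ioi.2 hr), ← setLIntegral_congr Ioi_ae_eq_Ici, lintegral_exp_Ioi hb]
  have h5 : Measurable fun w => ENNReal.ofReal (b * Real.exp (-(a + b) * w)) * f w :=
    Measurable.mul (by fun_prop) hf
  rw [setLIntegral_congr_fun measurableSet_Ioi h1, lintegral_add_right _ h5, h4,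
    ← lintegral_add_right _ h5]
  refine lintegral_congr fun r => ?_
  simp only [hA]
  rw [← mul_assoc, ← ENNReal.ofReal_mul (Real.exp_nonneg _), ← add_mul,
    ← ENNReal.ofReal_add (by positivity) (by positivity)]
  congr 2
  rw [mul_left_comm, ← Real.exp_add]
  have : -b * r + -a * r = -(a + b) * r := by ring
  rw [this]
  ring

/-- The total rate of discounting and of claims. -/
def totalRate (m : Model) : ℝ := m.δ + (m.lam 0 + m.lam 1)

theorem totalRate_pos (m : Model) : 0 < totalRate m :=
  add_pos m.δ_pos (add_pos (m.lam_pos 0) (m.lam_pos 1))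

theorem IsPlan.nonneg (hD : IsPlan m z D) (k : Fin 2) (t : ℝ≥0) : 0 ≤ D k t :=
  (hD.zero k) ▸ hD.mono k (zero_le (a := t))

/-- By integration by parts, the discounted dividends up to `w` are the mean of `D` at min(r, w),
with `r` exponential of parameter δ. Averaging over the claim time `w` leaves the mean of `D` at an
exponential time with parameter `totalRate m`. -/
theorem IsPlan.lintegral_planDividends (hD : IsPlan m z D) :
    ∫⁻ w in Ioi (0 : ℝ), ENNReal.ofReal ((m.lam 0 + m.lam 1) *
      Real.exp (-(m.lam 0 + m.lam 1) * w)) * planDividends m D w =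
    ∫⁻ w in Ioi (0 : ℝ), ENNReal.ofReal (Real.exp (-totalRate m * w)) *
      ENNReal.ofReal (totalRate m * ∑ j, m.a j * D j w.toNNReal) := by
  have hΛ := add_pos (m.lam_pos 0) (m.lam_pos 1)
  have hdd : ∀ j w, discountedDividends m.δ (D j) (ENNReal.ofReal w) =
      ∫⁻ r in Ioi (0 : ℝ), ENNReal.ofReal (m.δ * Real.exp (-m.δ * r)) *
        ENNReal.ofReal (D j (min r w).toNNReal) := by
    intro j w
    rw [discountedDividends_eq m.δ_pos (hD.mono j) (hD.zero j) (hD.left_continuous j)]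
    refine lintegral_congr fun r => ?_
    have h1 : ENNReal.ofReal w = (w.toNNReal : ℝ≥0∞) := rfl
    rw [h1, stopAt_coe, (show Monotone Real.toNNReal from fun _ _ => Real.toNNReal_mono).map_min]
  have hm : ∀ j, Measurable fun w => discountedDividends m.δ (D j) (ENNReal.ofReal w) := fun j =>
    Monotone.measurable fun w w' h =>
      lintegral_mono_set fun s hs => ⟨hs.1, hs.2.trans_le (ENNReal.ofReal_le_ofReal h)⟩
  have h1 : ∀ j, ∫⁻ w in Ioi (0 : ℝ), ENNReal.ofReal ((m.lam 0 + m.lam 1) *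
      Real.exp (-(m.lam 0 + m.lam 1) * w)) * (ENNReal.ofReal (m.a j) *
        discountedDividends m.δ (D j) (ENNReal.ofReal w)) =
      ∫⁻ w in Ioi (0 : ℝ), ENNReal.ofReal (Real.exp (-totalRate m * w)) *
        ENNReal.ofReal (totalRate m * (m.a j * D j w.toNNReal)) := by
    intro j
    have h2 : Measurable fun w => ENNReal.ofReal ((m.lam 0 + m.lam 1) *
        Real.exp (-(m.lam 0 + m.lam 1) * w)) *
          discountedDividends m.δ (D j) (ENNReal.ofReal w) := Measurable.mul (by fun_prop) (hm j)
    have h3 : Measurable fun w : ℝ => ENNReal.ofReal ((m.δ + (m.lam 0 + m.lam 1)) *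
        Real.exp (-(m.δ + (m.lam 0 + m.lam 1)) * w)) * ENNReal.ofReal (D j w.toNNReal) :=
      Measurable.mul (by fun_prop) (hD.measurable j).ennreal_ofReal
    simp only [mul_left_comm _ (ENNReal.ofReal (m.a j))]
    rw [lintegral_const_mul _ h2]
    simp only [hdd]
    rw [lintegral_exp_min m.δ_pos hΛ (hD.measurable j).ennreal_ofReal, ← lintegral_const_mul _ h3]
    refine lintegral_congr fun w => ?_
    rw [← ENNReal.ofReal_mul (mul_nonneg (add_pos m.δ_pos hΛ).le (Real.exp_nonneg _)),
      ← ENNReal.ofReal_mul (m.a_nonneg j), ← ENNReal.ofReal_mul (Real.exp_nonneg _)]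
    congr 1
    simp only [totalRate]
    ring
  simp only [planDividends, Finset.mul_sum]
  have h2 : ∀ j ∈ Finset.univ, Measurable fun w => ENNReal.ofReal ((m.lam 0 + m.lam 1) *
      Real.exp (-(m.lam 0 + m.lam 1) * w)) * (ENNReal.ofReal (m.a j) *
        discountedDividends m.δ (D j) (ENNReal.ofReal w)) := fun j _ =>
    Measurable.mul (by fun_prop) ((hm j).const_mul _)
  have h3 : ∀ j ∈ Finset.univ, Measurable fun w : ℝ => ENNReal.ofReal (Real.exp (-totalRate m * w)) *
      ENNReal.ofReal (totalRate m * (m.a j * D j w.toNNReal)) := fun j _ =>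
    Measurable.mul (by fun_prop) ((((hD.measurable j).const_mul _).const_mul _).ennreal_ofReal)
  rw [lintegral_finsetSum _ h2]
  simp only [h1]
  rw [← lintegral_finsetSum _ h3]
  refine lintegral_congr fun w => ?_
  rw [← Finset.mul_sum, ENNReal.ofReal_sum_of_nonneg fun j _ => mul_nonneg (totalRate_pos m).le
    (mul_nonneg (m.a_nonneg j) (hD.nonneg j _))]

/-- At claim time `w` the value afterwards, averaged over company and size of the claim at rate λ,
is exactly `H` at the current surpluses. The integrand at `w` depends on the plan through `D` at
time `w` only, so plans can be varied locally in time. -/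
theorem IsPlan.planValue_eq (hD : IsPlan m z D) : planValue m n z D =
    ∫⁻ w in Ioi (0 : ℝ), ENNReal.ofReal (Real.exp (-totalRate m * w) *
      (totalRate m * ∑ j, m.a j * D j w.toNNReal +
        H m n (planPath m z D w 0) (planPath m z D w 1))) := by
  have hR : ∀ k, Measurable fun w : ℝ => ∫⁻ α, afterClaim m n k (planPath m z D w) α ∂(m.F k) := by
    intro k
    have h1 : Measurable fun x : ℝ × ℝ => afterClaim m n k (planPath m z D x.1) x.2 :=
      (measurable_afterClaim m n k).comp ((hD.measurable_planPath.comp measurable_fst).prodMk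
        measurable_snd)
    exact h1.lintegral_prod_right'
  have hP := measurable_planDividends m D
  have hrate : ∀ k, Measurable fun w : ℝ =>
      ENNReal.ofReal (m.lam k * Real.exp (-(m.lam 0 + m.lam 1) * w)) := fun k => by fun_prop
  have h1 : planValue m n z D = ∫⁻ w in Ioi (0 : ℝ), ∑ k,
      ENNReal.ofReal (m.lam k * Real.exp (-(m.lam 0 + m.lam 1) * w)) *
        (planDividends m D w + ENNReal.ofReal (Real.exp (-m.δ * w)) *
          ∫⁻ α, afterClaim m n k (planPath m z D w) α ∂(m.F k)) := by
    have h2 : ∀ k ∈ Finset.univ, Measurable fun w : ℝ =>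
        ENNReal.ofReal (m.lam k * Real.exp (-(m.lam 0 + m.lam 1) * w)) *
          (planDividends m D w + ENNReal.ofReal (Real.exp (-m.δ * w)) *
            ∫⁻ α, afterClaim m n k (planPath m z D w) α ∂(m.F k)) := fun k _ =>
      (hrate k).mul (hP.add (Measurable.mul (by fun_prop) (hR k)))
    rw [lintegral_finsetSum _ h2]
    refine Finset.sum_congr rfl fun k _ => lintegral_congr fun w => ?_
    have h2 : Measurable fun α => afterClaim m n k (planPath m z D w) α :=
      (measurable_afterClaim m n k).comp (measurable_const.prodMk measurable_id)
    rw [lintegral_add_left measurable_const, lintegral_const, measure_univ, mul_one,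
      lintegral_const_mul _ h2]
  have h2 : ∀ w ∈ Ioi (0 : ℝ), ∑ k,
      ENNReal.ofReal (m.lam k * Real.exp (-(m.lam 0 + m.lam 1) * w)) *
        (planDividends m D w + ENNReal.ofReal (Real.exp (-m.δ * w)) *
          ∫⁻ α, afterClaim m n k (planPath m z D w) α ∂(m.F k)) =
      ENNReal.ofReal ((m.lam 0 + m.lam 1) * Real.exp (-(m.lam 0 + m.lam 1) * w)) *
        planDividends m D w + ENNReal.ofReal (Real.exp (-totalRate m * w)) *
          ENNReal.ofReal (H m n (planPath m z D w 0) (planPath m z D w 1)) := by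
    intro w hw
    simp only [mul_add, Finset.sum_add_distrib]
    congr 1
    · rw [← Finset.sum_mul, ← ENNReal.ofReal_sum_of_nonneg fun k _ =>
        mul_nonneg (m.lam_pos k).le (Real.exp_nonneg _), ← Finset.sum_mul, Fin.sum_univ_two]
    · rw [← sum_lintegral_afterClaim m n (hD.planPath_nonneg (le_of_lt hw)), Finset.mul_sum]
      refine Finset.sum_congr rfl fun k _ => ?_
      rw [← mul_assoc, ← mul_assoc, ← ENNReal.ofReal_mul (mul_nonneg (m.lam_pos k).le
        (Real.exp_nonneg _)), ← ENNReal.ofReal_mul (Real.exp_nonneg _), mul_assoc (m.lam k),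
        ← Real.exp_add, mul_comm (m.lam k)]
      congr 4
      rw [totalRate]
      ring
  have h3 : Measurable fun w => ENNReal.ofReal ((m.lam 0 + m.lam 1) *
      Real.exp (-(m.lam 0 + m.lam 1) * w)) * planDividends m D w := Measurable.mul (by fun_prop) hP
  rw [h1, setLIntegral_congr_fun measurableSet_Ioi h2, lintegral_add_left h3, hD.lintegral_planDividends, ← lintegral_add_left]
  · refine setLIntegral_congr_fun measurableSet_Ioi fun w hw => ?_
    rw [← mul_add, ← ENNReal.ofReal_add, ← ENNReal.ofReal_mul (Real.exp_nonneg _)]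
    · exact mul_nonneg (totalRate_pos m).le (Finset.sum_nonneg fun j _ =>
        mul_nonneg (m.a_nonneg j) (hD.nonneg j _))
    · exact H_nonneg m n (hD.planPath_nonneg (le_of_lt hw))
  · exact Measurable.mul (by fun_prop) ((Finset.measurable_sum _ fun j _ =>
      (hD.measurable j).const_mul _).const_mul _).ennreal_ofReal

variable {m : Model} {z : Fin 2 → ℝ} {n : ℕ} {D : Fin 2 → ℝ≥0 → ℝ}

/-! ### Perturbation of plans -/

/-- Changes the dividends of company `k` on `(0, s]` by a linear function with slope `-κ`. -/
def perturb (D : Fin 2 → ℝ≥0 → ℝ) (k : Fin 2) (κ : ℝ) (c s : ℝ≥0) (i : Fin 2) (t : ℝ≥0) : ℝ :=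
  D i t - if i = k ∧ 0 < t ∧ t ≤ s then κ * (t - c) else 0

theorem perturb_of_ne {k i : Fin 2} (h : i ≠ k) (D : Fin 2 → ℝ≥0 → ℝ) (κ : ℝ) (c s : ℝ≥0) :
    perturb D k κ c s i = D i := by
  funext t
  simp [perturb, h]

theorem perturb_of_mem {t s : ℝ≥0} (ht : 0 < t) (hts : t ≤ s) (D : Fin 2 → ℝ≥0 → ℝ) (k : Fin 2)
    (κ : ℝ) (c : ℝ≥0) : perturb D k κ c s k t = D k t - κ * (t - c) := by
  simp [perturb, ht, hts]

theorem perturb_of_lt {t s : ℝ≥0} (h : s < t) (D : Fin 2 → ℝ≥0 → ℝ) (k : Fin 2)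
    (κ : ℝ) (c : ℝ≥0) (i : Fin 2) : perturb D k κ c s i t = D i t := by
  simp [perturb, h]

theorem perturb_zero (D : Fin 2 → ℝ≥0 → ℝ) (k : Fin 2) (κ : ℝ) (c s : ℝ≥0) (i : Fin 2) :
    perturb D k κ c s i 0 = D i 0 := by
  simp [perturb]

/-- On (0, s] the plan grows at least at rate `κ`, so lowering its slope by `κ` keeps it monotone.
From 0 ≤ c ≤ s it follows that the jumps created right after `0` and right after `s`, κc and κ(s -
c), are non-negative. The room `κ * s` covers the largest payment in advance. -/
theorem IsPlan.perturb (hD : IsPlan m z D) {k : Fin 2} {κ : ℝ} {c s : ℝ≥0} (hκ : 0 ≤ κ) (hc : c ≤ s)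
    (hrate : ∀ t t' : ℝ≥0, t ≤ t' → t' ≤ s → κ * (t' - t) ≤ D k t' - D k t)
    (hroom : ∀ t ≤ s, D k t + κ * s ≤ z k + m.p k * t) :
    IsPlan m z (Collab.perturb D k κ c s) := by
  have hc' : (c : ℝ) ≤ s := by exact_mod_cast hc
  refine ⟨fun i => (perturb_zero D k κ c s i).trans (hD.zero i), fun i => ?_, fun i t => ?_,
    fun i t => ?_⟩
  · by_cases hi : i = k
    · subst hi
      intro t t' htt'
      rcases eq_zero_or_pos t with rfl | ht
      · rw [perturb_zero]
        rcases eq_zero_or_pos t' with rfl | ht'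
        · rw [perturb_zero]
        · rcases le_or_gt t' s with hs | hs
          · have h1 := hrate 0 t' zero_le hs
            rw [perturb_of_mem ht' hs]
            rw [NNReal.coe_zero, sub_zero] at h1
            nlinarith [c.coe_nonneg]
          · rw [perturb_of_lt hs]
            exact hD.mono i htt'
      · rcases le_or_gt t' s with hs | hs
        · rw [perturb_of_mem ht (htt'.trans hs), perturb_of_mem (ht.trans_le htt') hs]
          linarith [hrate t t' htt' hs]
        · rw [perturb_of_lt hs]
          rcases le_or_gt t s with hs' | hs'
          · rw [perturb_of_mem ht hs']
            have h1 := hrate t s hs' le_rfl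
            have h2 := hD.mono i hs.le
            nlinarith
          · rw [perturb_of_lt hs']
            exact hD.mono i htt'
    · rw [perturb_of_ne hi]
      exact hD.mono i
  · by_cases hi : i = k
    · subst hi
      rcases eq_zero_or_pos t with rfl | ht
      · have : Iic (0 : ℝ≥0) = {0} := by ext; simp
        rw [this]
        exact continuousWithinAt_singleton
      · rcases le_or_gt t s with hs | hs
        · have h1 : ContinuousWithinAt (fun u : ℝ≥0 => D i u - κ * ((u : ℝ) - c)) (Iic t) t :=
            (hD.left_continuous i t).sub (Continuous.continuousWithinAt (by fun_prop))
          refine h1.congr_of_eventuallyEq ?_ (perturb_of_mem ht hs D i κ c)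
          filter_upwards [self_mem_nhdsWithin, mem_nhdsWithin_of_mem_nhds (lt_mem_nhds ht)]
            with u hu hu'
          exact perturb_of_mem hu' (le_trans hu hs) D i κ c
        · refine (hD.left_continuous i t).congr_of_eventuallyEq ?_ (perturb_of_lt hs D i κ c i)
          filter_upwards [mem_nhdsWithin_of_mem_nhds (lt_mem_nhds hs)] with u hu
          exact perturb_of_lt hu D i κ c i
    · rw [perturb_of_ne hi]
      exact hD.left_continuous i t
  · by_cases hi : i = k
    · subst hi
      rcases eq_zero_or_pos t with rfl | ht
      · rw [perturb_zero]
        exact hD.le i 0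
      · rcases le_or_gt t s with hs | hs
        · rw [perturb_of_mem ht hs]
          nlinarith [hroom t hs, t.coe_nonneg]
        · rw [perturb_of_lt hs]
          exact hD.le i t
    · rw [perturb_of_ne hi]
      exact hD.le i t

/-! ### The first order condition for a plan of maximal value -/

/-- The integrand in the value of a plan. -/
def planIntegrand (m : Model) (n : ℕ) (z : Fin 2 → ℝ) (D : Fin 2 → ℝ≥0 → ℝ) (w : ℝ) : ℝ :=
  Real.exp (-totalRate m * w) * (totalRate m * ∑ j, m.a j * D j w.toNNReal +
    H m n (planPath m z D w 0) (planPath m z D w 1))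

theorem IsPlan.planIntegrand_nonneg (hD : IsPlan m z D) {w : ℝ} (hw : 0 ≤ w) :
    0 ≤ planIntegrand m n z D w :=
  mul_nonneg (Real.exp_nonneg _) (add_nonneg (mul_nonneg (totalRate_pos m).le
    (Finset.sum_nonneg fun j _ => mul_nonneg (m.a_nonneg j) (hD.nonneg j _)))
    (H_nonneg m n (hD.planPath_nonneg hw)))

/-- The unit vector of company `k`. -/
def unit (k : Fin 2) : ℝ × ℝ := (if k = 0 then 1 else 0, if k = 1 then 1 else 0)

/-- If changing a plan on `(0, s]` only does not increase its value, then
the gain on `(0, s]` cannot exceed the error. -/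
theorem setLIntegral_gain_le {D' : Fin 2 → ℝ≥0 → ℝ} (hD : IsPlan m z D) (hD' : IsPlan m z D')
    {s : ℝ≥0} (h : ∀ t, s < t → ∀ i, D' i t = D i t)
    (hle : planValue m n z D' ≤ planValue m n z D) (hfin : planValue m n z D ≠ ∞)
    {gain : ℝ → ℝ} (hgain : Measurable gain) (hgain0 : ∀ w ∈ Ioc (0 : ℝ) s, 0 ≤ gain w)
    {err : ℝ} (herr : 0 ≤ err)
    (hint : ∀ w ∈ Ioc (0 : ℝ) s, planIntegrand m n z D w + gain w ≤ planIntegrand m n z D' w + err) :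
    ∫⁻ w in Ioc (0 : ℝ) s, ENNReal.ofReal (gain w) ≤ ENNReal.ofReal (err * s) := by
  have hsplit : ∀ f : ℝ → ℝ≥0∞, ∫⁻ w in Ioi (0 : ℝ), f w =
      (∫⁻ w in Ioc (0 : ℝ) s, f w) + ∫⁻ w in Ioi (s : ℝ), f w := by
    intro f
    rw [← Ioc_union_Ioi_eq_Ioi s.coe_nonneg, lintegral_union measurableSet_Ioi
      (Ioc_disjoint_Ioi le_rfl)]
  have hv : ∀ D, IsPlan m z D → planValue m n z D =
      (∫⁻ w in Ioc (0 : ℝ) s, ENNReal.ofReal (planIntegrand m n z D w)) +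
        ∫⁻ w in Ioi (s : ℝ), ENNReal.ofReal (planIntegrand m n z D w) := by
    intro D hD
    rw [hD.planValue_eq, ← hsplit]
    rfl
  have hrest : ∫⁻ w in Ioi (s : ℝ), ENNReal.ofReal (planIntegrand m n z D' w) =
      ∫⁻ w in Ioi (s : ℝ), ENNReal.ofReal (planIntegrand m n z D w) := by
    refine setLIntegral_congr_fun measurableSet_Ioi fun w hw => ?_
    have h1 : ∀ i, D' i w.toNNReal = D i w.toNNReal := h _ (Real.lt_toNNReal_iff_coe_lt.2 hw)
    simp only [planIntegrand, planPath, h1]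
  rw [hv D hD, hv D' hD', hrest] at hle
  rw [hv D hD] at hfin
  have hfin1 := (ENNReal.add_ne_top.1 hfin).1
  have hle' := (ENNReal.add_le_add_iff_right (ENNReal.add_ne_top.1 hfin).2).1 hle
  have h1 : (∫⁻ w in Ioc (0 : ℝ) s, ENNReal.ofReal (planIntegrand m n z D w)) +
      ∫⁻ w in Ioc (0 : ℝ) s, ENNReal.ofReal (gain w) ≤
      (∫⁻ w in Ioc (0 : ℝ) s, ENNReal.ofReal (planIntegrand m n z D' w)) + ENNReal.ofReal (err * s) := by
    have h2 : ENNReal.ofReal (err * s) = ∫⁻ w in Ioc (0 : ℝ) s, ENNReal.ofReal err := by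
      rw [setLIntegral_const, Real.volume_Ioc, sub_zero, ENNReal.ofReal_mul herr]
    rw [h2, ← lintegral_add_right _ hgain.ennreal_ofReal, ← lintegral_add_right _ measurable_const]
    refine setLIntegral_mono' measurableSet_Ioc fun w hw => ?_
    rw [← ENNReal.ofReal_add (hD.planIntegrand_nonneg hw.1.le) (hgain0 w hw),
      ← ENNReal.ofReal_add (hD'.planIntegrand_nonneg hw.1.le) herr]
    exact ENNReal.ofReal_le_ofReal (hint w hw)
  exact (ENNReal.add_le_add_iff_left hfin1).1 (h1.trans (add_le_add hle' le_rfl))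

/-- On the half of (0, s] farther from the end point `c` the distance to `c` is at least s/2. -/
theorem lintegral_abs_sub_ge {b : ℝ} (hb : 0 ≤ b) {c s : ℝ≥0} (hc : c = 0 ∨ c = s) :
    ENNReal.ofReal (b * (s / 2) * (s / 2)) ≤
      ∫⁻ w in Ioc (0 : ℝ) s, ENNReal.ofReal (b * |w - c|) := by
  have hs := s.coe_nonneg
  have h1 : ∀ l r : ℝ, 0 ≤ l → r ≤ s → r - l = s / 2 → (∀ w ∈ Ioc l r, (s : ℝ) / 2 ≤ |w - c|) →
      ENNReal.ofReal (b * (s / 2) * (s / 2)) ≤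
        ∫⁻ w in Ioc (0 : ℝ) s, ENNReal.ofReal (b * |w - c|) := by
    intro l r hl hr hlr h
    have h2 : ENNReal.ofReal (b * (s / 2) * (s / 2)) =
        ∫⁻ w in Ioc l r, ENNReal.ofReal (b * (s / 2)) := by
      rw [setLIntegral_const, Real.volume_Ioc, hlr, ENNReal.ofReal_mul (by positivity)]
    rw [h2]
    refine (setLIntegral_mono' measurableSet_Ioc fun w hw => ?_).trans
      (lintegral_mono_set (Ioc_subset_Ioc hl hr))
    exact ENNReal.ofReal_le_ofReal (mul_le_mul_of_nonneg_left (h w hw) hb)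
  rcases hc with rfl | rfl
  · refine h1 (s / 2) s (by positivity) le_rfl (by ring) fun w hw => ?_
    rw [NNReal.coe_zero, sub_zero]
    exact hw.1.le.trans (le_abs_self w)
  · refine h1 0 (c / 2) le_rfl (by linarith) (by ring) fun w hw => ?_
    rw [abs_sub_comm]
    exact le_trans (by linarith [hw.2]) (le_abs_self _)

theorem norm_prod_le {x y r : ℝ} (hx : |x| ≤ r) (hy : |y| ≤ r) : ‖((x, y) : ℝ × ℝ)‖ ≤ r :=
  norm_prod_le_iff.2 ⟨hx, hy⟩

set_option maxHeartbeats 400000 in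
/-- A plan of maximal value satisfies the first order condition at its starting point. -/
theorem IsPlan.fderiv_eq (hD : IsPlan m z D) (hz : ∀ i, 0 ≤ z i)
    (hopt : stepValue m (n + 1) z ≤ planValue m n z D) {k : Fin 2} (hzk : 0 < z k)
    {f' : ℝ × ℝ →L[ℝ] ℝ} (hf : HasFDerivWithinAt (fun q : ℝ × ℝ => H m n q.1 q.2) f'
      (Ici 0 ×ˢ Ici 0) (z 0, z 1)) {κ B : ℝ} {s₀ : ℝ≥0} (hκ : 0 < κ) (hs₀ : 0 < s₀)
    (hrate : ∀ t t' : ℝ≥0, t ≤ t' → t' ≤ s₀ → κ * (t' - t) ≤ D k t' - D k t)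
    (hB : ∀ t ≤ s₀, ∀ i, D i t ≤ B * t) :
    f' (unit k) = m.a k * totalRate m := by
  by_contra hne
  set g := f' (unit k) - m.a k * totalRate m with hg
  have hg0 : 0 < |g| := abs_pos.2 (sub_ne_zero.2 hne)
  have hp := p_pos m
  have hq := totalRate_pos m
  have hB0 : 0 ≤ B := by
    have h1 := (hD.nonneg 0 s₀).trans (hB s₀ le_rfl 0)
    exact nonneg_of_mul_nonneg_left h1 (NNReal.coe_pos.2 hs₀)
  set P := m.p 0 + m.p 1 with hP
  have hP0 : 0 < P := add_pos (hp 0) (hp 1)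
  set C := P + B + κ with hC
  have hC0 : 0 < C := by positivity
  -- `C` bounds the speed at which either path leaves `z`. With this `ε` the total linearization
  -- error is |g|κs²/16, half of the gain |g|κs²/8 obtained below.
  set ε := |g| * κ / (32 * C) with hε
  have hε0 : 0 < ε := by positivity
  have hev := (hasFDerivWithinAt_iff_isLittleO.1 hf).def hε0
  rw [eventually_iff, Metric.mem_nhdsWithin_iff] at hev
  obtain ⟨η, hη, hev⟩ := hev
  -- Both paths remain within `η` of `z` up to time `s`, the factor e^{-qw} stays above 1/2, and `z
  -- k > 0` leaves room for the advance payment.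
  obtain ⟨s, hs, hss₀, hsη, hsq, hsz⟩ : ∃ s : ℝ≥0, 0 < s ∧ s ≤ s₀ ∧ C * s < η ∧
      totalRate m * s ≤ 1 / 2 ∧ (B + κ) * s ≤ z k := by
    have h1 : ∀ b : ℝ, 0 < b → ∀ r : ℝ, 0 < r → ∀ᶠ s : ℝ in 𝓝[>] 0, b * s < r := by
      intro b _ r hr
      have h2 : Tendsto (fun s : ℝ => b * s) (𝓝[>] 0) (𝓝 (b * 0)) :=
        ((continuous_const.mul continuous_id).tendsto 0).mono_left nhdsWithin_le_nhds
      rw [mul_zero] at h2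
      exact h2.eventually (gt_mem_nhds hr)
    obtain ⟨s, hs1, hs2, hs3, hs4, hs5⟩ := ((h1 1 one_pos s₀ (NNReal.coe_pos.2 hs₀)).and
      ((h1 C hC0 η hη).and ((h1 _ hq (1 / 2) (by norm_num)).and
        ((h1 (B + κ) (by positivity) _ hzk).and self_mem_nhdsWithin)))).exists
    refine ⟨⟨s, le_of_lt hs5⟩, hs5, ?_, hs2, hs3.le, hs4.le⟩
    rw [one_mul] at hs1
    exact hs1.le
  have hs' : (0 : ℝ) < s := NNReal.coe_pos.2 hs
  -- The sign of `g` decides: if more surplus is worth more than dividends (g ≥ 0), company `k`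
  -- delays payments, c = 0; otherwise it advances them, c = s.
  obtain ⟨c, hc, hcs, hgc⟩ : ∃ c : ℝ≥0, (c = 0 ∨ c = s) ∧ c ≤ s ∧
      ∀ w ∈ Ioc (0 : ℝ) s, g * (κ * (w - c)) = |g| * κ * |w - c| := by
    rcases lt_or_ge g 0 with hneg | hnn
    · refine ⟨s, Or.inr rfl, le_rfl, fun w hw => ?_⟩
      rw [abs_of_neg hneg, abs_of_nonpos (sub_nonpos.2 hw.2)]
      ring
    · refine ⟨0, Or.inl rfl, zero_le, fun w hw => ?_⟩
      rw [abs_of_nonneg hnn, NNReal.coe_zero, sub_zero, abs_of_pos hw.1]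
      ring
  have hcs' : (c : ℝ) ≤ s := by exact_mod_cast hcs
  have hD' : IsPlan m z (Collab.perturb D k κ c s) :=
    hD.perturb hκ.le hcs (fun t t' h h' => hrate t t' h (h'.trans hss₀)) fun t ht => by
      have h1 := hB t (ht.trans hss₀) k
      have h2 : B * (t : ℝ) ≤ B * s := mul_le_mul_of_nonneg_left (by exact_mod_cast ht) hB0
      have h3 := mul_nonneg (hp k).le t.coe_nonneg
      linarith
  have hvle : planValue m n z (Collab.perturb D k κ c s) ≤ planValue m n z D :=
    hD'.planValue_le.trans hopt
  have hfin : planValue m n z D ≠ ∞ :=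
    ne_top_of_le_ne_top (stepValue_ne_top m (n + 1) hz) hD.planValue_le
  have happrox : ∀ y : Fin 2 → ℝ, (∀ i, 0 ≤ y i) → (∀ i, |y i - z i| ≤ C * s) →
      |H m n (y 0) (y 1) - H m n (z 0) (z 1) - f' (y 0 - z 0, y 1 - z 1)| ≤ ε * (C * s) := by
    intro y hy hyz
    have h1 : ‖((y 0 - z 0, y 1 - z 1) : ℝ × ℝ)‖ ≤ C * s := norm_prod_le (hyz 0) (hyz 1)
    have h2 : (y 0, y 1) ∈ Metric.ball (z 0, z 1) η ∩ Ici 0 ×ˢ Ici 0 := by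
      refine ⟨?_, hy 0, hy 1⟩
      rw [Metric.mem_ball, dist_eq_norm]
      exact h1.trans_lt hsη
    exact (hev h2).trans (mul_le_mul_of_nonneg_left h1 hε0.le)
  -- The linear parts of `H` and of the dividends combine to gκ(w - c). `H` is linearized at the
  -- points of the old and of the new path, which gives the factor 2 in the error; bounding the
  -- exponential below by 1/2 halves the gain.
  have hint : ∀ w ∈ Ioc (0 : ℝ) s, planIntegrand m n z D w + |g| * κ / 2 * |w - c| ≤
      planIntegrand m n z (Collab.perturb D k κ c s) w + 2 * (ε * (C * s)) := by
    intro w hw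
    set t := w.toNNReal with ht
    have htw : (t : ℝ) = w := Real.coe_toNNReal w hw.1.le
    have ht0 : 0 < t := Real.toNNReal_pos.2 hw.1
    have hts : t ≤ s := Real.toNNReal_le_iff_le_coe.2 hw.2
    set y := planPath m z D w with hy
    set y' := planPath m z (Collab.perturb D k κ c s) w with hy'
    have hyy' : ∀ i, y' i = y i + if i = k then κ * (w - c) else 0 := by
      intro i
      simp only [hy, hy', planPath, ← ht]
      by_cases hi : i = k
      · subst hi
        rw [perturb_of_mem ht0 hts, if_pos rfl, htw]
        ring
      · rw [perturb_of_ne hi, if_neg hi, add_zero]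
    have hyz : ∀ i, |y i - z i| ≤ (P + B) * s := by
      intro i
      have h1 : y i - z i = m.p i * w - D i t := by
        simp only [hy, planPath, ← ht]
        ring
      have h2 := hB t (hts.trans hss₀) i
      have h3 := hD.nonneg i t
      have h4 := p_le_sum m i
      have h5 := hp i
      rw [htw] at h2
      have h6 : m.p i * w ≤ P * s := mul_le_mul h4 hw.2 hw.1.le hP0.le
      have h7 : B * w ≤ B * s := mul_le_mul_of_nonneg_left hw.2 hB0
      have h8 := mul_pos h5 hw.1
      rw [h1, abs_le]
      constructor <;> nlinarith
    have hwc : |w - c| ≤ s := by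
      rw [abs_le]
      constructor <;> linarith [hw.1, hw.2, c.coe_nonneg]
    have hyz' : ∀ i, |y' i - z i| ≤ C * s := by
      intro i
      rw [hyy', add_sub_right_comm]
      refine (abs_add_le _ _).trans ?_
      have h1 : |if i = k then κ * (w - c) else 0| ≤ κ * s := by
        split_ifs
        · rw [abs_mul, abs_of_pos hκ]
          exact mul_le_mul_of_nonneg_left hwc hκ.le
        · rw [abs_zero]
          positivity
      linarith [hyz i]
    have h1 := happrox y (hD.planPath_nonneg hw.1.le) fun i => (hyz i).trans
      (mul_le_mul_of_nonneg_right (by linarith) hs'.le)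
    have h2 := happrox y' (hD'.planPath_nonneg hw.1.le) hyz'
    have h3 : f' (y' 0 - z 0, y' 1 - z 1) = f' (y 0 - z 0, y 1 - z 1) +
        κ * (w - c) * f' (unit k) := by
      rw [← smul_eq_mul (κ * (w - c)), ← map_smul, ← map_add]
      congr 1
      rw [hyy', hyy']
      rcases eq_or_eq_other 0 k with rfl | rfl
      · simp [unit]
        ring
      · simp [unit, other_zero]
        ring
    have h4 : ∑ j, m.a j * Collab.perturb D k κ c s j t = ∑ j, m.a j * D j t -
        m.a k * (κ * (w - c)) := by
      rw [sum_fin_two_other _ k, sum_fin_two_other _ k, perturb_of_mem ht0 hts,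
        perturb_of_ne (other_ne k), htw]
      ring
    simp only [planIntegrand, ← hy, ← hy', ← ht, h4]
    rw [abs_le] at h1 h2
    have hE1 : Real.exp (-totalRate m * w) ≤ 1 := by
      rw [Real.exp_le_one_iff]
      nlinarith [hw.1]
    have hE2 : 1 / 2 ≤ Real.exp (-totalRate m * w) := by
      have h5 := Real.add_one_le_exp (-totalRate m * w)
      nlinarith [hw.2]
    have hgain : |g| * κ * |w - c| - 2 * (ε * (C * s)) ≤
        (totalRate m * (∑ j, m.a j * D j t - m.a k * (κ * (w - c))) + H m n (y' 0) (y' 1)) -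
          (totalRate m * ∑ j, m.a j * D j t + H m n (y 0) (y 1)) := by
      rw [← hgc w hw, hg]
      linarith [h1.2, h2.1]
    have hgn : 0 ≤ |g| * κ * |w - c| := by positivity
    have hen : 0 ≤ 2 * (ε * (C * s)) := by positivity
    have h6 := mul_le_mul_of_nonneg_left hgain (Real.exp_nonneg (-totalRate m * w))
    have h7 : Real.exp (-totalRate m * w) * (2 * (ε * (C * s))) ≤ 1 * (2 * (ε * (C * s))) :=
      mul_le_mul_of_nonneg_right hE1 hen
    have h8 : 1 / 2 * (|g| * κ * |w - c|) ≤ Real.exp (-totalRate m * w) * (|g| * κ * |w - c|) :=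
      mul_le_mul_of_nonneg_right hE2 hgn
    rw [mul_sub, mul_sub] at h6
    linarith
  have hb : 0 ≤ |g| * κ / 2 := by positivity
  have he : 0 ≤ 2 * (ε * (C * s)) := by positivity
  have hfinal := setLIntegral_gain_le hD hD' (fun t ht i => perturb_of_lt ht D k κ c i) hvle hfin
    (gain := fun w => |g| * κ / 2 * |w - c|) ((measurable_id.sub_const _).abs.const_mul _)
    (fun w _ => mul_nonneg hb (abs_nonneg _)) he hint
  -- The gain is at least (|g|κ/2)(s/2)² = |g|κs²/8, but the error allows at most |g|κs²/16.
  have h1 := (lintegral_abs_sub_ge hb hc).trans hfinal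
  rw [ENNReal.ofReal_le_ofReal_iff (mul_nonneg he s.coe_nonneg)] at h1
  have h2 : ε * C = |g| * κ / 32 := by
    rw [hε]
    field_simp
  have h3 : 2 * (ε * (C * s)) * (s : ℝ) = |g| * κ / 16 * (s * s) := by
    have : 2 * (ε * (C * s)) * (s : ℝ) = 2 * (ε * C) * (s * s) := by ring
    rw [this, h2]
    ring
  rw [h3] at h1
  have h4 : 0 < |g| * κ * (s * s) := by positivity
  linarith

variable {m : Model}

/-! ### The curves -/

/-- The continuous derivative attains its maximum and minimum on the compact interval, and both are
negative. -/
theorem IsPhi.exists_bounds {w M : ℝ} {ξ : ℝ → ℝ} (h : IsPhi w M ξ) : ∃ b B : ℝ, 0 < b ∧ 0 < B ∧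
    ∀ u ∈ Icc w M, ∀ v ∈ Icc w M, u ≤ v → b * (v - u) ≤ ξ u - ξ v ∧ ξ u - ξ v ≤ B * (v - u) := by
  obtain ⟨ξ', hcont, hderiv⟩ := h.deriv
  have hne : (Icc w M).Nonempty := nonempty_Icc.2 h.le
  obtain ⟨x, hx, hmax⟩ := isCompact_Icc.exists_isMaxOn hne hcont
  obtain ⟨x', hx', hmin⟩ := isCompact_Icc.exists_isMinOn hne hcont
  have hξ : ContinuousOn ξ (Icc w M) := fun u hu => (hderiv u hu).1.continuousWithinAt
  have hint : ∀ u ∈ interior (Icc w M), HasDerivAt ξ (ξ' u) u ∧ u ∈ Icc w M := fun u hu =>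
    ⟨(hderiv u (interior_subset hu)).1.hasDerivAt (mem_interior_iff_mem_nhds.1 hu),
      interior_subset hu⟩
  have hlin : ∀ a u : ℝ, HasDerivAt (fun u : ℝ => a * u) a u := fun a u => by
    simpa using (hasDerivAt_id u).const_mul a
  have hsum : ∀ a, ∀ u ∈ interior (Icc w M), HasDerivAt (fun u => ξ u + a * u) (ξ' u + a) u :=
    fun a u hu => (hint u hu).1.add (hlin a u)
  have hcs : ∀ a : ℝ, ContinuousOn (fun u => ξ u + a * u) (Icc w M) := fun a =>
    hξ.add (Continuous.continuousOn (by fun_prop))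
  have hanti : AntitoneOn (fun u => ξ u + -ξ' x * u) (Icc w M) := by
    refine antitoneOn_of_deriv_nonpos (convex_Icc w M) (hcs _)
      (fun u hu => (hsum _ u hu).differentiableAt.differentiableWithinAt) fun u hu => ?_
    rw [(hsum _ u hu).deriv]
    linarith [isMaxOn_iff.1 hmax u (hint u hu).2]
  have hmono : MonotoneOn (fun u => ξ u + -ξ' x' * u) (Icc w M) := by
    refine monotoneOn_of_deriv_nonneg (convex_Icc w M) (hcs _)
      (fun u hu => (hsum _ u hu).differentiableAt.differentiableWithinAt) fun u hu => ?_
    rw [(hsum _ u hu).deriv]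
    linarith [isMinOn_iff.1 hmin u (hint u hu).2]
  refine ⟨-ξ' x, -ξ' x', neg_pos.2 (hderiv x hx).2, neg_pos.2 (hderiv x' hx').2,
    fun u hu v hv huv => ?_⟩
  have h1 := hanti hu hv huv
  have h2 := hmono hu hv huv
  simp only at h1 h2
  constructor <;> linarith

namespace Curve

variable (c : Curve m) (k : Fin 2)

theorem surjOn_ξ : SurjOn (c.ξ k) (Icc (c.base k) (c.M k)) (Icc 0 (c.vertex (other k))) := by
  obtain ⟨ξ', -, hderiv⟩ := (c.phi k).deriv
  have hξ : ContinuousOn (c.ξ k) (Icc (c.base k) (c.M k)) := fun u hu =>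
    (hderiv u hu).1.continuousWithinAt
  have h := intermediate_value_Icc' (c.phi k).le hξ
  rwa [(c.phi k).zero, c.start k] at h

theorem inv_mem {y : ℝ} (hy : y ∈ Icc 0 (c.vertex (other k))) :
    c.inv k y ∈ Icc (c.base k) (c.M k) :=
  Function.invFunOn_mem (c.surjOn_ξ k hy)

theorem ξ_inv {y : ℝ} (hy : y ∈ Icc 0 (c.vertex (other k))) : c.ξ k (c.inv k y) = y :=
  Function.invFunOn_eq (c.surjOn_ξ k hy)

theorem exists_bounds : ∃ b B : ℝ, 0 < b ∧ 0 < B ∧ ∀ u ∈ Icc (c.base k) (c.M k),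
    ∀ v ∈ Icc (c.base k) (c.M k), u ≤ v →
      b * (v - u) ≤ c.ξ k u - c.ξ k v ∧ c.ξ k u - c.ξ k v ≤ B * (v - u) :=
  (c.phi k).exists_bounds

theorem strictAntiOn_ξ : StrictAntiOn (c.ξ k) (Icc (c.base k) (c.M k)) := by
  obtain ⟨b, B, hb, -, h⟩ := c.exists_bounds k
  intro u hu v hv huv
  have h1 := (h u hu v hv huv.le).1
  have h2 := mul_pos hb (sub_pos.2 huv)
  linarith

theorem inv_ξ {u : ℝ} (hu : u ∈ Icc (c.base k) (c.M k))
    (hy : c.ξ k u ∈ Icc 0 (c.vertex (other k))) : c.inv k (c.ξ k u) = u :=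
  (c.strictAntiOn_ξ k).injOn (c.inv_mem k hy) hu (c.ξ_inv k hy)

theorem inv_anti {y y' : ℝ} (hy : y ∈ Icc 0 (c.vertex (other k)))
    (hy' : y' ∈ Icc 0 (c.vertex (other k))) (h : y ≤ y') : c.inv k y' ≤ c.inv k y := by
  by_contra hlt
  have h1 := c.strictAntiOn_ξ k (c.inv_mem k hy) (c.inv_mem k hy') (not_le.1 hlt)
  rw [c.ξ_inv k hy, c.ξ_inv k hy'] at h1
  linarith

theorem exists_inv_bounds : ∃ b B : ℝ, 0 < b ∧ 0 < B ∧ ∀ y ∈ Icc 0 (c.vertex (other k)),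
    ∀ y' ∈ Icc 0 (c.vertex (other k)), y ≤ y' →
      b * (c.inv k y - c.inv k y') ≤ y' - y ∧ y' - y ≤ B * (c.inv k y - c.inv k y') := by
  obtain ⟨b, B, hb, hB, h⟩ := c.exists_bounds k
  refine ⟨b, B, hb, hB, fun y hy y' hy' hyy' => ?_⟩
  have h1 := h _ (c.inv_mem k hy') _ (c.inv_mem k hy) (c.inv_anti k hy hy' hyy')
  rwa [c.ξ_inv k hy, c.ξ_inv k hy'] at h1

theorem ξ_mem {u : ℝ} (hu : u ∈ Icc (c.base k) (c.M k)) :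
    c.ξ k u ∈ Icc 0 (c.vertex (other k)) := by
  have hle := (c.phi k).le
  have h1 := (c.strictAntiOn_ξ k).antitoneOn hu (right_mem_Icc.2 hle) hu.2
  have h2 := (c.strictAntiOn_ξ k).antitoneOn (left_mem_Icc.2 hle) hu hu.1
  rw [(c.phi k).zero] at h1
  rw [base, c.start k] at h2
  exact ⟨h1, h2⟩

/-- The point of the curve of company `k` with parameter `u`. -/
def point (u : ℝ) (i : Fin 2) : ℝ :=
  if i = k then u + m.p k / m.p (other k) * c.ξ k u else c.ξ k u

theorem point_self (u : ℝ) : c.point k u k = u + m.p k / m.p (other k) * c.ξ k u := if_pos rfl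

theorem point_other (u : ℝ) : c.point k u (other k) = c.ξ k u := if_neg (other_ne k)

theorem point_nonneg {u : ℝ} (hu : u ∈ Icc (c.base k) (c.M k)) (i : Fin 2) : 0 ≤ c.point k u i := by
  rcases eq_or_eq_other k i with rfl | rfl
  · rw [point_self]
    exact c.in_quadrant _ u hu
  · rw [point_other]
    exact (c.ξ_mem k hu).1

theorem point_base : c.point k (c.base k) = c.vertex := by
  funext i
  rcases eq_or_eq_other k i with rfl | rfl
  · rw [point_self, base, c.start]
    ring
  · rw [point_other, base, c.start]

theorem path_vertex (t : ℝ≥0) : c.path c.vertex t = c.vertex := if_pos fun _ => le_rfl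

theorem path_point {u : ℝ} (hu : u ∈ Ioc (c.base k) (c.M k)) (t : ℝ≥0) :
    c.path (c.point k u) t = c.sidePath (c.point k u) k t := by
  have hle := (c.phi k).le
  have h1 : c.point k u (other k) < c.vertex (other k) := by
    have h2 := c.strictAntiOn_ξ k (left_mem_Icc.2 hle) (Ioc_subset_Icc_self hu) hu.1
    have h3 := c.start k
    rw [← base] at h3
    rw [point_other]
    linarith
  rw [path, if_neg fun h => absurd (h (other k)) (not_le.2 h1)]
  have hp := p_pos m
  have h0 := (hp 0).ne'
  have h1 := (hp 1).ne'
  rcases eq_or_eq_other 0 k with rfl | rfl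
  · have h2 : c.point 0 u 0 - m.p 0 / m.p 1 * c.point 0 u 1 = u := by
      have h3 := c.point_self 0 u
      have h4 := c.point_other 0 u
      rw [other_zero] at h3 h4
      rw [h3, h4]
      ring
    rw [if_pos (show c.base 0 ≤ c.point 0 u 0 - m.p 0 / m.p 1 * c.point 0 u 1 by
      rw [h2]; exact hu.1.le)]
  -- `Curve.path` decides the side by the coordinate of Company One, which is the negative multiple
  -- -(p 0 / p 1) of that of Company Two. So `u > base 1` means lying strictly below `base 0`;
  -- strictness excludes the vertex.
  · rw [other_zero] at hu ⊢
    have h2 : c.point 1 u 0 - m.p 0 / m.p 1 * c.point 1 u 1 = -(m.p 0 / m.p 1) * u := by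
      have h3 := c.point_self 1 u
      have h4 := c.point_other 1 u
      rw [other_one] at h3 h4
      rw [h3, h4]
      field_simp
      ring
    have h3 : c.base 0 = -(m.p 0 / m.p 1) * c.base 1 := by
      simp only [base, other_zero, other_one]
      field_simp
      ring
    rw [if_neg]
    rw [h2, h3, not_le]
    exact mul_lt_mul_of_neg_left hu.1 (neg_lt_zero.2 (div_pos (hp 0) (hp 1)))

end Curve

/-! ### The dividends of a curve strategy started on its curve -/

/-- A process with bounded rates is a plan if the surpluses remain non-negative. -/
theorem isPlan_of_rates {z : Fin 2 → ℝ} {D : Fin 2 → ℝ≥0 → ℝ} {K : ℝ} (h0 : ∀ i, D i 0 = 0)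
    (hmono : ∀ i, Monotone (D i)) (hK : ∀ i (t t' : ℝ≥0), t ≤ t' → D i t' - D i t ≤ K * (t' - t))
    (hle : ∀ i (t : ℝ≥0), D i t ≤ z i + m.p i * t) : IsPlan m z D := by
  refine ⟨h0, hmono, fun i t => Continuous.continuousWithinAt ?_, hle⟩
  refine (LipschitzWith.of_le_add_mul K.toNNReal fun s t => ?_).continuous
  have hK' : K ≤ K.toNNReal := Real.le_coe_toNNReal K
  rcases le_total s t with hst | hst
  · have h1 := hmono i hst
    have h2 : 0 ≤ (K.toNNReal : ℝ) * dist s t := by positivity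
    linarith
  · have h1 := hK i t s hst
    have hst' : (t : ℝ) ≤ s := by exact_mod_cast hst
    have h2 : dist s t = s - t := by rw [NNReal.dist_eq, abs_of_nonneg (sub_nonneg.2 hst')]
    rw [h2]
    nlinarith

namespace Curve

variable (c : Curve m) (k : Fin 2)

theorem dividends_vertex (i : Fin 2) (t : ℝ≥0) : c.dividends c.vertex i t = m.p i * t := by
  rw [dividends, path_vertex]
  split_ifs with h
  · simp [h]
  · ring

/-- The surplus of the other company when the curve of company `k` is followed. -/
def level (u : ℝ) (t : ℝ≥0) : ℝ := min (c.ξ k u + m.p (other k) * t) (c.vertex (other k))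

theorem level_mem {u : ℝ} (hu : u ∈ Icc (c.base k) (c.M k)) (t : ℝ≥0) :
    c.level k u t ∈ Icc 0 (c.vertex (other k)) := by
  have h1 := c.ξ_mem k hu
  exact ⟨le_min (add_nonneg h1.1 (mul_nonneg (p_pos m _).le t.coe_nonneg)) (h1.1.trans h1.2),
    min_le_right _ _⟩

theorem level_zero {u : ℝ} (hu : u ∈ Icc (c.base k) (c.M k)) : c.level k u 0 = c.ξ k u := by
  simp [level, (c.ξ_mem k hu).2]

theorem level_mono (u : ℝ) : Monotone (c.level k u) := fun t t' h => by
  refine min_le_min ?_ le_rfl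
  have h1 : (t : ℝ) ≤ t' := by exact_mod_cast h
  have h2 := mul_le_mul_of_nonneg_left h1 (p_pos m (other k)).le
  linarith

theorem level_sub_le (u : ℝ) {t t' : ℝ≥0} (h : t ≤ t') :
    c.level k u t' - c.level k u t ≤ m.p (other k) * (t' - t) := by
  have h1 : (t : ℝ) ≤ t' := by exact_mod_cast h
  have h2 := mul_le_mul_of_nonneg_left h1 (p_pos m (other k)).le
  simp only [level]
  rcases le_total (c.ξ k u + m.p (other k) * t) (c.vertex (other k)) with h3 | h3
  · rw [min_eq_left h3]
    linarith [min_le_left (c.ξ k u + m.p (other k) * t') (c.vertex (other k))]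
  · rw [min_eq_right h3]
    linarith [min_le_right (c.ξ k u + m.p (other k) * t') (c.vertex (other k))]

theorem path_point_other {u : ℝ} (hu : u ∈ Ioc (c.base k) (c.M k)) (t : ℝ≥0) :
    c.path (c.point k u) t (other k) = c.level k u t := by
  rw [path_point c k hu, sidePath]
  simp only [if_true, point_other]
  rfl

theorem path_point_self {u : ℝ} (hu : u ∈ Ioc (c.base k) (c.M k)) (t : ℝ≥0) :
    c.path (c.point k u) t k =
      c.inv k (c.level k u t) + m.p k / m.p (other k) * c.level k u t := by
  have hu' := Ioc_subset_Icc_self hu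
  -- The level only rises from `ξ u` and the inverse is decreasing, so the minimum in `sidePath` is
  -- always the curve itself: the path never leaves it.
  have h1 : c.inv k (c.level k u t) ≤ u := by
    have h2 := c.inv_anti k (c.level_mem k hu' 0) (c.level_mem k hu' t)
      (c.level_mono k u (zero_le (a := t)))
    rwa [c.level_zero k hu', c.inv_ξ k hu' (c.ξ_mem k hu')] at h2
  rw [path_point c k hu, sidePath]
  simp only [if_neg (other_ne k).symm, point_other, point_self]
  rw [add_sub_cancel_right, ← level, min_eq_right h1]

theorem dividends_point {u : ℝ} (hu : u ∈ Ioc (c.base k) (c.M k)) (i : Fin 2) (t : ℝ≥0) :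
    c.dividends (c.point k u) i t = c.point k u i + m.p i * t - c.path (c.point k u) t i := by
  have hu' := Ioc_subset_Icc_self hu
  rw [dividends]
  split_ifs with ht
  · subst ht
    rcases eq_or_eq_other k i with rfl | rfl
    · rw [path_point_self c i hu, level_zero c i hu', inv_ξ c i hu' (c.ξ_mem i hu'), point_self]
      simp
    · rw [path_point_other c k hu, level_zero c k hu', point_other]
      simp
  · rfl

/-- Along its curve, company `k` pays at a rate which is bounded and bounded away from zero. -/
theorem exists_rates {u : ℝ} (hu : u ∈ Icc (c.base k) (c.M k)) :
    IsPlan m (c.point k u) (c.dividends (c.point k u)) ∧ ∃ (κ B : ℝ) (s₀ : ℝ≥0), 0 < κ ∧ 0 < s₀ ∧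
      (∀ t t' : ℝ≥0, t ≤ t' → t' ≤ s₀ → κ * (t' - t) ≤
        c.dividends (c.point k u) k t' - c.dividends (c.point k u) k t) ∧
      ∀ t : ℝ≥0, t ≤ s₀ → ∀ i, c.dividends (c.point k u) i t ≤ B * t := by
  have hp := p_pos m
  suffices h : ∃ (κ B : ℝ) (s₀ : ℝ≥0), 0 < κ ∧ 0 < s₀ ∧
      (∀ t t' : ℝ≥0, t ≤ t' → t' ≤ s₀ → κ * (t' - t) ≤
        c.dividends (c.point k u) k t' - c.dividends (c.point k u) k t) ∧
      (∀ i, Monotone (c.dividends (c.point k u) i)) ∧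
      (∀ i (t t' : ℝ≥0), t ≤ t' → c.dividends (c.point k u) i t' -
        c.dividends (c.point k u) i t ≤ B * (t' - t)) ∧
      ∀ i (t : ℝ≥0), c.dividends (c.point k u) i t ≤ c.point k u i + m.p i * t by
    obtain ⟨κ, B, s₀, hκ, hs₀, hrate, hmono, hB, hle⟩ := h
    have h0 : ∀ i, c.dividends (c.point k u) i 0 = 0 := fun i => if_pos rfl
    refine ⟨isPlan_of_rates h0 hmono hB hle, κ, B, s₀, hκ, hs₀, hrate, fun t _ i => ?_⟩
    have h1 := hB i 0 t zero_le
    rwa [h0, sub_zero, NNReal.coe_zero, sub_zero] at h1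
  rcases hu.1.eq_or_lt with heq | hlt
  · rw [← heq, point_base]
    simp only [dividends_vertex]
    refine ⟨m.p k, m.p 0 + m.p 1, 1, hp k, one_pos, fun t t' _ _ => by linarith, fun i t t' h => ?_,
      fun i t t' h => ?_, fun i t => le_add_of_nonneg_left (c.vertex_nonneg i)⟩
    · rw [dividends_vertex, dividends_vertex]
      exact mul_le_mul_of_nonneg_left (by exact_mod_cast h) (hp i).le
    · have h1 : (t : ℝ) ≤ t' := by exact_mod_cast h
      rw [← mul_sub]
      exact mul_le_mul_of_nonneg_right (p_le_sum m i) (sub_nonneg.2 h1)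
  · have hu' : u ∈ Ioc (c.base k) (c.M k) := ⟨hlt, hu.2⟩
    obtain ⟨b, B, hb, hB, hinv⟩ := c.exists_inv_bounds k
    have hlev := c.level_mem k hu
    have hinv' : ∀ t t' : ℝ≥0, t ≤ t' → _ := fun t t' h =>
      hinv _ (hlev t) _ (hlev t') (c.level_mono k u h)
    have hother : ∀ t, c.dividends (c.point k u) (other k) t =
        c.ξ k u + m.p (other k) * t - c.level k u t := fun t => by
      rw [dividends_point c k hu', point_other, path_point_other c k hu']
    -- Premiums move both surpluses along a line of constant `u`. The payments of company `k`
    -- therefore consist of the decrease of `u` and, once the vertex is reached, of its share for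
    -- keeping `u` fixed while the other company pays.
    have hself : ∀ t, c.dividends (c.point k u) k t = u - c.inv k (c.level k u t) +
        m.p k / m.p (other k) * c.dividends (c.point k u) (other k) t := fun t => by
      rw [hother, dividends_point c k hu', point_self, path_point_self c k hu']
      have := (hp (other k)).ne'
      field_simp
      ring
    have hρ : 0 < m.p k / m.p (other k) := div_pos (hp k) (hp (other k))
    have hmo : Monotone (c.dividends (c.point k u) (other k)) := fun t t' h => by
      rw [hother, hother]
      linarith [c.level_sub_le k u h]
    have hinvle : ∀ t t' : ℝ≥0, t ≤ t' → 0 ≤ c.inv k (c.level k u t) - c.inv k (c.level k u t') :=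
      fun t t' h => sub_nonneg.2 (c.inv_anti k (hlev t) (hlev t') (c.level_mono k u h))
    have hLo : ∀ t t' : ℝ≥0, t ≤ t' → c.dividends (c.point k u) (other k) t' -
        c.dividends (c.point k u) (other k) t ≤ m.p (other k) * (t' - t) := fun t t' h => by
      rw [hother, hother]
      linarith [c.level_mono k u h]
    have hinvL : ∀ t t' : ℝ≥0, t ≤ t' → c.inv k (c.level k u t) - c.inv k (c.level k u t') ≤
        m.p (other k) / b * (t' - t) := fun t t' h => by
      have h1 := (hinv' t t' h).1.trans (c.level_sub_le k u h)
      rw [div_mul_eq_mul_div, le_div_iff₀ hb]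
      linarith
    have hξ : c.ξ k u < c.vertex (other k) := by
      have h1 := c.strictAntiOn_ξ k (left_mem_Icc.2 (c.phi k).le) hu hlt
      have h2 := c.start k
      rw [← base] at h2
      exact h1.trans_eq h2
    -- The time at which the vertex is reached. Before it the level rises at rate `p (other k)`, so
    -- `u` decreases at least at rate `p (other k) / B`, where `B` bounds the slope of the curve
    -- function.
    set s₀ := (c.vertex (other k) - c.ξ k u) / m.p (other k) with hs₀
    have hs₀pos : 0 < s₀ := div_pos (sub_pos.2 hξ) (hp _)
    refine ⟨m.p (other k) / B, m.p (other k) / b + m.p k + m.p (other k), ⟨s₀, hs₀pos.le⟩,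
      div_pos (hp _) hB, hs₀pos, fun t t' h h' => ?_, fun i => ?_, fun i t t' h => ?_, fun i t => ?_⟩
    · have hlin : ∀ t'' : ℝ≥0, t'' ≤ t' → c.level k u t'' = c.ξ k u + m.p (other k) * t'' := by
        intro t'' ht''
        refine min_eq_left ?_
        have h1 : (t'' : ℝ) ≤ s₀ := (show (t'' : ℝ) ≤ t' by exact_mod_cast ht'').trans h'
        rw [hs₀, le_div_iff₀ (hp _)] at h1
        linarith
      have h1 := (hinv' t t' h).2
      have h2 : c.level k u t' - c.level k u t = m.p (other k) * (t' - t) := by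
        rw [hlin t' le_rfl, hlin t h]
        ring
      have h3 : m.p (other k) / B * (t' - t) ≤
          c.inv k (c.level k u t) - c.inv k (c.level k u t') := by
        rw [div_mul_eq_mul_div, div_le_iff₀ hB]
        linarith
      have h4 := mul_le_mul_of_nonneg_left (hmo h) hρ.le
      rw [hself t', hself t]
      linarith
    · rcases eq_or_eq_other k i with rfl | rfl
      · intro t t' h
        have h4 := mul_le_mul_of_nonneg_left (hmo h) hρ.le
        rw [hself t', hself t]
        linarith [hinvle t t' h]
      · exact hmo
    · have h1 : (0 : ℝ) ≤ t' - t := sub_nonneg.2 (by exact_mod_cast h)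
      have h5 : 0 ≤ m.p (other k) / b * (t' - t) := mul_nonneg (div_pos (hp _) hb).le h1
      have h6 : 0 ≤ m.p k * (t' - t) := mul_nonneg (hp k).le h1
      have h7 : 0 ≤ m.p (other k) * (t' - t) := mul_nonneg (hp (other k)).le h1
      rcases eq_or_eq_other k i with rfl | rfl
      · have h2 := mul_le_mul_of_nonneg_left (hLo t t' h) hρ.le
        have h3 : m.p i / m.p (other i) * (m.p (other i) * (t' - t)) = m.p i * (t' - t) := by
          rw [← mul_assoc, div_mul_cancel₀ _ (hp (other i)).ne']
        rw [h3, mul_sub] at h2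
        rw [hself t', hself t]
        linarith [hinvL t t' h]
      · linarith [hLo t t' h]
    · rw [dividends_point c k hu']
      refine sub_le_self _ ?_
      rcases eq_or_eq_other k i with rfl | rfl
      · rw [path_point_self c i hu']
        have h1 := c.in_quadrant i _ (c.inv_mem i (hlev t))
        rwa [c.ξ_inv i (hlev t)] at h1
      · rw [path_point_other c k hu']
        exact (hlev t).1

/-- By hypothesis the optimal value at a point of the curve is the curve value, which is at most the
value of the curve's plan; so this plan is maximal. `hpos` is the room needed for advancing
payments. -/
theorem fderiv_eq {n : ℕ} (hH : DifferentiableOn ℝ (fun q : ℝ × ℝ => H m n q.1 q.2) (Ici 0 ×ˢ Ici 0))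
    (hc : ∀ z : Fin 2 → ℝ, (∀ k, 0 ≤ z k) →
      stepValue m (n + 1) z = c.oneStepValue (stepValue m n) z)
    {u : ℝ} (hu : u ∈ Icc (c.base k) (c.M k)) (hpos : 0 < c.point k u k) :
    ∃ f' : ℝ × ℝ →L[ℝ] ℝ, HasFDerivWithinAt (fun q : ℝ × ℝ => H m n q.1 q.2) f' (Ici 0 ×ˢ Ici 0)
      (c.point k u 0, c.point k u 1) ∧ f' (unit k) = m.a k * totalRate m := by
  have hnn := c.point_nonneg k hu
  obtain ⟨hD, κ, B, s₀, hκ, hs₀, hrate, hB⟩ := c.exists_rates k hu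
  obtain ⟨f', hf⟩ := hH (c.point k u 0, c.point k u 1) ⟨hnn 0, hnn 1⟩
  exact ⟨f', hf, hD.fderiv_eq hnn ((hc _ hnn).trans_le (c.oneStepValue_le hD)) hpos hf hκ hs₀
    hrate hB⟩

end Curve

end Collab

end

/-! ### The partial derivatives along the two curves -/

theorem mainTheorem9 (m : Collab.Model) (n : ℕ) (hn : 1 ≤ n)
    (hH : DifferentiableOn ℝ (fun q : ℝ × ℝ => Collab.H m (n - 1) q.1 q.2)
      (Set.Ici 0 ×ˢ Set.Ici 0))
    (c : Collab.Curve m)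
    (hc : ∀ z : Fin 2 → ℝ, (∀ k, 0 ≤ z k) →
      Collab.stepValue m n z = c.oneStepValue (Collab.stepValue m (n - 1)) z) :
    (∀ u ∈ Set.Icc (c.base 0) (c.M 0), 0 < u + m.p 0 / m.p 1 * c.ξ 0 u →
      HasDerivAt (fun x => Collab.H m (n - 1) x (c.ξ 0 u))
        (m.a 0 * (m.δ + (m.lam 0 + m.lam 1))) (u + m.p 0 / m.p 1 * c.ξ 0 u)) ∧
    (∀ v ∈ Set.Icc (c.base 1) (c.M 1), 0 < v + m.p 1 / m.p 0 * c.ξ 1 v →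
      HasDerivAt (fun y => Collab.H m (n - 1) (c.ξ 1 v) y)
        (m.a 1 * (m.δ + (m.lam 0 + m.lam 1))) (v + m.p 1 / m.p 0 * c.ξ 1 v)) := by
  obtain ⟨n, rfl⟩ := Nat.exists_eq_add_of_le' hn
  rw [Nat.add_sub_cancel] at hH hc ⊢
  constructor
  · intro u hu hpos
    have h0 : c.point 0 u 0 = u + m.p 0 / m.p 1 * c.ξ 0 u := c.point_self 0 u
    have h1 : c.point 0 u 1 = c.ξ 0 u := c.point_other 0 u
    obtain ⟨f', hf, hf'⟩ := c.fderiv_eq 0 hH hc hu (h0 ▸ hpos)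
    rw [h0, h1] at hf
    have hline : HasDerivAt (fun x : ℝ => (x, c.ξ 0 u)) ((1 : ℝ), (0 : ℝ))
        (u + m.p 0 / m.p 1 * c.ξ 0 u) := (hasDerivAt_id _).prodMk (hasDerivAt_const _ _)
    -- The derivative of `H` is relative to the closed quadrant. As the first coordinate is
    -- positive, the horizontal line stays in the quadrant near the point, also when the point lies
    -- on the axis, so an ordinary two-sided derivative results.
    have h2 := hf.comp_hasDerivAt (f := fun x : ℝ => (x, c.ξ 0 u)) _ hline (by
      filter_upwards [lt_mem_nhds hpos] with x hx
      exact ⟨hx.le, (c.ξ_mem 0 hu).1⟩)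
    have h3 : f' (1, 0) = m.a 0 * (m.δ + (m.lam 0 + m.lam 1)) := by
      simpa [Collab.unit, Collab.totalRate] using hf'
    rw [h3] at h2
    exact h2
  · intro v hv hpos
    have h0 : c.point 1 v 0 = c.ξ 1 v := c.point_other 1 v
    have h1 : c.point 1 v 1 = v + m.p 1 / m.p 0 * c.ξ 1 v := c.point_self 1 v
    obtain ⟨f', hf, hf'⟩ := c.fderiv_eq 1 hH hc hv (h1 ▸ hpos)
    rw [h0, h1] at hf
    have hline : HasDerivAt (fun y : ℝ => (c.ξ 1 v, y)) ((0 : ℝ), (1 : ℝ))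
        (v + m.p 1 / m.p 0 * c.ξ 1 v) := (hasDerivAt_const _ _).prodMk (hasDerivAt_id _)
    have h2 := hf.comp_hasDerivAt (f := fun y : ℝ => (c.ξ 1 v, y)) _ hline (by
      filter_upwards [lt_mem_nhds hpos] with y hy
      exact ⟨(c.ξ_mem 1 hv).1, hy.le⟩)
    have h3 : f' (0, 1) = m.a 1 * (m.δ + (m.lam 0 + m.lam 1)) := by
      simpa [Collab.unit, Collab.totalRate] using hf'
    rw [h3] at h2
    exact h2
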